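/- **Setting.** Let $\gamma>1$ and consider states $w=(\rho,\rho u,B,E)\in\mathbb R^8$ with $u,B\in\mathbb R^3$, $\rho e=E-\tfrac12\rho|u|^2-\tfrac12|B|^2$, $p=(\gamma-1)\rho e$. A state is *admissible* if $\rho>0$ and $p>0$. Let $f_d(w)=\big(\rho u_d,\ \rho u_du-B_dB+(p+\tfrac{|B|^2}2)e_d,\ u_dB-B_du,\ (E+p+\tfrac{|B|^2}2)u_d-(u\cdot B)B_d\big)$ be the ideal MHD fluxes and $S(w)=(0,B,u,u\cdot B)$ the coefficient of the Godunov–Powell (GP) source term. *Nodes.* Let $k\ge1$, let $x_0<\dots<x_k$ be the Legendre–Gauss–Lobatto (LGL) nodes on $[-1,1]$ (the zeros of $(1-x^2)P_k'(x)$), $l_\alpha$ the nodal basis, $\omega_\alpha=\int_{-1}^1l_\alpha$, $D_{\alpha\beta}=l_\beta'(x_\alpha)$, and $(\tau_0,\dots,\tau_k)=(-1,0,\dots,0,1)$. *Fluxes.* Let $f_{d,S}(w,z)$ be a two-point flux that is symmetric and consistent ($f_{d,S}(w,w)=f_d(w)$) on admissible states. For a left and a right state $w_L,w_R$ at an interface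 with normal $e_d$ and signal speeds $S_L=S_L(w_L,w_R)$, $S_R=S_R(w_L,w_R)$ let $$\hat f_d=\frac{S_Rf_d(w_L)-S_Lf_d(w_R)+S_LS_R(w_R-w_L)}{S_R-S_L},\qquad \hat B_d=\frac{S_RB_d(w_L)-S_LB_d(w_R)}{S_R-S_L}$$ (HLL flux). Put $$\alpha^r_d(w,z)=\max\{u_d(w),\bar u_d\}+C_d(w)+\frac{|B(w)-B(z)|}{\sqrt{\rho(w)}+\sqrt{\rho(z)}},\qquad \alpha^l_d(w,z)=\min\{u_d(w),\bar u_d\}-C_d(w)-\frac{|B(w)-B(z)|}{\sqrt{\rho(w)}+\sqrt{\rho(z)}},$$ where $\bar u_d=\frac{\sqrt{\rho(w)}u_d(w)+\sqrt{\rho(z)}u_d(z)}{\sqrt{\rho(w)}+\sqrt{\rho(z)}}$ and $C_d^2=\tfrac12\Big(C_s^2+\tfrac{|B|^2}\rho+\sqrt{\big(C_s^2+\tfrac{|B|^2}\rho\big)^2-4C_s^2\tfrac{B_d^2}\rho}\Big)$, $C_s=\frac p{\rho\sqrt{2e}}$. The signal speeds are assumed to satisfy, for all admissible $w_L,w_R$: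 $S_L\le0\le S_R$, $S_L<S_R$, $S_L\le\alpha^l_d(w_L,w_R)$, $S_R\ge\alpha^r_d(w_R,w_L)$. *Scheme.* On a line of nodal values $v_0,\dots,v_k$ in direction $d$ with exterior traces $e_L,e_R$ put $$R_\alpha=\frac{\tau_\alpha}{\omega_\alpha}F^*_\alpha-2\sum_\beta D_{\alpha\beta}f_{d,S}(v_\alpha,v_\beta)-\sum_\beta D_{\alpha\beta}B_d(v_\beta)S(v_\alpha),$$ where $F^*_0=f_d(v_0)-\hat f_d(e_L,v_0)+S(v_0)\big(B_d(v_0)-\hat B_d(e_L,v_0)\big)$, $F^*_k=f_d(v_k)-\hat f_d(v_k,e_R)+S(v_k)\big(B_d(v_k)-\hat B_d(v_k,e_R)\big)$, and $F_\alpha^*=0$ otherwise; and let $$\mathcal B_d=\hat f_d(e_L,v_0)-\hat f_d(v_k,e_R)+S(v_k)\big(B_d(v_k)-\hat B_d(v_k,e_R)\big)-S(v_0)\big(B_d(v_0)-\hat B_d(e_L,v_0)\big).$$ In 1D, on uniform cells of length $h$, the semi-discrete scheme is $\frac{dw_{i\alpha}}{dt}=\frac2hR_\alpha$ with cell average $\bar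 w=\frac12\sum_\alpha\omega_\alpha w_\alpha$. In 2D, on uniform cells $I_{ij}$ of size $h_x\times h_y$, it is $\frac{dw_{ij\alpha\beta}}{dt}=(L_hw)_{ij\alpha\beta}:=\frac2{h_x}R^x_\alpha+\frac2{h_y}R^y_\beta$ (the line procedure in each direction), with $\bar w=\frac14\sum_{\alpha,\beta}\omega_\alpha\omega_\beta w_{\alpha\beta}$. Exterior traces come from the neighbouring cells; at the domain boundary they are prescribed functions of the numerical solution that are admissible whenever all nodal values are. The field is *locally divergence-free (LDF)* if the piecewise polynomial $(B_1,B_2)$ interpolating the nodal values satisfies $\partial_xB_1+\partial_yB_2=0$ in every cell (in 1D: $\partial_xB_1=0$). *CFL condition.* Let $\sigma_\alpha$ be, on a line as above, $\sigma_0=S_R-\alpha^l_d(v_0,v_k)+\frac{S_R}{S_R-S_L}\frac{|B_d(v_0)-B_d(e_L)|}{\sqrt{\rho(v_0)}}$ with $S_{L,R}=S_{L,R}(e_L,v_0)$; $\sigma_k=\alpha^r_d(v_k,v_0)-S_L+\frac{-S_L}{S_R-S_L}\frac{|B_d(e_R)-B_d(v_k)|}{\sqrt{\rho(v_k)}}$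 with $S_{L,R}=S_{L,R}(v_k,e_R)$; and $\sigma_\alpha=0$ otherwise. A step size $\Delta t\ge0$ satisfies the CFL condition at $w$ if $\Delta t\big(\frac{\sigma_{x,ij\alpha\beta}}{h_x}+\frac{\sigma_{y,ij\alpha\beta}}{h_y}\big)<\frac{\omega_0}2$ at all nodes (in 1D: $\Delta t\,\sigma_{i\alpha}/h<\omega_0/2$). *Limiting.* $P_\tau$ is the composition of the following three steps. (1) The LDF projection: in each cell the Piola image $\hat B_0=(\frac{h_y}2B_1,\frac{h_x}2B_2)$ on $K=[-1,1]^2$ is replaced by $\hat B\in Q^k(K)^2$ such that, for some $\hat p\in M=Q^{k-1,k}+Q^{k,k-1}$, $\int_K\hat B\cdot v+\int_K\hat p\,\nabla\cdot v=\int_K\hat B_0\cdot v$ for all $v\in Q^k(K)^2$ and $\int_Kq\,\nabla\cdot\hat B=0$ for all $q\in M$; the other components are kept. (2) The OEDG damping $w\mapsto\bar w+e^{-\tau\sum_{m=0}^k\delta^m}(w-\bar w)$ in each cell, with arbitrary real coefficients $\delta^m=\delta^m_{ij}(w)$. (3) The Zhang–Shu positivity-preserving (PP) limiter on the LGL nodes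 with a threshold $\varepsilon>0$: in each cell, first $\rho\mapsto\bar\rho+\theta_1(\rho-\bar\rho)$, then $w\mapsto\bar w+\theta_2(w-\bar w)$, where $\theta_1=1$ if $\min\rho\ge\varepsilon_1:=\min(\varepsilon,\bar\rho)$ and $\theta_1=\frac{\bar\rho-\varepsilon_1}{\bar\rho-\min\rho}$ otherwise, and $\theta_2$ is formed in the same way from $\rho e$ at the nodes and at the cell average (minima over the LGL nodes of the cell). **Theorem.** The entropy conservative flux of Chandrashekar, $f_{d,S}=(F^\rho,F^m,F^B,F^E)$ with $\beta=\rho/(2p)$, arithmetic means $\{\cdot\}$, logarithmic means $(\cdot)^{\ln}$ and $$F^\rho=\rho^{\ln}\{u_d\},\quad F^m=F^\rho\{u\}-\{B_d\}\{B\}+\Big(\tfrac{\{\rho\}}{2\{\beta\}}+\tfrac12\{|B|^2\}\Big)e_d,\quad F^B=\tfrac1{\{\beta\}}\big(\{\beta u_d\}\{B\}-\{B_d\}\{\beta u\}\big),$$ $$F^E=\tfrac12\Big(\tfrac1{(\gamma-1)\beta^{\ln}}-\{|u|^2\}\Big)F^\rho+\{u\}\cdot F^m+\{B\}\cdot F^B-\tfrac12\{u_d\}\{|B|^2\}+(\{u\}\cdot\{B\})\{B_d\},$$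 is symmetric and consistent on admissible states, hence a possible choice of $f_{d,S}$, and the following hold. 1. (Evolution of cell averages.) At any time at which the nodal values are admissible, the semi-discrete scheme satisfies in 1D $$h\frac{d\bar w_i}{dt}+\sum_{\alpha,\beta}\omega_\alpha D_{\alpha\beta}B_1(w_{i\beta})S(w_{i\alpha})=\mathcal B_1,$$ and in 2D $$h_xh_y\frac{d\bar w_{ij}}{dt}+\frac{h_xh_y}4\sum_{\alpha,\beta}\omega_\alpha\omega_\beta\,\mathrm{div}_{\alpha\beta}\,S(w_{ij\alpha\beta})=h_y\sum_\beta\frac{\omega_\beta}2\mathcal B_1^{(\beta)}+h_x\sum_\alpha\frac{\omega_\alpha}2\mathcal B_2^{(\alpha)},$$ $$\mathrm{div}_{\alpha\beta}=\frac2{h_x}\sum_pD_{\alpha p}B_1(w_{ijp\beta})+\frac2{h_y}\sum_qD_{\beta q}B_2(w_{ij\alpha q}).$$ 2. In 2D, $\mathrm{div}_{\alpha\beta}$ is the divergence of the polynomial $(B_1,B_2)$ at the $(\alpha,\beta)$-node of $I_{ij}$. In 1D and 2D the volume term (the second term on the left) vanishes if the field is LDF. 3. The LDF projection exists, is unique,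 produces an LDF field and keeps all cell averages. The OEDG damping and the PP limiter preserve the LDF property and all cell averages, and the PP limiter makes all nodal values admissible if all cell averages are admissible. 4. (Forward Euler.) In 1D and 2D: if all nodal values of $w$ are admissible, $w$ is LDF, and $\Delta t\ge0$ satisfies the CFL condition at $w$, then all cell averages of the forward Euler update of $w$ with step $\Delta t$ are admissible. 5. (SSP Runge–Kutta, 2D.) Consider any method whose stages are $w^{n,0}=w^n$, $w^{n,i+1}=P_{\Delta t_n}\big(\sum_{j\le i}a_{ij}(w^{n,j}+r_{ij}\Delta t_nL_h(w^{n,j}))\big)$ for $0\le i<s$, $w^{n+1}=w^{n,s}$, with $\Delta t_n>0$, $a_{ij}\ge0$, $\sum_{j\le i}a_{ij}=1$, $r_{ij}\ge0$. If $w^0$ is LDF with admissible nodal values, and $r_{ij}\Delta t_n$ satisfies the CFL condition at $w^{n,j}$ whenever $a_{ij}\ne0$, then for all $n$ the cell averages of all stages, before and after limiting, are admissible, and all limited stages are LDF with admissible nodal values. The same holds for one step, from an LDF $w^n$ with admissible nodal values, of the third order SSP method $$w^{n,1}=P_{\Delta t}(w^n+\Delta tL_h(w^n)),\quad w^{n,2}=P_{\Delta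 t}\big(\tfrac34w^n+\tfrac14(w^{n,1}+\Delta tL_h(w^{n,1}))\big),\quad w^{n+1}=P_{\Delta t}\big(\tfrac13w^n+\tfrac23(w^{n,2}+\Delta tL_h(w^{n,2}))\big)$$ if $\Delta t>0$ satisfies the CFL condition at $w^n,w^{n,1},w^{n,2}$: the cell averages of the three stages before limiting are admissible, and $w^{n+1}$ is LDF with admissible nodal values and cell averages. -/

import Mathlib

noncomputable section

namespace MHD

open Matrix

/-! ### Ideal MHD with the Godunov-Powell source term -/

/-- Conservative variables `(ρ, ρu, B, E)`. -/
abbrev State : Type := ℝ × (Fin 3 → ℝ) × (Fin 3 → ℝ) × ℝ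

def rho (w : State) : ℝ := w.1

def mom (w : State) : Fin 3 → ℝ := w.2.1

def mag (w : State) : Fin 3 → ℝ := w.2.2.1

def ener (w : State) : ℝ := w.2.2.2

def vel (w : State) : Fin 3 → ℝ := (rho w)⁻¹ • mom w

/-- Internal energy density `ρe = E - |ρu|²/(2ρ) - |B|²/2`. -/
def internal (w : State) : ℝ :=
  ener w - (mom w ⬝ᵥ mom w) / (2 * rho w) - (mag w ⬝ᵥ mag w) / 2

/-- The `γ`-law equation of state `p = (γ - 1) ρ e`. -/
def pressure (γ : ℝ) (w : State) : ℝ := (γ - 1) * internal w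

/-- Positive density and positive pressure. -/
def Admissible (γ : ℝ) (w : State) : Prop := 0 < rho w ∧ 0 < pressure γ w

/-- Total pressure `p + |B|²/2`. -/
def totalPressure (γ : ℝ) (w : State) : ℝ := pressure γ w + (mag w ⬝ᵥ mag w) / 2

/-- The physical flux `f_d` in the direction of the `d`-th coordinate. -/
def flux (γ : ℝ) (d : Fin 3) (w : State) : State :=
  (rho w * vel w d,
   (rho w * vel w d) • vel w - mag w d • mag w + totalPressure γ w • Pi.single d 1,
   vel w d • mag w - mag w d • vel w,
   (ener w + totalPressure γ w) * vel w d - (vel w ⬝ᵥ mag w) * mag w d)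

/-- The coefficient vector `S(w) = (0, B, u, u·B)` of the Godunov-Powell source term. -/
def gpS (w : State) : State := (0, mag w, vel w, vel w ⬝ᵥ mag w)

/-! ### Two-point volume fluxes -/

/-- A family of two-point fluxes that is symmetric and consistent with the physical fluxes. -/
def IsTwoPointFlux (γ : ℝ) (fS : Fin 3 → State → State → State) : Prop :=
  (∀ d w z, Admissible γ w → Admissible γ z → fS d w z = fS d z w) ∧
  ∀ d w, Admissible γ w → fS d w w = flux γ d w

/-- Logarithmic mean. -/
def logMean (a b : ℝ) : ℝ := if a = b then a else (a - b) / (Real.log a - Real.log b)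

/-- `β = ρ / (2p)`. -/
def invTemp (γ : ℝ) (w : State) : ℝ := rho w / (2 * pressure γ w)

/-- The entropy conservative flux of Chandrashekar (and Klingenberg). -/
def chandrashekar (γ : ℝ) (d : Fin 3) (w z : State) : State :=
  let u : Fin 3 → ℝ := (1 / 2 : ℝ) • (vel w + vel z)
  let b : Fin 3 → ℝ := (1 / 2 : ℝ) • (mag w + mag z)
  let r : ℝ := (rho w + rho z) / 2
  let β : ℝ := (invTemp γ w + invTemp γ z) / 2
  let βu : Fin 3 → ℝ := (1 / 2 : ℝ) • (invTemp γ w • vel w + invTemp γ z • vel z)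
  let u2 : ℝ := (vel w ⬝ᵥ vel w + vel z ⬝ᵥ vel z) / 2
  let b2 : ℝ := (mag w ⬝ᵥ mag w + mag z ⬝ᵥ mag z) / 2
  let Fρ : ℝ := logMean (rho w) (rho z) * u d
  let Fm : Fin 3 → ℝ := Fρ • u - b d • b + (r / (2 * β) + b2 / 2) • Pi.single d 1
  let FB : Fin 3 → ℝ := β⁻¹ • (βu d • b - b d • βu)
  (Fρ, Fm, FB,
   (1 / ((γ - 1) * logMean (invTemp γ w) (invTemp γ z)) - u2) / 2 * Fρ
     + u ⬝ᵥ Fm + b ⬝ᵥ FB - u d * b2 / 2 + (u ⬝ᵥ b) * b d)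

/-! ### Positivity-preserving signal speed bounds -/

/-- Fast magnetosonic-type speed `C_d(w)`, in which the speed of sound is replaced by
`C_s = p / (ρ √(2e))`, so that `C_s² = p² / (2 ρ · ρe)`. -/
def fastSpeed (γ : ℝ) (d : Fin 3) (w : State) : ℝ :=
  let cs2 : ℝ := pressure γ w ^ 2 / (2 * rho w * internal w)
  let a : ℝ := cs2 + (mag w ⬝ᵥ mag w) / rho w
  Real.sqrt ((a + Real.sqrt (a ^ 2 - 4 * cs2 * mag w d ^ 2 / rho w)) / 2)

/-- The average of the normal velocities with the weights `√ρ`. -/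
def roeVel (d : Fin 3) (w z : State) : ℝ :=
  (Real.sqrt (rho w) * vel w d + Real.sqrt (rho z) * vel z d) /
    (Real.sqrt (rho w) + Real.sqrt (rho z))

/-- `|B(w) - B(z)| / (√ρ(w) + √ρ(z))`, with the Euclidean norm. -/
def magJumpSpeed (w z : State) : ℝ :=
  Real.sqrt ((mag w - mag z) ⬝ᵥ (mag w - mag z)) / (Real.sqrt (rho w) + Real.sqrt (rho z))

/-- Upper speed bound attached to the state `w`, with partner state `z`. -/
def alphaR (γ : ℝ) (d : Fin 3) (w z : State) : ℝ :=
  max (vel w d) (roeVel d w z) + fastSpeed γ d w + magJumpSpeed w z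

/-- Lower speed bound attached to the state `w`, with partner state `z`. -/
def alphaL (γ : ℝ) (d : Fin 3) (w z : State) : ℝ :=
  min (vel w d) (roeVel d w z) - fastSpeed γ d w - magJumpSpeed w z

/-- Requirements on the signal speed estimates `S_L(w_L, w_R)`, `S_R(w_L, w_R)` of the HLL
flux in each coordinate direction. -/
def PPSpeeds (γ : ℝ) (SL SR : Fin 3 → State → State → ℝ) : Prop :=
  ∀ d wL wR, Admissible γ wL → Admissible γ wR →
    SL d wL wR ≤ 0 ∧ 0 ≤ SR d wL wR ∧ SL d wL wR < SR d wL wR ∧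
    SL d wL wR ≤ alphaL γ d wL wR ∧ alphaR γ d wR wL ≤ SR d wL wR

/-! ### Legendre-Gauss-Lobatto nodes -/

/-- The `k`-th Legendre polynomial (Rodrigues' formula). -/
def legendre (k : ℕ) : Polynomial ℝ :=
  Polynomial.C (1 / (2 ^ k * (k.factorial : ℝ))) *
    (Polynomial.derivative^[k]) ((Polynomial.X ^ 2 - 1) ^ k)

/-- The `k + 1` LGL nodes in increasing order: the zeros of `(1 - x²) P_k'(x)`. Since this
polynomial has degree `k + 1`, for `k ≥ 1` the nodes are determined by these conditions. -/
structure LGLNodes (k : ℕ) where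
  node : Fin (k + 1) → ℝ
  strictMono : StrictMono node
  root : ∀ i, (1 - node i ^ 2) * (Polynomial.derivative (legendre k)).eval (node i) = 0

namespace LGLNodes

variable {k : ℕ} (X : LGLNodes k)

/-- The nodal basis `l_i`. -/
def basis (i : Fin (k + 1)) : Polynomial ℝ := Lagrange.basis Finset.univ X.node i

/-- The quadrature weights `ω_i = ∫ l_i`. -/
def weight (i : Fin (k + 1)) : ℝ := ∫ x in (-1 : ℝ)..1, (X.basis i).eval x

/-- The differentiation matrix `D_{ij} = l_j'(x_i)`. -/
def diff (i j : Fin (k + 1)) : ℝ := (Polynomial.derivative (X.basis j)).eval (X.node i)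

end LGLNodes

/-- The diagonal `(-1, 0, …, 0, 1)`. -/
def tau {k : ℕ} (α : Fin (k + 1)) : ℝ :=
  if α = 0 then -1 else if α = Fin.last k then 1 else 0

/-! ### The nodal scheme along one line of nodes -/

/-- The data of the spatial discretization on the reference element: heat capacity ratio,
LGL nodes, two-point volume flux, and HLL signal speeds. -/
structure Disc (k : ℕ) where
  γ : ℝ
  X : LGLNodes k
  fS : Fin 3 → State → State → State
  SL : Fin 3 → State → State → ℝ
  SR : Fin 3 → State → State → ℝ

namespace Disc

variable {k : ℕ} (S : Disc k)

/-- HLL numerical flux in direction `d`. -/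
def hll (d : Fin 3) (wL wR : State) : State :=
  (S.SR d wL wR - S.SL d wL wR)⁻¹ •
    (S.SR d wL wR • flux S.γ d wL - S.SL d wL wR • flux S.γ d wR
      + (S.SL d wL wR * S.SR d wL wR) • (wR - wL))

/-- The compatible numerical value of the normal magnetic field at the interface. -/
def hllB (d : Fin 3) (wL wR : State) : ℝ :=
  (S.SR d wL wR * mag wL d - S.SL d wL wR * mag wR d) / (S.SR d wL wR - S.SL d wL wR)

/-- The star vector of a line of nodal values `u` with exterior traces `eL`, `eR`. -/
def star (d : Fin 3) (u : Fin (k + 1) → State) (eL eR : State) (α : Fin (k + 1)) : State :=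
  if α = 0 then
    flux S.γ d (u 0) - S.hll d eL (u 0) + (mag (u 0) d - S.hllB d eL (u 0)) • gpS (u 0)
  else if α = Fin.last k then
    flux S.γ d (u (Fin.last k)) - S.hll d (u (Fin.last k)) eR
      + (mag (u (Fin.last k)) d - S.hllB d (u (Fin.last k)) eR) • gpS (u (Fin.last k))
  else 0

/-- The right-hand side of the scheme along a line, before scaling by `2 / h`. -/
def lineRes (d : Fin 3) (u : Fin (k + 1) → State) (eL eR : State) (α : Fin (k + 1)) : State :=
  (tau α / S.X.weight α) • S.star d u eL eR α
    - (2 : ℝ) • ∑ β, S.X.diff α β • S.fS d (u α) (u β)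
    - ∑ β, (S.X.diff α β * mag (u β) d) • gpS (u α)

/-- The boundary terms in the evolution of the average over a line. -/
def lineBoundary (d : Fin 3) (u : Fin (k + 1) → State) (eL eR : State) : State :=
  S.hll d eL (u 0) - S.hll d (u (Fin.last k)) eR
    + (mag (u (Fin.last k)) d - S.hllB d (u (Fin.last k)) eR) • gpS (u (Fin.last k))
    - (mag (u 0) d - S.hllB d eL (u 0)) • gpS (u 0)

/-- The wave speed estimate at the node `α` of a line that enters the CFL condition. It
vanishes at nodes which do not lie on the two end points of the line. -/
def nodeSpeed (d : Fin 3) (u : Fin (k + 1) → State) (eL eR : State) (α : Fin (k + 1)) : ℝ :=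
  let P := u 0
  let Q := u (Fin.last k)
  if α = 0 then
    S.SR d eL P - alphaL S.γ d P Q
      + S.SR d eL P / (S.SR d eL P - S.SL d eL P) * (|mag P d - mag eL d| / Real.sqrt (rho P))
  else if α = Fin.last k then
    alphaR S.γ d Q P - S.SL d Q eR
      + -S.SL d Q eR / (S.SR d Q eR - S.SL d Q eR)
          * (|mag eR d - mag Q d| / Real.sqrt (rho Q))
  else 0

end Disc

/-! ### One space dimension -/

/-- `N` uniform cells on `[a, b]`. -/
structure Grid1 where
  N : ℕ
  a : ℝ
  b : ℝ
  N_pos : 0 < N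
  a_lt_b : a < b

namespace Grid1

def h (G : Grid1) : ℝ := (G.b - G.a) / G.N

/-- Center of the cell `i`. -/
def ctr (G : Grid1) (i : Fin G.N) : ℝ := G.a + ((i : ℝ) + 1 / 2) * G.h

end Grid1

/-- Nodal values of a one-dimensional numerical solution. -/
abbrev Sol1 (k : ℕ) (G : Grid1) : Type := Fin G.N → Fin (k + 1) → State

namespace Disc

variable {k : ℕ} (S : Disc k)

/-- Exterior trace at the left end of the cell `i`; the states `g.1`, `g.2` are the exterior
states prescribed at the two ends of the domain. -/
def extL1 {G : Grid1} (g : State × State) (w : Sol1 k G) (i : Fin G.N) : State :=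
  if h : 0 < i.1 then w ⟨i.1 - 1, by omega⟩ (Fin.last k) else g.1

def extR1 {G : Grid1} (g : State × State) (w : Sol1 k G) (i : Fin G.N) : State :=
  if h : i.1 + 1 < G.N then w ⟨i.1 + 1, h⟩ 0 else g.2

/-- The semi-discrete operator: the scheme is `dw/dt = L1 w`. -/
def L1 {G : Grid1} (bc : Sol1 k G → State × State) (w : Sol1 k G) : Sol1 k G := fun i α =>
  (2 / G.h) • S.lineRes 0 (w i) (extL1 (bc w) w i) (extR1 (bc w) w i) α

/-- Cell average (exact for the interpolating polynomial, because `ω_α = ∫ l_α`). -/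
def avg1 (u : Fin (k + 1) → State) : State := (1 / 2 : ℝ) • ∑ α, S.X.weight α • u α

/-- Volume term of the cell average evolution. -/
def vol1 (u : Fin (k + 1) → State) : State :=
  ∑ α, ∑ β, (S.X.weight α * S.X.diff α β * mag (u β) 0) • gpS (u α)

/-- The polynomial `B_1` on the cell `i`, as a function of the physical coordinate. -/
def magFun1 {G : Grid1} (w : Sol1 k G) (i : Fin G.N) (x : ℝ) : ℝ :=
  ∑ α, mag (w i α) 0 * (S.X.basis α).eval ((x - G.ctr i) / (G.h / 2))

/-- `∂B_1/∂x = 0` in the interior of each cell. -/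
def LDF1 {G : Grid1} (w : Sol1 k G) : Prop :=
  ∀ i, ∀ x ∈ Set.Icc (G.ctr i - G.h / 2) (G.ctr i + G.h / 2), deriv (S.magFun1 w i) x = 0

/-- CFL condition for a forward Euler step of size `t`. -/
def CFL1 {G : Grid1} (bc : Sol1 k G → State × State) (w : Sol1 k G) (t : ℝ) : Prop :=
  ∀ i α, t * (S.nodeSpeed 0 (w i) (extL1 (bc w) w i) (extR1 (bc w) w i) α / G.h)
    < S.X.weight 0 / 2

end Disc

/-! ### Two space dimensions -/

/-- `Nx × Ny` uniform cells on `[a, b] × [c, d]`. -/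
structure Grid where
  Nx : ℕ
  Ny : ℕ
  a : ℝ
  b : ℝ
  c : ℝ
  d : ℝ
  Nx_pos : 0 < Nx
  Ny_pos : 0 < Ny
  a_lt_b : a < b
  c_lt_d : c < d

namespace Grid

def hx (G : Grid) : ℝ := (G.b - G.a) / G.Nx

def hy (G : Grid) : ℝ := (G.d - G.c) / G.Ny

def xc (G : Grid) (i : Fin G.Nx) : ℝ := G.a + ((i : ℝ) + 1 / 2) * G.hx

def yc (G : Grid) (j : Fin G.Ny) : ℝ := G.c + ((j : ℝ) + 1 / 2) * G.hy

/-- The closed cell `I_{ij}`. -/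
def cell (G : Grid) (i : Fin G.Nx) (j : Fin G.Ny) : Set (ℝ × ℝ) :=
  Set.Icc (G.xc i - G.hx / 2) (G.xc i + G.hx / 2) ×ˢ
    Set.Icc (G.yc j - G.hy / 2) (G.yc j + G.hy / 2)

end Grid

/-- Nodal values on one cell; the first index belongs to `x`, the second to `y`. -/
abbrev CellSol (k : ℕ) : Type := Fin (k + 1) → Fin (k + 1) → State

/-- Nodal values of a two-dimensional numerical solution. -/
abbrev Sol (k : ℕ) (G : Grid) : Type := Fin G.Nx → Fin G.Ny → CellSol k

/-- Exterior states at the boundary nodes of the domain. -/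
structure Ghost (k : ℕ) (G : Grid) where
  left : Fin G.Ny → Fin (k + 1) → State
  right : Fin G.Ny → Fin (k + 1) → State
  bottom : Fin G.Nx → Fin (k + 1) → State
  top : Fin G.Nx → Fin (k + 1) → State

def Ghost.AllAdmissible {k : ℕ} {G : Grid} (γ : ℝ) (g : Ghost k G) : Prop :=
  (∀ j β, Admissible γ (g.left j β) ∧ Admissible γ (g.right j β)) ∧
  ∀ i α, Admissible γ (g.bottom i α) ∧ Admissible γ (g.top i α)

/-- All nodal values are admissible. -/
def NodallyAdmissible {k : ℕ} {G : Grid} (γ : ℝ) (w : Sol k G) : Prop :=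
  ∀ i j α β, Admissible γ (w i j α β)

section Traces

variable {k : ℕ} {G : Grid} (g : Ghost k G) (w : Sol k G) (i : Fin G.Nx) (j : Fin G.Ny)

/-- Exterior traces of the cell `(i, j)` at the nodes of its four edges. -/
def extLeft (β : Fin (k + 1)) : State :=
  if h : 0 < i.1 then w ⟨i.1 - 1, by omega⟩ j (Fin.last k) β else g.left j β

def extRight (β : Fin (k + 1)) : State :=
  if h : i.1 + 1 < G.Nx then w ⟨i.1 + 1, h⟩ j 0 β else g.right j β

def extBottom (α : Fin (k + 1)) : State :=
  if h : 0 < j.1 then w i ⟨j.1 - 1, by omega⟩ α (Fin.last k) else g.bottom i α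

def extTop (α : Fin (k + 1)) : State :=
  if h : j.1 + 1 < G.Ny then w i ⟨j.1 + 1, h⟩ α 0 else g.top i α

end Traces

namespace Disc

variable {k : ℕ} (S : Disc k) {G : Grid}

/-- The semi-discrete operator `L_h`: the one-dimensional scheme applied dimension by
dimension. -/
def L (bc : Sol k G → Ghost k G) (w : Sol k G) : Sol k G := fun i j α β =>
  (2 / G.hx) • S.lineRes 0 (fun p => w i j p β)
      (extLeft (bc w) w i j β) (extRight (bc w) w i j β) α
  + (2 / G.hy) • S.lineRes 1 (fun q => w i j α q)
      (extBottom (bc w) w i j α) (extTop (bc w) w i j α) β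

/-- Cell average (exact for the interpolating polynomial, because `ω_α = ∫ l_α`). -/
def avg (c : CellSol k) : State :=
  (1 / 4 : ℝ) • ∑ α, ∑ β, (S.X.weight α * S.X.weight β) • c α β

/-- The boundary terms in the evolution of the cell average. -/
def boundaryTerm (bc : Sol k G → Ghost k G) (w : Sol k G) (i : Fin G.Nx) (j : Fin G.Ny) :
    State :=
  G.hy • ∑ β, (S.X.weight β / 2) • S.lineBoundary 0 (fun p => w i j p β)
      (extLeft (bc w) w i j β) (extRight (bc w) w i j β)
  + G.hx • ∑ α, (S.X.weight α / 2) • S.lineBoundary 1 (fun q => w i j α q)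
      (extBottom (bc w) w i j α) (extTop (bc w) w i j α)

/-- The discrete divergence of `B` at a node, through the differentiation matrix. -/
def discDiv (w : Sol k G) (i : Fin G.Nx) (j : Fin G.Ny) (α β : Fin (k + 1)) : ℝ :=
  2 / G.hx * ∑ p, S.X.diff α p * mag (w i j p β) 0
    + 2 / G.hy * ∑ q, S.X.diff β q * mag (w i j α q) 1

/-- The volume source term in the evolution of the cell average. -/
def volumeTerm (w : Sol k G) (i : Fin G.Nx) (j : Fin G.Ny) : State :=
  (G.hx * G.hy / 4) •
    ∑ α, ∑ β, (S.X.weight α * S.X.weight β * S.discDiv w i j α β) • gpS (w i j α β)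

/-- The polynomial on the reference element with given nodal values. -/
def refInterp (b : Fin (k + 1) → Fin (k + 1) → ℝ) : MvPolynomial (Fin 2) ℝ :=
  ∑ α, ∑ β, MvPolynomial.C (b α β) *
    (Polynomial.aeval (MvPolynomial.X 0) (S.X.basis α) *
      Polynomial.aeval (MvPolynomial.X 1) (S.X.basis β))

/-- The polynomial `B_{d+1}` on the cell `(i, j)`, as a function of the physical
coordinates. -/
def magFun (w : Sol k G) (i : Fin G.Nx) (j : Fin G.Ny) (d : Fin 3) (x y : ℝ) : ℝ :=
  MvPolynomial.eval ![(x - G.xc i) / (G.hx / 2), (y - G.yc j) / (G.hy / 2)]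
    (S.refInterp fun α β => mag (w i j α β) d)

/-- The divergence of the piecewise polynomial magnetic field in the cell `(i, j)`. -/
def divB (w : Sol k G) (i : Fin G.Nx) (j : Fin G.Ny) (x y : ℝ) : ℝ :=
  deriv (fun x' => S.magFun w i j 0 x' y) x + deriv (fun y' => S.magFun w i j 1 x y') y

/-- The magnetic field is locally divergence-free. -/
def LDF (w : Sol k G) : Prop :=
  ∀ i j x y, (x, y) ∈ G.cell i j → S.divB w i j x y = 0

/-- CFL condition for a forward Euler step of size `t`. -/
def CFL (bc : Sol k G → Ghost k G) (w : Sol k G) (t : ℝ) : Prop :=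
  ∀ i j α β,
    t * (S.nodeSpeed 0 (fun p => w i j p β)
            (extLeft (bc w) w i j β) (extRight (bc w) w i j β) α / G.hx
        + S.nodeSpeed 1 (fun q => w i j α q)
            (extBottom (bc w) w i j α) (extTop (bc w) w i j α) β / G.hy)
      < S.X.weight 0 / 2

end Disc

/-! ### The limiting procedure -/

/-- The polynomials of degree at most `a` in the first and `b` in the second variable. -/
def QSpace (a b : ℕ) : Submodule ℝ (MvPolynomial (Fin 2) ℝ) :=
  MvPolynomial.restrictSupport ℝ {n | n 0 ≤ a ∧ n 1 ≤ b}

/-- The multiplier space `Q^{k-1,k} + Q^{k,k-1}`, used for `k ≥ 1`. -/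
def MSpace (k : ℕ) : Submodule ℝ (MvPolynomial (Fin 2) ℝ) :=
  QSpace (k - 1) k ⊔ QSpace k (k - 1)

/-- Integral over the reference element `[-1, 1]²`. -/
def refInt (P : MvPolynomial (Fin 2) ℝ) : ℝ :=
  ∫ x in (-1 : ℝ)..1, ∫ y in (-1 : ℝ)..1, MvPolynomial.eval ![x, y] P

def refDiv (v : Fin 2 → MvPolynomial (Fin 2) ℝ) : MvPolynomial (Fin 2) ℝ :=
  MvPolynomial.pderiv 0 (v 0) + MvPolynomial.pderiv 1 (v 1)

/-- `B` is the first component of a solution `(B, p)` of the saddle point problem on the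
reference element with input `B₀`. -/
def IsRefLDFProjection (k : ℕ) (B₀ B : Fin 2 → MvPolynomial (Fin 2) ℝ) : Prop :=
  (∀ m, B m ∈ QSpace k k) ∧ ∃ p ∈ MSpace k,
    (∀ v : Fin 2 → MvPolynomial (Fin 2) ℝ, (∀ m, v m ∈ QSpace k k) →
      refInt (∑ m, B m * v m) + refInt (p * refDiv v) = refInt (∑ m, B₀ m * v m)) ∧
    ∀ q ∈ MSpace k, refInt (refDiv B * q) = 0

namespace Disc

variable {k : ℕ} (S : Disc k) {G : Grid}

/-- The contravariant Piola transform of `(B_1, B_2)` on the cell `(i, j)`. -/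
def piola (w : Sol k G) (i : Fin G.Nx) (j : Fin G.Ny) : Fin 2 → MvPolynomial (Fin 2) ℝ :=
  ![S.refInterp fun α β => G.hy / 2 * mag (w i j α β) 0,
    S.refInterp fun α β => G.hx / 2 * mag (w i j α β) 1]

/-- `w'` arises from `w` by the LDF projection of `(B_1, B_2)` in every cell; all other
components are unchanged. -/
def IsLDFProjection (w w' : Sol k G) : Prop :=
  ∀ i j,
    (∀ α β, rho (w' i j α β) = rho (w i j α β) ∧ mom (w' i j α β) = mom (w i j α β) ∧
      mag (w' i j α β) 2 = mag (w i j α β) 2 ∧ ener (w' i j α β) = ener (w i j α β)) ∧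
    IsRefLDFProjection k (S.piola w i j) (S.piola w' i j)

/-- The OEDG damping with pseudo time `t` and damping coefficients `δ`. -/
def oedg (δ : Fin (k + 1) → Sol k G → Fin G.Nx → Fin G.Ny → ℝ) (t : ℝ) (w : Sol k G) :
    Sol k G := fun i j α β =>
  S.avg (w i j) + Real.exp (-t * ∑ m, δ m w i j) • (w i j α β - S.avg (w i j))

/-- Smallest nodal value of a scalar quantity in a cell. -/
def nodeMin (q : State → ℝ) (c : CellSol k) : ℝ :=
  Finset.univ.inf' Finset.univ_nonempty
    fun n : Fin (k + 1) × Fin (k + 1) => q (c n.1 n.2)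

/-- Largest scaling factor (at most `1`) of the Zhang-Shu limiter that lifts the minimum `m`
to the threshold `e`, for the mean value `a`. -/
def scale (a e m : ℝ) : ℝ := if e ≤ m then 1 else (a - e) / (a - m)

/-- First step of the PP limiter: only the density is changed. -/
def ppDensity (ε : ℝ) (c : CellSol k) : CellSol k := fun α β =>
  let r := rho (S.avg c)
  (r + scale r (min ε r) (nodeMin rho c) * (rho (c α β) - r),
    mom (c α β), mag (c α β), ener (c α β))

/-- Second step of the PP limiter: all components are scaled towards the cell average. -/
def ppEnergy (ε : ℝ) (c : CellSol k) : CellSol k := fun α β =>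
  let e := internal (S.avg c)
  S.avg c + scale e (min ε e) (nodeMin internal c) • (c α β - S.avg c)

/-- The Zhang-Shu positivity-preserving limiter on the LGL nodes, with threshold `ε`. -/
def ppLimiter (ε : ℝ) (w : Sol k G) : Sol k G := fun i j =>
  S.ppEnergy ε (S.ppDensity ε (w i j))

/-- `out = P_t(raw)`: LDF projection, then OEDG damping, then PP limiter. -/
def IsLimited (δ : Fin (k + 1) → Sol k G → Fin G.Nx → Fin G.Ny → ℝ) (ε t : ℝ)
    (raw out : Sol k G) : Prop :=
  ∃ w, S.IsLDFProjection raw w ∧ out = S.ppLimiter ε (S.oedg δ t w)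

/-- The forward Euler step of size `t`. -/
def euler (bc : Sol k G → Ghost k G) (t : ℝ) (w : Sol k G) : Sol k G := w + t • S.L bc w

/-- All cell averages are admissible. -/
def AvgAdmissible (w : Sol k G) : Prop := ∀ i j, Admissible S.γ (S.avg (w i j))

end Disc

/-! ### Time discretization -/

/-- A Runge-Kutta method of `s` stages each of which is a convex combination of forward Euler
steps from the previous stages: stage `i + 1` is the limited version of
`∑_{j ≤ i} a_{ij} (w^{(j)} + r_{ij} Δt L_h(w^{(j)}))`. -/
structure ConvexEuler where
  s : ℕ
  a : ℕ → ℕ → ℝ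
  r : ℕ → ℕ → ℝ
  a_nonneg : ∀ i < s, ∀ j ≤ i, 0 ≤ a i j
  a_sum : ∀ i < s, ∑ j ∈ Finset.range (i + 1), a i j = 1
  r_nonneg : ∀ i < s, ∀ j ≤ i, 0 ≤ r i j

/-- The value of stage `i + 1` before limiting. -/
def ConvexEuler.raw (R : ConvexEuler) {k : ℕ} (S : Disc k) {G : Grid}
    (bc : Sol k G → Ghost k G) (Δt : ℝ) (W : ℕ → Sol k G) (i : ℕ) : Sol k G :=
  ∑ j ∈ Finset.range (i + 1), R.a i j • S.euler bc (R.r i j * Δt) (W j)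

end MHD

end

open MHD

noncomputable section

namespace MHD

open Polynomial

/-! ### Legendre polynomials and Legendre-Gauss-Lobatto quadrature -/

/-! Admissibility is a nonlinear condition, but it is equivalent to a family of affine ones. For
fixed `v`, `b` and nonzero density, `gqlForm v b w + |b|²/2` equals ρe + ρ|u-v|²/2 + |B-b|²/2
(`gqlForm_add`). So for ρ > 0 the internal energy is the minimum of these affine functions of w,
attained at v = u, b = B. A state is admissible once its density and all these functions are
positive (`admissible_of_forms`). Convexity of the admissible set and concavity of ρe follow, and
positivity of an updated average becomes a scalar estimate that is linear in the update.

The algebra of the averages is summation by parts. LGL quadrature is exact up to degree 2k-1, which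
gives `sbp`. With a symmetric and consistent two-point flux the volume part then sums to a
difference of physical fluxes, which cancels those in the star vector (`sum_weight_lineRes`). Only
interface terms and the nodal divergence times the source coefficient remain, and the latter
vanishes for an LDF field.

The analytic core is the field `split` of `IsPPForm`, proved for the energy forms in `isPPForm_gql`.
It bounds a w - f(w) - b z + f(z) from below, using the fast speed for the quadratic form of a
single state (`fast_bound`) and the magnetic jump speed for the interaction of two states
(`jump_term_le`). Its only defect is κ = v·b times the jump of the normal field. `lineBoundary_ge`
applies it at both interfaces and to the two end states of a line. At the interfaces the defect
combines with the Godunov-Powell term, because φ(S(w)) + κ = (u-v)·(B-b) is controlled by the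
functional divided by √ρ; this is the field-jump part of the CFL speed. The defect left inside a
cell is κ times the discrete net magnetic flux, which is zero for an LDF field (`net_flux_eq_zero`).
Under the CFL condition the updated average is thus bounded below by a positive combination of nodal
values of the functional.

For the limiting step, the LDF projection is a finite-dimensional saddle point problem
(`exists_saddle`). Since the divergence of a Q^k field lies in the multiplier space, the weak
constraint makes it vanish identically. Damping and limiting act on B, in each cell, by scaling
towards the cell average, so divergence-freeness and averages survive. The Runge-Kutta claims follow
by convexity and induction over stages and time steps. -/

theorem intervalIntegrable_eval (p : ℝ[X]) (a b : ℝ) :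
    IntervalIntegrable (fun x => p.eval x) MeasureTheory.volume a b :=
  p.continuous.intervalIntegrable a b

theorem integral_eval_derivative (p : ℝ[X]) :
    ∫ x in (-1 : ℝ)..1, (derivative p).eval x = p.eval 1 - p.eval (-1) :=
  intervalIntegral.integral_eq_sub_of_hasDerivAt (fun x _ => p.hasDerivAt x)
    (intervalIntegrable_eval _ _ _)

theorem integral_mul_derivative (p q : ℝ[X]) (h1 : p.eval 1 * q.eval 1 = 0)
    (h2 : p.eval (-1) * q.eval (-1) = 0) :
    ∫ x in (-1 : ℝ)..1, (derivative p * q).eval x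
      = -∫ x in (-1 : ℝ)..1, (p * derivative q).eval x := by
  have h := integral_eval_derivative (p * q)
  simp only [derivative_mul, eval_add, eval_mul, h1, h2, sub_zero] at h ⊢
  rw [intervalIntegral.integral_add] at h
  · linarith
  · simpa using intervalIntegrable_eval (derivative p * q) (-1) 1
  · simpa using intervalIntegrable_eval (p * derivative q) (-1) 1

/-- If the polynomial were nowhere positive on the interval it would have infinitely many roots
there. -/
theorem integral_eval_pos {p : ℝ[X]} (hp : p ≠ 0)
    (h : ∀ x ∈ Set.Icc (-1 : ℝ) 1, 0 ≤ p.eval x) :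
    0 < ∫ x in (-1 : ℝ)..1, p.eval x := by
  refine intervalIntegral.integral_pos (by norm_num) p.continuous.continuousOn
    (fun x hx => h x (Set.Ioc_subset_Icc_self hx)) ?_
  by_contra hcon
  push Not at hcon
  refine hp (eq_zero_of_infinite_isRoot p
    ((Set.Icc_infinite (by norm_num : (-1 : ℝ) < 1)).mono ?_))
  intro x hx
  exact le_antisymm (hcon x hx) (h x hx)

theorem natDegree_iterate_derivative_eq (p : ℝ[X]) (m : ℕ) (hm : m ≤ p.natDegree) :
    ((derivative^[m]) p).natDegree = p.natDegree - m := by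
  induction m with
  | zero => simp
  | succ m ih =>
    have h := ih (by omega)
    rw [Function.iterate_succ_apply']
    have h2 := degree_derivative (p := (derivative^[m]) p) (by omega)
    rw [natDegree_eq_of_degree_eq_some h2, h]
    omega

theorem natDegree_X_sq_sub_one_pow (k : ℕ) : ((X ^ 2 - 1 : ℝ[X]) ^ k).natDegree = 2 * k := by
  rw [natDegree_pow, show (X ^ 2 - 1 : ℝ[X]) = X ^ 2 - C 1 by simp, natDegree_X_pow_sub_C]
  ring

theorem legendre_coeff_ne_zero (k : ℕ) : (1 / (2 ^ k * (k.factorial : ℝ))) ≠ 0 := by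
  positivity

theorem natDegree_legendre (k : ℕ) : (legendre k).natDegree = k := by
  rw [legendre, natDegree_C_mul (legendre_coeff_ne_zero k), natDegree_iterate_derivative_eq,
    natDegree_X_sq_sub_one_pow]
  · omega
  · rw [natDegree_X_sq_sub_one_pow]; omega

theorem natDegree_derivative_legendre {k : ℕ} (hk : 1 ≤ k) :
    (derivative (legendre k)).natDegree = k - 1 := by
  have h := natDegree_iterate_derivative_eq (legendre k) 1 (by rw [natDegree_legendre]; exact hk)
  rwa [natDegree_legendre] at h

theorem derivative_legendre_ne_zero {k : ℕ} (hk : 1 ≤ k) : derivative (legendre k) ≠ 0 := by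
  intro h
  have := derivative_eq_zero.1 h
  rw [natDegree_legendre] at this
  omega

/-- Repeated integration by parts in Rodrigues' formula. -/
theorem integral_iterate_derivative_mul (k m : ℕ) (hm : m ≤ k) (q : ℝ[X]) :
    ∫ x in (-1 : ℝ)..1, ((derivative^[m]) ((X ^ 2 - 1 : ℝ[X]) ^ k) * q).eval x
      = (-1) ^ m * ∫ x in (-1 : ℝ)..1, ((X ^ 2 - 1 : ℝ[X]) ^ k * (derivative^[m]) q).eval x := by
  induction m generalizing q with
  | zero => simp
  | succ m ih =>
    -- Fewer than `k` derivatives leave a factor `X² - 1`, so the boundary terms at ±1 vanish.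
    have hdvd : (X ^ 2 - 1 : ℝ[X]) ∣ (derivative^[m]) ((X ^ 2 - 1 : ℝ[X]) ^ k) :=
      (dvd_pow_self _ (by omega)).trans (pow_sub_dvd_iterate_derivative_pow _ k m)
    obtain ⟨r, hr⟩ := hdvd
    rw [Function.iterate_succ_apply', integral_mul_derivative, ih (by omega),
      Function.iterate_succ_apply, pow_succ]
    · ring
    · rw [hr]; simp
    · rw [hr]; simp

theorem integral_legendre_mul {k : ℕ} (q : ℝ[X]) (hq : q.natDegree < k) :
    ∫ x in (-1 : ℝ)..1, (legendre k * q).eval x = 0 := by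
  have h := integral_iterate_derivative_mul k k le_rfl q
  rw [iterate_derivative_eq_zero hq] at h
  simp only [legendre, mul_assoc, eval_C_mul]
  rw [intervalIntegral.integral_const_mul, h]
  simp

/-- The polynomial `(1 - x²) P_k'` is orthogonal to all polynomials of degree at most `k - 2`. -/
theorem integral_lobatto_mul {k : ℕ} (q : ℝ[X]) (hq : q = 0 ∨ q.natDegree + 2 ≤ k) :
    ∫ x in (-1 : ℝ)..1, ((1 - X ^ 2) * derivative (legendre k) * q).eval x = 0 := by
  rcases hq with rfl | hq
  · simp
  have h := integral_mul_derivative (legendre k) ((1 - X ^ 2) * q) (by simp) (by simp)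
  rw [show (1 - X ^ 2) * derivative (legendre k) * q
    = derivative (legendre k) * ((1 - X ^ 2) * q) by ring, h, integral_legendre_mul, neg_zero]
  have h1 : ((1 - X ^ 2 : ℝ[X]) * q).natDegree ≤ 2 + q.natDegree := by
    refine natDegree_mul_le.trans (Nat.add_le_add_right ?_ _)
    compute_degree
  have h2 := natDegree_derivative_le ((1 - X ^ 2 : ℝ[X]) * q)
  omega

/-- Gauss-Lucas, iterated. Once the derivative becomes constant its root set is empty, so no degree
hypothesis is needed. -/
theorem rootSet_iterate_derivative_subset (p : ℂ[X]) (s : Set ℂ) (hs : Convex ℝ s)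
    (hp : p.rootSet ℂ ⊆ s) (m : ℕ) : ((derivative^[m]) p).rootSet ℂ ⊆ s := by
  induction m with
  | zero => simpa
  | succ m ih =>
    rw [Function.iterate_succ_apply']
    by_cases h : 0 < ((derivative^[m]) p).degree
    · exact (rootSet_derivative_subset_convexHull_rootSet h).trans (convexHull_min ih hs)
    · rw [not_lt] at h
      rw [eq_C_of_degree_le_zero h]
      simp

/-- All zeros of `P_k'` lie in `[-1, 1]`. -/
theorem abs_le_one_of_derivative_legendre_root {k : ℕ} (hk : 1 ≤ k) {x : ℝ}
    (hx : (derivative (legendre k)).eval x = 0) : x ∈ Set.Icc (-1 : ℝ) 1 := by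
  have hne := derivative_legendre_ne_zero hk
  have hform : derivative (legendre k) = C (1 / (2 ^ k * (k.factorial : ℝ))) *
      (derivative^[k + 1]) ((X ^ 2 - 1) ^ k) := by
    rw [legendre, derivative_C_mul, Function.iterate_succ_apply']
  rw [hform] at hx hne
  have hx' : ((derivative^[k + 1]) ((X ^ 2 - 1 : ℝ[X]) ^ k)).eval x = 0 := by
    rw [eval_C_mul] at hx
    exact (mul_eq_zero.1 hx).resolve_left (legendre_coeff_ne_zero k)
  have hne' : (derivative^[k + 1]) ((X ^ 2 - 1 : ℝ[X]) ^ k) ≠ 0 := right_ne_zero_of_mul hne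
  have hmap : ((derivative^[k + 1]) ((X ^ 2 - 1 : ℝ[X]) ^ k)).map (algebraMap ℝ ℂ)
      = (derivative^[k + 1]) ((X ^ 2 - 1 : ℂ[X]) ^ k) := by
    rw [← iterate_derivative_map]; simp
  have hmem : (x : ℂ) ∈ ((derivative^[k + 1]) ((X ^ 2 - 1 : ℂ[X]) ^ k)).rootSet ℂ := by
    rw [← hmap, mem_rootSet]
    refine ⟨(Polynomial.map_ne_zero_iff (algebraMap ℝ ℂ).injective).2 hne', ?_⟩
    rw [coe_aeval_eq_eval, ← Complex.coe_algebraMap, eval_map_algebraMap, aeval_algebraMap_apply,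
      coe_aeval_eq_eval, hx', map_zero]
  -- Up to a constant, `P_k'` is a derivative of `(X² - 1)^k`, whose complex roots are only ±1; the
  -- convex set is the segment between them.
  have hsub := rootSet_iterate_derivative_subset ((X ^ 2 - 1 : ℂ[X]) ^ k)
    (segment ℝ (-1 : ℂ) 1) (convex_segment _ _) (by
      intro z hz
      rw [mem_rootSet] at hz
      have : z ^ 2 - 1 = 0 := by
        have := hz.2
        simp only [map_pow, map_sub, aeval_X, map_one] at this
        exact pow_eq_zero_iff (by omega) |>.1 this
      have h2 : (z - 1) * (z + 1) = 0 := by linear_combination this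
      rcases mul_eq_zero.1 h2 with h | h
      · rw [sub_eq_zero.1 h]; exact right_mem_segment _ _ _
      · rw [eq_neg_of_add_eq_zero_left h]; exact left_mem_segment _ _ _) (k + 1) hmem
  obtain ⟨a, b, ha, hb, hab, he⟩ := hsub
  have := congrArg Complex.re he
  simp at this
  constructor <;> linarith

theorem legendre_comp_neg (k : ℕ) : (legendre k).comp (-X) = (-1) ^ k * legendre k := by
  have h : ∀ (m : ℕ) (p : ℝ[X]), ((derivative^[m]) p).comp (-X)
      = (-1) ^ m * (derivative^[m]) (p.comp (-X)) := by
    intro m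
    induction m with
    | zero => intro p; simp
    | succ m ih =>
      intro p
      rw [Function.iterate_succ_apply, ih, Function.iterate_succ_apply, derivative_comp]
      simp only [derivative_neg, derivative_X, neg_mul, one_mul, iterate_derivative_neg, pow_succ]
      ring
  rw [legendre, mul_comp, C_comp, h]
  simp only [pow_comp, sub_comp, X_comp, one_comp, neg_sq]
  ring

/-- Parity of `P_k`, squared so that the sign depending on `k` disappears. It yields the equality of
the two end weights. -/
theorem eval_neg_derivative_legendre_sq (k : ℕ) (x : ℝ) :
    (derivative (legendre k)).eval (-x) ^ 2 = (derivative (legendre k)).eval x ^ 2 := by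
  have h := congrArg (fun p => (derivative p).eval x) (legendre_comp_neg k)
  have hd : derivative ((-1) ^ k * legendre k : ℝ[X]) = (-1) ^ k * derivative (legendre k) := by
    have : ((-1) ^ k : ℝ[X]) = C ((-1) ^ k) := by simp
    rw [this, derivative_C_mul]
  simp only [derivative_comp, hd] at h
  simp only [derivative_neg, derivative_X, eval_mul, eval_neg, eval_one, eval_comp, eval_X,
    eval_pow] at h
  have h2 := congrArg (· ^ 2) h
  simp only [mul_pow, neg_sq, one_pow, one_mul] at h2
  rw [h2, ← pow_mul, mul_comm k, pow_mul, neg_sq, one_pow, one_pow, one_mul]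

end MHD

end

noncomputable section

namespace MHD

open Polynomial

/-! ### LGL nodes, exactness and positivity of the quadrature, summation by parts -/

namespace LGLNodes

variable {k : ℕ} (X : LGLNodes k)

theorem injOn : Set.InjOn X.node (Finset.univ : Finset (Fin (k + 1))) :=
  X.strictMono.injective.injOn

theorem eval_basis (i j : Fin (k + 1)) :
    (X.basis i).eval (X.node j) = if i = j then 1 else 0 := by
  split_ifs with h
  · subst h; exact Lagrange.eval_basis_self X.injOn (Finset.mem_univ _)
  · exact Lagrange.eval_basis_of_ne h (Finset.mem_univ _)

theorem natDegree_basis (i : Fin (k + 1)) : (X.basis i).natDegree = k := by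
  have := Lagrange.natDegree_basis X.injOn (Finset.mem_univ i)
  simpa [basis] using this

theorem sum_basis : ∑ i, X.basis i = 1 :=
  Lagrange.sum_basis X.injOn Finset.univ_nonempty

theorem eq_sum_basis {f : ℝ[X]} (hf : f.natDegree ≤ k) :
    f = ∑ i, C (f.eval (X.node i)) * X.basis i := by
  have h := Lagrange.eq_interpolate (f := f) X.injOn (by
    refine degree_le_natDegree.trans_lt ?_
    simp only [Finset.card_univ, Fintype.card_fin]
    exact_mod_cast Nat.lt_succ_of_le hf)
  rw [Lagrange.interpolate_apply] at h
  exact h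

/-- The polynomial whose zeros are the LGL nodes. -/
def lobatto (k : ℕ) : ℝ[X] := (1 - Polynomial.X ^ 2) * derivative (legendre k)

theorem eval_lobatto_node (i : Fin (k + 1)) : (lobatto k).eval (X.node i) = 0 := by
  simpa [lobatto] using X.root i

theorem natDegree_lobatto (hk : 1 ≤ k) : (lobatto k).natDegree = k + 1 := by
  have h : (1 - Polynomial.X ^ 2 : ℝ[X]).natDegree = 2 := by compute_degree!
  rw [lobatto, natDegree_mul (ne_zero_of_natDegree_gt (n := 0) (by omega))
    (derivative_legendre_ne_zero hk), h, natDegree_derivative_legendre hk]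
  omega

theorem lobatto_ne_zero (hk : 1 ≤ k) : lobatto k ≠ 0 :=
  ne_zero_of_natDegree_gt (n := 0) (by rw [natDegree_lobatto hk]; omega)

/-- A polynomial of degree `k + 1` with `k + 1` distinct zeros is its leading coefficient times the
nodal polynomial: the difference has smaller degree and vanishes at all nodes. Hence the nodes
exhaust the zeros, and ±1 are among them. -/
theorem lobatto_eq_nodal (hk : 1 ≤ k) :
    lobatto k = C (lobatto k).leadingCoeff * Lagrange.nodal Finset.univ X.node := by
  have hlc : (lobatto k).leadingCoeff ≠ 0 := leadingCoeff_ne_zero.2 (lobatto_ne_zero hk)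
  have hdeg : (lobatto k).degree = ((k + 1 : ℕ) : WithBot ℕ) := by
    rw [degree_eq_natDegree (lobatto_ne_zero hk), natDegree_lobatto hk]
  refine Polynomial.eq_of_degree_sub_lt_of_eval_index_eq _ X.injOn ?_ ?_
  · have : (C (lobatto k).leadingCoeff * Lagrange.nodal Finset.univ X.node).degree
        = (lobatto k).degree := by
      rw [degree_C_mul hlc, Lagrange.degree_nodal, hdeg]; simp
    have h := degree_sub_lt_left this.symm (lobatto_ne_zero hk) (by
      rw [leadingCoeff_mul, leadingCoeff_C, Lagrange.nodal_monic.leadingCoeff, mul_one])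
    rw [hdeg] at h
    simpa using h
  · intro i _
    rw [X.eval_lobatto_node, eval_mul, Lagrange.eval_nodal_at_node (Finset.mem_univ i), mul_zero]

theorem exists_node_eq (hk : 1 ≤ k) {x : ℝ} (hx : (lobatto k).eval x = 0) :
    ∃ i, X.node i = x := by
  rw [X.lobatto_eq_nodal hk, eval_C_mul, Lagrange.eval_nodal] at hx
  have := (mul_eq_zero.1 hx).resolve_left (leadingCoeff_ne_zero.2 (lobatto_ne_zero hk))
  obtain ⟨i, _, hi⟩ := Finset.prod_eq_zero_iff.1 this
  exact ⟨i, (sub_eq_zero.1 hi).symm⟩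

theorem node_mem_Icc (hk : 1 ≤ k) (i : Fin (k + 1)) : X.node i ∈ Set.Icc (-1 : ℝ) 1 := by
  rcases mul_eq_zero.1 (X.root i) with h | h
  · constructor <;> nlinarith
  · exact abs_le_one_of_derivative_legendre_root hk h

theorem node_zero (hk : 1 ≤ k) : X.node 0 = -1 := by
  obtain ⟨i, hi⟩ := X.exists_node_eq hk (x := -1) (by simp [lobatto])
  have := X.strictMono.monotone (Fin.zero_le i)
  have := (X.node_mem_Icc hk 0).1
  linarith

theorem node_last (hk : 1 ≤ k) : X.node (Fin.last k) = 1 := by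
  obtain ⟨i, hi⟩ := X.exists_node_eq hk (x := 1) (by simp [lobatto])
  have := X.strictMono.monotone (Fin.le_last i)
  have := (X.node_mem_Icc hk (Fin.last k)).2
  linarith

theorem integral_sum_basis (c : Fin (k + 1) → ℝ) :
    ∫ x in (-1 : ℝ)..1, (∑ i, C (c i) * X.basis i).eval x = ∑ i, X.weight i * c i := by
  simp only [eval_finsetSum, eval_C_mul]
  rw [intervalIntegral.integral_finsetSum
    (fun i _ => (intervalIntegrable_eval (X.basis i) (-1) 1).const_mul _)]
  refine Finset.sum_congr rfl fun i _ => ?_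
  rw [intervalIntegral.integral_const_mul, weight, mul_comm]

theorem sum_weight : ∑ i, X.weight i = 2 := by
  have h := X.integral_sum_basis (fun _ => 1)
  simp only [map_one, one_mul, mul_one, X.sum_basis, eval_one] at h
  rw [← h]
  norm_num

/-- The LGL quadrature rule is exact for polynomials of degree at most `2k - 1`. -/
theorem quadrature (hk : 1 ≤ k) (f : ℝ[X]) (hf : f.natDegree ≤ 2 * k - 1) :
    ∑ i, X.weight i * f.eval (X.node i) = ∫ x in (-1 : ℝ)..1, f.eval x := by
  set N := Lagrange.nodal Finset.univ X.node with hN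
  have hmon : N.Monic := Lagrange.nodal_monic
  have hNd : N.natDegree = k + 1 := by simp [hN, Lagrange.natDegree_nodal]
  set q := f /ₘ N
  set r := f %ₘ N
  have hfr : r + N * q = f := modByMonic_add_div f N
  have hrdeg : r.natDegree ≤ k := by
    have := natDegree_modByMonic_lt f hmon (by
      intro h; rw [h] at hNd; simp at hNd)
    rw [hNd] at this
    exact Nat.lt_succ_iff.1 this
  -- Dividing a polynomial of degree at most `2k - 1` by the nodal polynomial leaves a quotient of
  -- degree at most `k - 2`, just what the orthogonality of the Lobatto polynomial allows; otherwise
  -- the quotient is zero.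
  have hq : q.natDegree + 2 ≤ k ∨ q = 0 := by
    by_cases hlt : f.natDegree < k + 1
    · right
      apply (divByMonic_eq_zero_iff hmon).2
      exact degree_lt_degree (hNd.symm ▸ hlt)
    · left
      have := natDegree_divByMonic f hmon
      rw [hNd] at this
      change q.natDegree = _ at this
      omega
  have hNint : ∫ x in (-1 : ℝ)..1, (N * q).eval x = 0 := by
    have h := integral_lobatto_mul (k := k) q hq.symm
    have hl := X.lobatto_eq_nodal hk
    rw [lobatto] at hl
    rw [hl, mul_assoc] at h
    simp only [eval_C_mul] at h
    rw [intervalIntegral.integral_const_mul] at h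
    exact (mul_eq_zero.1 h).resolve_left (leadingCoeff_ne_zero.2 (lobatto_ne_zero hk))
  have hev : ∀ i, f.eval (X.node i) = r.eval (X.node i) := by
    intro i
    rw [← hfr, eval_add, eval_mul, hN, Lagrange.eval_nodal_at_node (Finset.mem_univ i), zero_mul,
      add_zero]
  have hint : ∫ x in (-1 : ℝ)..1, f.eval x = ∫ x in (-1 : ℝ)..1, r.eval x := by
    rw [← hfr]
    simp only [eval_add]
    rw [intervalIntegral.integral_add (intervalIntegrable_eval _ _ _)
      (intervalIntegrable_eval _ _ _), hNint, add_zero]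
  rw [hint]
  conv_rhs => rw [X.eq_sum_basis hrdeg]
  rw [X.integral_sum_basis]
  exact Finset.sum_congr rfl fun i _ => by rw [hev]

theorem weight_pos (hk : 1 ≤ k) (i : Fin (k + 1)) : 0 < X.weight i := by
  set P := derivative (legendre k) with hP
  have hPne : P ≠ 0 := derivative_legendre_ne_zero hk
  set g : ℝ[X] := (Polynomial.X ^ 2 - 1) * P ^ 2 with hg
  have hX2 : (Polynomial.X ^ 2 - 1 : ℝ[X]).natDegree = 2 := by compute_degree!
  have hX2ne : (Polynomial.X ^ 2 - 1 : ℝ[X]) ≠ 0 := ne_zero_of_natDegree_gt (n := 0) (by omega)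
  have hgdeg : g.natDegree = 2 * k := by
    rw [hg, natDegree_mul hX2ne (pow_ne_zero 2 hPne), hX2, natDegree_pow,
      natDegree_derivative_legendre hk]
    omega
  have hglc : g.leadingCoeff = P.leadingCoeff ^ 2 := by
    rw [hg, leadingCoeff_mul, leadingCoeff_pow]
    have : (Polynomial.X ^ 2 - 1 : ℝ[X]).leadingCoeff = 1 := by
      rw [leadingCoeff, hX2]; simp [coeff_one]
    rw [this, one_mul]
  have hlc : P.leadingCoeff ≠ 0 := leadingCoeff_ne_zero.2 hPne
  -- The square of a basis polynomial has degree `2k`, one too many for exactness. This `c` cancels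
  -- its leading term against `c (x² - 1) P_k'²`, which vanishes at all nodes and is nonpositive on
  -- [-1, 1], so the corrected polynomial has the same nodal values and stays nonnegative.
  set c : ℝ := ((X.basis i).leadingCoeff / P.leadingCoeff) ^ 2 with hc
  have hb : X.basis i ≠ 0 := Lagrange.basis_ne_zero X.injOn (Finset.mem_univ i)
  set f : ℝ[X] := X.basis i ^ 2 - C c * g with hf
  have hfdeg : f.natDegree ≤ 2 * k - 1 := by
    have h1 : (X.basis i ^ 2).natDegree = 2 * k := by rw [natDegree_pow, X.natDegree_basis]
    have hle : f.natDegree ≤ 2 * k := by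
      refine (natDegree_sub_le _ _).trans (max_le h1.le ?_)
      exact (natDegree_C_mul_le _ _).trans hgdeg.le
    have hco : f.coeff (2 * k) = 0 := by
      rw [hf, coeff_sub, coeff_C_mul]
      have e1 : (X.basis i ^ 2).coeff (2 * k) = (X.basis i).leadingCoeff ^ 2 := by
        rw [← leadingCoeff_pow, leadingCoeff, h1]
      have e2 : g.coeff (2 * k) = P.leadingCoeff ^ 2 := by
        rw [← hglc, leadingCoeff, hgdeg]
      rw [e1, e2, hc]
      field_simp
      ring
    rcases Nat.lt_or_eq_of_le hle with h | h
    · omega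
    · by_contra
      have : f.leadingCoeff = 0 := by rw [leadingCoeff, h, hco]
      rw [leadingCoeff_eq_zero.1 this] at h
      simp at h
      omega
  have hquad := X.quadrature hk f hfdeg
  have hsum : ∑ j, X.weight j * f.eval (X.node j) = X.weight i := by
    have : ∀ j, X.weight j * f.eval (X.node j) = if i = j then X.weight j else 0 := by
      intro j
      have hgj : g.eval (X.node j) = 0 := by
        have := X.root j
        simp only [hg, eval_mul, eval_sub, eval_pow, eval_X, eval_one]
        linear_combination (-P.eval (X.node j)) * this
      rw [hf, eval_sub, eval_C_mul, hgj, eval_pow, X.eval_basis]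
      split_ifs <;> simp
    simp [this]
  rw [← hsum, hquad]
  refine integral_eval_pos ?_ ?_
  · intro h0
    have h := congrArg (fun p => p.eval (X.node i)) h0
    have hgi : g.eval (X.node i) = 0 := by
      have := X.root i
      simp only [hg, eval_mul, eval_sub, eval_pow, eval_X, eval_one]
      linear_combination (-P.eval (X.node i)) * this
    simp [hf, hgi, X.eval_basis] at h
  · intro x hx
    simp only [hf, hg, eval_sub, eval_mul, eval_pow, eval_C, eval_X, eval_one]
    have hx2 : x ^ 2 ≤ 1 := by nlinarith [hx.1, hx.2]
    have hc0 : 0 ≤ c := sq_nonneg _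
    have h3 : 0 ≤ c * ((1 - x ^ 2) * P.eval x ^ 2) :=
      mul_nonneg hc0 (mul_nonneg (by linarith) (sq_nonneg _))
    nlinarith [sq_nonneg ((X.basis i).eval x)]

theorem sum_eq_of_ends {M : Type*} [AddCommMonoid M] (hk : 1 ≤ k) (g : Fin (k + 1) → M)
    (h : ∀ i, i ≠ 0 → i ≠ Fin.last k → g i = 0) : ∑ i, g i = g 0 + g (Fin.last k) := by
  have hne : (0 : Fin (k + 1)) ≠ Fin.last k := by
    intro h; have := congrArg Fin.val h; simp at this; omega
  rw [← Finset.sum_pair hne]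
  refine (Finset.sum_subset (Finset.subset_univ _) ?_).symm
  intro i _ hi
  simp only [Finset.mem_insert, Finset.mem_singleton, not_or] at hi
  exact h i hi.1 hi.2

theorem derivative_legendre_node (hk : 1 ≤ k) {i : Fin (k + 1)} (h0 : i ≠ 0)
    (h1 : i ≠ Fin.last k) : (derivative (legendre k)).eval (X.node i) = 0 := by
  refine (mul_eq_zero.1 (X.root i)).resolve_left ?_
  have a := X.strictMono (Fin.pos_of_ne_zero h0)
  have b := X.strictMono (Fin.lt_last_iff_ne_last.2 h1)
  rw [X.node_zero hk] at a
  rw [X.node_last hk] at b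
  intro h
  nlinarith

theorem weight_last (hk : 1 ≤ k) : X.weight (Fin.last k) = X.weight 0 := by
  set P := derivative (legendre k) with hP
  have hPne : P ≠ 0 := derivative_legendre_ne_zero hk
  -- The test polynomials `(1 ± x) P_k'²` vanish at all interior nodes and at one end, so each
  -- isolates one end weight. Their integrals agree under `x ↦ -x`.
  have hdeg : ∀ s : ℝ, ((1 + C s * Polynomial.X) * P ^ 2).natDegree ≤ 2 * k - 1 := by
    intro s
    refine natDegree_mul_le.trans ?_
    rw [natDegree_pow, natDegree_derivative_legendre hk]
    have : (1 + C s * Polynomial.X : ℝ[X]).natDegree ≤ 1 := by compute_degree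
    omega
  have hq : ∀ s : ℝ, X.weight 0 * ((1 - s) * P.eval 1 ^ 2)
      + X.weight (Fin.last k) * ((1 + s) * P.eval 1 ^ 2)
      = ∫ x in (-1 : ℝ)..1, ((1 + C s * Polynomial.X) * P ^ 2).eval x := by
    intro s
    rw [← X.quadrature hk _ (hdeg s), sum_eq_of_ends hk]
    · rw [X.node_zero hk, X.node_last hk]
      simp only [eval_mul, eval_add, eval_one, eval_C, eval_X, eval_pow, hP,
        eval_neg_derivative_legendre_sq]
      ring
    · intro i h0 h1
      simp [hP, X.derivative_legendre_node hk h0 h1]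
  have hsymm : ∫ x in (-1 : ℝ)..1, ((1 + C (1 : ℝ) * Polynomial.X) * P ^ 2).eval x
      = ∫ x in (-1 : ℝ)..1, ((1 + C (-1 : ℝ) * Polynomial.X) * P ^ 2).eval x := by
    have h := intervalIntegral.integral_comp_neg (a := -1) (b := 1)
      (fun x : ℝ => ((1 + C (1 : ℝ) * Polynomial.X) * P ^ 2).eval x)
    rw [neg_neg] at h
    rw [← h]
    refine intervalIntegral.integral_congr fun x _ => ?_
    simp only [eval_mul, eval_add, eval_one, eval_C, eval_X, eval_pow, hP,
      eval_neg_derivative_legendre_sq]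
    ring
  have hpos : 0 < ∫ x in (-1 : ℝ)..1, ((1 + C (1 : ℝ) * Polynomial.X) * P ^ 2).eval x := by
    refine integral_eval_pos (mul_ne_zero ?_ (pow_ne_zero 2 hPne)) ?_
    · intro h
      have := congrArg (fun p => p.eval 1) h
      norm_num at this
    · intro x hx
      simp only [eval_mul, eval_add, eval_one, eval_C, eval_X, eval_pow]
      exact mul_nonneg (by linarith [hx.1]) (sq_nonneg _)
  have e1 := hq 1
  have e2 := hq (-1)
  have hne : P.eval 1 ^ 2 ≠ 0 := by
    intro h
    rw [h] at e1
    simp only [mul_zero, add_zero] at e1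
    linarith
  rw [hsymm] at e1
  have : (X.weight (Fin.last k) - X.weight 0) * P.eval 1 ^ 2 = 0 := by linarith
  exact sub_eq_zero.1 ((mul_eq_zero.1 this).resolve_right hne)

theorem sum_diff (i : Fin (k + 1)) : ∑ j, X.diff i j = 0 := by
  simp only [diff]
  rw [← eval_finsetSum, ← derivative_sum, X.sum_basis]
  simp

/-- The summation-by-parts property. -/
theorem sbp (hk : 1 ≤ k) (i j : Fin (k + 1)) :
    X.weight i * X.diff i j + X.weight j * X.diff j i = if i = j then tau i else 0 := by
  have key : ∀ a b : Fin (k + 1), X.weight a * X.diff a b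
      = ∫ x in (-1 : ℝ)..1, (X.basis a * derivative (X.basis b)).eval x := by
    intro a b
    -- A basis polynomial times the derivative of another has degree at most `2k - 1`, so both
    -- products of weights and differentiation entries are exact integrals and can be integrated by
    -- parts.
    rw [← X.quadrature hk]
    · simp only [eval_mul, X.eval_basis]
      simp [diff]
    · refine natDegree_mul_le.trans ?_
      have := natDegree_derivative_le (X.basis b)
      rw [X.natDegree_basis] at this ⊢
      omega
  have h := integral_eval_derivative (X.basis i * X.basis j)
  rw [key, key, ← intervalIntegral.integral_add (intervalIntegrable_eval _ _ _)
    (intervalIntegrable_eval _ _ _)]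
  have e1 : ∀ a, (X.basis a).eval 1 = if a = Fin.last k then 1 else 0 := fun a => by
    rw [← X.eval_basis, X.node_last hk]
  have e0 : ∀ a, (X.basis a).eval (-1) = if a = 0 then 1 else 0 := fun a => by
    rw [← X.eval_basis, X.node_zero hk]
  simp only [eval_mul, e0, e1, derivative_mul, eval_add] at h
  have hne : (0 : Fin (k + 1)) ≠ Fin.last k := by
    intro h; have := congrArg Fin.val h; simp at this; omega
  calc _ = ∫ x in (-1 : ℝ)..1, ((derivative (X.basis i)).eval x * (X.basis j).eval x
        + (X.basis i).eval x * (derivative (X.basis j)).eval x) := by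
        refine intervalIntegral.integral_congr fun x _ => ?_
        simp only [eval_mul]; ring
    _ = _ := by
        rw [h]
        by_cases hij : i = j
        · subst hij
          by_cases h0 : i = 0
          · subst h0; simp [tau, hne]
          · by_cases h1 : i = Fin.last k
            · subst h1; simp [tau, hne.symm]
            · simp [tau, h0, h1]
        · by_cases h1 : i = Fin.last k
          · have : j ≠ Fin.last k := fun h => hij (h1.trans h.symm)
            by_cases h0 : i = 0
            · exact absurd (h0.symm.trans h1) hne
            · simp [hij, this, h0]
          · by_cases h0 : i = 0
            · have : j ≠ 0 := fun h => hij (h0.trans h.symm)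
              simp [hij, this, h1]
            · simp [hij, h0, h1]

theorem sum_weight_diff (hk : 1 ≤ k) (j : Fin (k + 1)) :
    ∑ i, X.weight i * X.diff i j = tau j := by
  have h : ∀ i, X.weight i * X.diff i j
      = (if i = j then tau i else 0) - X.weight j * X.diff j i := by
    intro i; rw [← X.sbp hk i j]; ring
  simp only [h, Finset.sum_sub_distrib, ← Finset.mul_sum, X.sum_diff]
  simp

end LGLNodes

end MHD

end

noncomputable section

namespace MHD

open Matrix

/-! ### Linear functionals that characterize admissible states -/

theorem mom_eq {w : State} (h : rho w ≠ 0) : mom w = rho w • vel w := by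
  rw [vel, smul_smul, mul_inv_cancel₀ h, one_smul]

theorem ener_eq {w : State} (h : rho w ≠ 0) :
    ener w = internal w + rho w / 2 * (vel w ⬝ᵥ vel w) + (mag w ⬝ᵥ mag w) / 2 := by
  rw [internal, mom_eq h, smul_dotProduct, dotProduct_smul]
  simp only [smul_eq_mul]
  field_simp
  ring

/-- The functional `w ↦ (|v|²/2, -v, -b, 1) · w`. -/
def gqlForm (v b : Fin 3 → ℝ) : State →ₗ[ℝ] ℝ where
  toFun w := (v ⬝ᵥ v) / 2 * rho w - v ⬝ᵥ mom w - b ⬝ᵥ mag w + ener w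
  map_add' w z := by
    simp only [rho, mom, mag, ener, Prod.fst_add, Prod.snd_add, dotProduct_add]; ring
  map_smul' a w := by
    simp only [rho, mom, mag, ener, Prod.smul_fst, Prod.smul_snd, dotProduct_smul, smul_eq_mul,
      RingHom.id_apply]
    ring

theorem gqlForm_apply (v b : Fin 3 → ℝ) (w : State) :
    gqlForm v b w = (v ⬝ᵥ v) / 2 * rho w - v ⬝ᵥ mom w - b ⬝ᵥ mag w + ener w := rfl

/-- The density as a linear functional. -/
def rhoForm : State →ₗ[ℝ] ℝ := LinearMap.fst ℝ _ _

theorem rhoForm_apply (w : State) : rhoForm w = rho w := rfl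

theorem dot3 (a b : Fin 3 → ℝ) : a ⬝ᵥ b = a 0 * b 0 + a 1 * b 1 + a 2 * b 2 := by
  simp [dotProduct, Fin.sum_univ_three]

theorem dotProduct_self_nonneg' (a : Fin 3 → ℝ) : 0 ≤ a ⬝ᵥ a := by
  rw [dot3]
  linarith [mul_self_nonneg (a 0), mul_self_nonneg (a 1), mul_self_nonneg (a 2)]

/-- Completing the squares in velocity and magnetic field. The two squares are what the later
estimates spend on flux and source terms. -/
theorem gqlForm_add {w : State} (h : rho w ≠ 0) (v b : Fin 3 → ℝ) :
    gqlForm v b w + (b ⬝ᵥ b) / 2 = internal w + rho w / 2 * ((vel w - v) ⬝ᵥ (vel w - v))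
      + ((mag w - b) ⬝ᵥ (mag w - b)) / 2 := by
  rw [gqlForm_apply, ener_eq h, mom_eq h]
  simp only [dot3, Pi.sub_apply, Pi.smul_apply, smul_eq_mul]
  ring

/-- Identifies `κ = v ⬝ᵥ b`: adding it to the source coefficient leaves a product of deviations,
which the squares in `gqlForm_add` control. -/
theorem gqlForm_gpS (w : State) (v b : Fin 3 → ℝ) :
    gqlForm v b (gpS w) + v ⬝ᵥ b = (vel w - v) ⬝ᵥ (mag w - b) := by
  rw [gqlForm_apply]
  simp only [gpS, rho, mom, mag, ener]
  simp only [dot3, Pi.sub_apply]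
  ring

theorem gqlForm_flux {γ : ℝ} {w : State} (h : rho w ≠ 0) (d : Fin 3) (v b : Fin 3 → ℝ) :
    gqlForm v b (flux γ d w) = vel w d * gqlForm v b w
      + (pressure γ w + (mag w ⬝ᵥ mag w) / 2) * (vel w d - v d)
      - mag w d * ((vel w - v) ⬝ᵥ (mag w - b) - v ⬝ᵥ b) := by
  rw [gqlForm_apply, gqlForm_apply, ener_eq h, mom_eq h]
  have hd : v ⬝ᵥ Pi.single d (1 : ℝ) = v d := by simp
  have e : v ⬝ᵥ mom (flux γ d w) = rho w * vel w d * (v ⬝ᵥ vel w) - mag w d * (v ⬝ᵥ mag w)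
      + totalPressure γ w * v d := by
    simp only [flux, mom, dotProduct_add, dotProduct_sub, dotProduct_smul, hd, smul_eq_mul]
  have e2 : b ⬝ᵥ mag (flux γ d w) = vel w d * (b ⬝ᵥ mag w) - mag w d * (b ⬝ᵥ vel w) := by
    simp only [flux, mag, dotProduct_sub, dotProduct_smul, smul_eq_mul]
  have e3 : rho (flux γ d w) = rho w * vel w d := rfl
  have e4 : ener (flux γ d w) = (ener w + totalPressure γ w) * vel w d
      - (vel w ⬝ᵥ mag w) * mag w d := rfl
  rw [e, e2, e3, e4, ener_eq h, totalPressure]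
  simp only [dot3, Pi.sub_apply, Pi.smul_apply, smul_eq_mul]
  ring

theorem internal_pos {γ : ℝ} (hγ : 1 < γ) {w : State} (h : Admissible γ w) : 0 < internal w :=
  (mul_pos_iff_of_pos_left (sub_pos.2 hγ)).1 h.2

theorem admissible_iff {γ : ℝ} (hγ : 1 < γ) {w : State} :
    Admissible γ w ↔ 0 < rho w ∧ 0 < internal w := by
  rw [Admissible, pressure, mul_pos_iff_of_pos_left (sub_pos.2 hγ)]

theorem gqlForm_add_ge {γ : ℝ} (hγ : 1 < γ) {w : State} (h : Admissible γ w)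
    (v b : Fin 3 → ℝ) :
    rho w / 2 * ((vel w - v) ⬝ᵥ (vel w - v)) + ((mag w - b) ⬝ᵥ (mag w - b)) / 2
      < gqlForm v b w + (b ⬝ᵥ b) / 2 := by
  rw [gqlForm_add h.1.ne']
  linarith [internal_pos hγ h]

/-! ### The fast speed bound -/

/-- Young's inequality in a form that needs no division by `A`, which may vanish when the fast speed
equals the sound speed. -/
theorem mul_le_half_of_sq_le {n x A M B : ℝ} (hA : 0 ≤ A) (hM : 0 ≤ M) (hB : 0 ≤ B)
    (h : x ^ 2 ≤ A * M * B) : n * x ≤ (A * n ^ 2 + M * B) / 2 := by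
  refine (le_abs_self _).trans (abs_le_of_sq_le_sq ?_ (by positivity))
  have h1 : n ^ 2 * x ^ 2 ≤ n ^ 2 * (A * M * B) := mul_le_mul_of_nonneg_left h (sq_nonneg n)
  nlinarith [sq_nonneg (A * n ^ 2 - M * B)]

/-- The bound of the quadratic form of the linearized system by the fast speed `C`. -/
theorem fast_form_le {C cs bd β₁ β₂ : ℝ} (hC : 0 < C) (h1 : cs ^ 2 ≤ C ^ 2)
    (h2 : bd ^ 2 ≤ C ^ 2)
    (hK : (C ^ 2 - cs ^ 2) * (C ^ 2 - bd ^ 2) = (β₁ ^ 2 + β₂ ^ 2) * C ^ 2)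
    (y n t₁ t₂ b₁ b₂ : ℝ) :
    n * (cs * y + β₁ * b₁ + β₂ * b₂) - bd * (t₁ * b₁ + t₂ * b₂)
      ≤ C / 2 * (y ^ 2 + n ^ 2 + t₁ ^ 2 + t₂ ^ 2 + b₁ ^ 2 + b₂ ^ 2) := by
  -- Cauchy-Schwarz for the tangential fields; the characteristic equation `hK` turns its constant
  -- into the product of the two gaps.
  have hx : (C * (β₁ * b₁ + β₂ * b₂)) ^ 2
      ≤ (C ^ 2 - cs ^ 2) * (C ^ 2 - bd ^ 2) * (b₁ ^ 2 + b₂ ^ 2) := by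
    rw [hK]
    have : 0 ≤ C ^ 2 * (β₁ * b₂ - β₂ * b₁) ^ 2 := by positivity
    nlinarith
  have hn := mul_le_half_of_sq_le (n := n) (sub_nonneg.2 h1) (sub_nonneg.2 h2) (by positivity) hx
  -- After multiplication by `C`, Young's inequality for `y n`, `t₁ b₁` and `t₂ b₂` uses up `cs² n²`
  -- and `bd² (b₁² + b₂²)`; the mixed term `hn` needs exactly the remaining `C² - cs²` and `C² -
  -- bd²`.
  refine le_of_mul_le_mul_left ?_ hC
  nlinarith [sq_nonneg (C * y - cs * n), sq_nonneg (C * t₁ + bd * b₁),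
    sq_nonneg (C * t₂ + bd * b₂)]

/-- The squared fast speed is the larger root of K² - (C_s² + |B|²/ρ) K + C_s² B_d²/ρ = 0, written
in factored form. The discriminant is at least (C_s² - B_d²/ρ)², so this root dominates both C_s²
and B_d²/ρ. -/
theorem fastSpeed_spec {γ : ℝ} {w : State} (hγ : 1 < γ) (h : Admissible γ w) (d : Fin 3) :
    0 < fastSpeed γ d w ∧
    pressure γ w ^ 2 / (2 * rho w * internal w) ≤ fastSpeed γ d w ^ 2 ∧
    mag w d ^ 2 / rho w ≤ fastSpeed γ d w ^ 2 ∧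
    (fastSpeed γ d w ^ 2 - pressure γ w ^ 2 / (2 * rho w * internal w))
        * (fastSpeed γ d w ^ 2 - mag w d ^ 2 / rho w)
      = ((mag w ⬝ᵥ mag w) / rho w - mag w d ^ 2 / rho w) * fastSpeed γ d w ^ 2 := by
  have hρ := h.1
  have hi := internal_pos hγ h
  have hp := h.2
  set cs2 := pressure γ w ^ 2 / (2 * rho w * internal w) with hcs
  have hcs0 : 0 < cs2 := by positivity
  set bd := mag w d ^ 2 / rho w with hbd
  set B := (mag w ⬝ᵥ mag w) / rho w with hB
  have hbd0 : 0 ≤ bd := by positivity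
  have hBbd : bd ≤ B := by
    apply div_le_div_of_nonneg_right _ hρ.le
    rw [dot3]
    fin_cases d <;> simp <;> nlinarith [sq_nonneg (mag w 0), sq_nonneg (mag w 1),
      sq_nonneg (mag w 2)]
  have hdisc : (cs2 - bd) ^ 2 ≤ (cs2 + B) ^ 2 - 4 * cs2 * bd := by
    nlinarith [mul_nonneg hcs0.le (sub_nonneg.2 hBbd)]
  set r := Real.sqrt ((cs2 + B) ^ 2 - 4 * cs2 * bd) with hr
  have hr2 : r ^ 2 = (cs2 + B) ^ 2 - 4 * cs2 * bd :=
    Real.sq_sqrt ((sq_nonneg _).trans hdisc)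
  have hrabs : |cs2 - bd| ≤ r := Real.abs_le_sqrt hdisc
  have hf : fastSpeed γ d w = Real.sqrt ((cs2 + B + r) / 2) := by
    rw [hr, fastSpeed, hbd, mul_div_assoc]
  have hr0 : 0 ≤ r := Real.sqrt_nonneg _
  have hK0 : 0 < (cs2 + B + r) / 2 := by linarith
  have hf2 : fastSpeed γ d w ^ 2 = (cs2 + B + r) / 2 := by rw [hf, Real.sq_sqrt hK0.le]
  rw [hf2]
  refine ⟨by rw [hf]; exact Real.sqrt_pos.2 hK0, ?_, ?_, ?_⟩
  · linarith [le_abs_self (cs2 - bd)]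
  · linarith [neg_abs_le (cs2 - bd)]
  · linear_combination hr2 / 4

/-- With velocities weighted by √ρ and `y = √(2ρe)` the energy becomes half a sum of squares and the
pressure term acquires the coefficient p/(ρ√(2e)), which explains the modified sound speed. The
normal field components cancel on the left, so only tangential ones reach `fast_form_le`. The
hypothesis `hsum` lets one proof serve all three directions. -/
theorem fast_bound_aux {γ : ℝ} (hγ : 1 < γ) {w : State} (h : Admissible γ w)
    (d i j : Fin 3) (hsum : ∀ x y : Fin 3 → ℝ, x ⬝ᵥ y = x d * y d + x i * y i + x j * y j)
    (θ b : Fin 3 → ℝ) :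
    pressure γ w * θ d - mag w d * (θ ⬝ᵥ b) + (mag w ⬝ᵥ b) * θ d
      ≤ fastSpeed γ d w * (internal w + rho w / 2 * (θ ⬝ᵥ θ) + (b ⬝ᵥ b) / 2) := by
  obtain ⟨hC, h1, h2, h3⟩ := fastSpeed_spec hγ h d
  have hρ := h.1
  have hi := internal_pos hγ h
  set C := fastSpeed γ d w
  set s := Real.sqrt (rho w) with hs
  have hs0 : 0 < s := Real.sqrt_pos.2 hρ
  have hs2 : rho w = s ^ 2 := (Real.sq_sqrt hρ.le).symm
  set y := Real.sqrt (2 * internal w) with hy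
  have hy0 : 0 < y := Real.sqrt_pos.2 (by linarith)
  have hy2 : internal w = y ^ 2 / 2 := by rw [hy, Real.sq_sqrt (by linarith)]; ring
  have e1 : pressure γ w ^ 2 / (2 * rho w * internal w) = (pressure γ w / (s * y)) ^ 2 := by
    rw [hs2, hy2]; field_simp
  have e2 : mag w d ^ 2 / rho w = (mag w d / s) ^ 2 := by rw [hs2]; field_simp
  have e3 : (mag w ⬝ᵥ mag w) / rho w = (mag w d / s) ^ 2 + (mag w i / s) ^ 2 + (mag w j / s) ^ 2 := by
    rw [hs2, hsum]; field_simp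
  rw [e1] at h1
  rw [e2] at h2
  rw [e1, e2, e3] at h3
  have key := fast_form_le hC h1 h2 (β₁ := mag w i / s) (β₂ := mag w j / s)
    (by rw [h3]; ring) y (s * θ d) (s * θ i) (s * θ j) (b i) (b j)
  have l : s * θ d * (pressure γ w / (s * y) * y + mag w i / s * b i + mag w j / s * b j)
      - mag w d / s * (s * θ i * b i + s * θ j * b j)
      = pressure γ w * θ d - mag w d * (θ ⬝ᵥ b) + (mag w ⬝ᵥ b) * θ d := by
    rw [hsum, hsum]; field_simp; ring
  rw [l] at key
  refine key.trans ?_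
  rw [hsum, hsum, hs2, hy2]
  have := mul_nonneg hC.le (sq_nonneg (b d))
  nlinarith

theorem fast_bound {γ : ℝ} (hγ : 1 < γ) {w : State} (h : Admissible γ w)
    (d : Fin 3) (θ b : Fin 3 → ℝ) :
    pressure γ w * θ d - mag w d * (θ ⬝ᵥ b) + (mag w ⬝ᵥ b) * θ d
      ≤ fastSpeed γ d w * (internal w + rho w / 2 * (θ ⬝ᵥ θ) + (b ⬝ᵥ b) / 2) := by
  fin_cases d
  · exact fast_bound_aux hγ h 0 1 2 (fun x y => by rw [dot3]) θ b
  · exact fast_bound_aux hγ h 1 0 2 (fun x y => by rw [dot3]; ring) θ b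
  · exact fast_bound_aux hγ h 2 0 1 (fun x y => by rw [dot3]; ring) θ b

/-! ### The splitting inequality -/

/-- The properties of an affine functional `w ↦ φ w + c` that are used in the proof of
positivity; `κ` measures the lack of symmetry caused by jumps of the normal magnetic field. -/
structure IsPPForm (γ : ℝ) (φ : State →ₗ[ℝ] ℝ) (c κ : ℝ) : Prop where
  pos : ∀ w, Admissible γ w → 0 < φ w + c
  gp : ∀ w, Admissible γ w → |φ (gpS w) + κ| ≤ (φ w + c) / Real.sqrt (rho w)
  split : ∀ d w z a b, Admissible γ w → Admissible γ z → alphaR γ d w z ≤ a →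
    b ≤ alphaL γ d z w →
    0 ≤ φ (a • w - flux γ d w - b • z + flux γ d z) + (a - b) * c + (mag w d - mag z d) * κ

theorem roeVel_comm (d : Fin 3) (w z : State) : roeVel d z w = roeVel d w z := by
  rw [roeVel, roeVel, add_comm, add_comm (Real.sqrt (rho z))]

theorem magJumpSpeed_comm (w z : State) : magJumpSpeed z w = magJumpSpeed w z := by
  rw [magJumpSpeed, magJumpSpeed, add_comm]
  congr 2
  simp only [dot3, Pi.sub_apply]; ring

theorem magJumpSpeed_nonneg (w z : State) : 0 ≤ magJumpSpeed w z :=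
  div_nonneg (Real.sqrt_nonneg _) (add_nonneg (Real.sqrt_nonneg _) (Real.sqrt_nonneg _))

theorem isPPForm_rho {γ : ℝ} (hγ : 1 < γ) : IsPPForm γ rhoForm 0 0 where
  pos w h := by simpa [rhoForm_apply] using h.1
  gp w h := by
    have : rhoForm (gpS w) = 0 := rfl
    rw [this, rhoForm_apply]
    simp only [add_zero, abs_zero]
    exact div_nonneg h.1.le (Real.sqrt_nonneg _)
  split d w z a b hw hz ha hb := by
    have e : rhoForm (a • w - flux γ d w - b • z + flux γ d z)
        = (a - vel w d) * rho w + (vel z d - b) * rho z := by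
      simp only [map_add, map_sub, map_smul, rhoForm_apply, smul_eq_mul]
      change a * rho w - rho w * vel w d - b * rho z + rho z * vel z d = _
      ring
    rw [e]
    have h1 : vel w d ≤ a := by
      have := (fastSpeed_spec hγ hw d).1
      rw [alphaR] at ha
      linarith [le_max_left (vel w d) (roeVel d w z), magJumpSpeed_nonneg w z]
    have h2 : b ≤ vel z d := by
      have := (fastSpeed_spec hγ hz d).1
      rw [alphaL] at hb
      linarith [min_le_left (vel z d) (roeVel d z w), magJumpSpeed_nonneg z w]
    have := mul_nonneg (sub_nonneg.2 h1) hw.1.le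
    have := mul_nonneg (sub_nonneg.2 h2) hz.1.le
    linarith

theorem dot_le_sqrt (a b : Fin 3 → ℝ) : a ⬝ᵥ b ≤ Real.sqrt (a ⬝ᵥ a) * Real.sqrt (b ⬝ᵥ b) := by
  rw [← Real.sqrt_mul (dotProduct_self_nonneg' a)]
  refine Real.le_sqrt_of_sq_le ?_
  simp only [dot3]
  nlinarith [sq_nonneg (a 0 * b 1 - a 1 * b 0), sq_nonneg (a 0 * b 2 - a 2 * b 0),
    sq_nonneg (a 1 * b 2 - a 2 * b 1)]

theorem apply_sq_le_dot (a : Fin 3 → ℝ) (d : Fin 3) : a d ^ 2 ≤ a ⬝ᵥ a := by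
  rw [dot3]
  fin_cases d <;> simp <;> nlinarith [sq_nonneg (a 0), sq_nonneg (a 1), sq_nonneg (a 2)]

/-- Estimate of the term in which the jump of the magnetic field enters. -/
theorem jump_term_le {a c x y : ℝ} (ha : 0 < a) (hc : 0 < c) (b b' : Fin 3 → ℝ) :
    -((a * x + c * y) / (a + c) * ((b ⬝ᵥ b - b' ⬝ᵥ b') / 2)) ≤
      Real.sqrt ((b - b') ⬝ᵥ (b - b')) / (a + c) *
        (a ^ 2 * x ^ 2 / 2 + b ⬝ᵥ b / 2 + (c ^ 2 * y ^ 2 / 2 + b' ⬝ᵥ b' / 2)) := by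
  set J := Real.sqrt ((b - b') ⬝ᵥ (b - b')) with hJ
  have hJ0 : 0 ≤ J := Real.sqrt_nonneg _
  have e : b ⬝ᵥ b - b' ⬝ᵥ b' = (b - b') ⬝ᵥ (b + b') := by
    simp only [dot3, Pi.sub_apply, Pi.add_apply]; ring
  set T := Real.sqrt ((b + b') ⬝ᵥ (b + b')) with hT
  have hT0 : 0 ≤ T := Real.sqrt_nonneg _
  have hT2 : T ^ 2 ≤ 2 * (b ⬝ᵥ b) + 2 * (b' ⬝ᵥ b') := by
    rw [hT, Real.sq_sqrt (dotProduct_self_nonneg' _)]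
    simp only [dot3, Pi.add_apply]
    nlinarith [sq_nonneg (b 0 - b' 0), sq_nonneg (b 1 - b' 1), sq_nonneg (b 2 - b' 2)]
  -- The difference of squares factors into jump times sum. The jump supplies the speed, and the sum
  -- is paired with the weighted velocities and absorbed by the energies.
  have hd : |(b - b') ⬝ᵥ (b + b')| ≤ J * T := by
    rw [abs_le]
    refine ⟨?_, dot_le_sqrt _ _⟩
    have := dot_le_sqrt (-(b - b')) (b + b')
    rw [neg_dotProduct, neg_dotProduct_neg] at this
    linarith
  have hac : 0 < a + c := add_pos ha hc
  set m := a * x + c * y with hm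
  have h1 : -(m * ((b - b') ⬝ᵥ (b + b'))) ≤ |m| * (J * T) :=
    calc _ ≤ |m * ((b - b') ⬝ᵥ (b + b'))| := neg_le_abs _
      _ = |m| * |(b - b') ⬝ᵥ (b + b')| := abs_mul _ _
      _ ≤ _ := mul_le_mul_of_nonneg_left hd (abs_nonneg _)
  have h2 : |m| * T ≤ a ^ 2 * x ^ 2 + c ^ 2 * y ^ 2 + b ⬝ᵥ b + b' ⬝ᵥ b' := by
    have : |m| ^ 2 ≤ 2 * (a ^ 2 * x ^ 2) + 2 * (c ^ 2 * y ^ 2) := by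
      rw [sq_abs, hm]; nlinarith [sq_nonneg (a * x - c * y)]
    nlinarith [sq_nonneg (|m| - T)]
  have h3 := mul_le_mul_of_nonneg_left h2 hJ0
  rw [e]
  have l : -(m / (a + c) * ((b - b') ⬝ᵥ (b + b') / 2))
      = -(m * ((b - b') ⬝ᵥ (b + b'))) / 2 / (a + c) := by field_simp
  rw [l, div_mul_eq_mul_div]
  refine div_le_div_of_nonneg_right ?_ hac.le
  nlinarith

theorem abs_dot_mul_le {s : ℝ} (hs : 0 ≤ s) (x y : Fin 3 → ℝ) :
    |x ⬝ᵥ y| * s ≤ s ^ 2 / 2 * (x ⬝ᵥ x) + (y ⬝ᵥ y) / 2 := by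
  rw [← abs_of_nonneg hs, ← abs_mul, abs_of_nonneg hs, abs_le]
  simp only [dot3]
  constructor
  · nlinarith [sq_nonneg (s * x 0 + y 0), sq_nonneg (s * x 1 + y 1), sq_nonneg (s * x 2 + y 2)]
  · nlinarith [sq_nonneg (s * x 0 - y 0), sq_nonneg (s * x 1 - y 1), sq_nonneg (s * x 2 - y 2)]

/-- Up to the term handled by `fast_bound`, the part v_d|b|²/2 common to both states, and the κ
term, the flux carries ρe + ρ|u-v|²/2 with speed u_d but |B-b|²/2 with speed v_d. Replacing v_d by
the √ρ-weighted mean ū_d makes the second speed independent of v and costs (ū_d - v_d) times the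
difference of the magnetic parts, which `jump_term_le` bounds. Hence the maximum or minimum of u_d
and ū_d, the fast speed and the jump speed in `alphaR` and `alphaL`. -/
theorem isPPForm_gql {γ : ℝ} (hγ : 1 < γ) (v b : Fin 3 → ℝ) :
    IsPPForm γ (gqlForm v b) ((b ⬝ᵥ b) / 2) (v ⬝ᵥ b) where
  pos w h := by
    have := gqlForm_add_ge hγ h v b
    have h1 := mul_nonneg (half_pos h.1).le (dotProduct_self_nonneg' (vel w - v))
    have h2 := dotProduct_self_nonneg' (mag w - b)
    linarith
  gp w h := by
    have hs : 0 < Real.sqrt (rho w) := Real.sqrt_pos.2 h.1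
    have hs2 : Real.sqrt (rho w) ^ 2 = rho w := Real.sq_sqrt h.1.le
    have := gqlForm_add_ge hγ h v b
    rw [gqlForm_gpS, le_div_iff₀ hs]
    have hab := abs_dot_mul_le hs.le (vel w - v) (mag w - b)
    rw [hs2] at hab
    exact hab.trans this.le
  split d w z a a' hw hz ha hb := by
    simp only [map_add, map_sub, map_smul, smul_eq_mul, gqlForm_flux hw.1.ne',
      gqlForm_flux hz.1.ne']
    have Xw := gqlForm_add hw.1.ne' v b
    have Xz := gqlForm_add hz.1.ne' v b
    have hJ := jump_term_le (x := vel w d - v d) (y := vel z d - v d)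
      (Real.sqrt_pos.2 hw.1) (Real.sqrt_pos.2 hz.1) (mag w - b) (mag z - b)
    rw [Real.sq_sqrt hw.1.le, Real.sq_sqrt hz.1.le] at hJ
    rw [show mag w - b - (mag z - b) = mag w - mag z by abel] at hJ
    change _ ≤ magJumpSpeed w z * _ at hJ
    have hroe : (Real.sqrt (rho w) * (vel w d - v d) + Real.sqrt (rho z) * (vel z d - v d))
        / (Real.sqrt (rho w) + Real.sqrt (rho z)) = roeVel d w z - v d := by
      have h1 := Real.sqrt_pos.2 hw.1
      have h2 := Real.sqrt_pos.2 hz.1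
      rw [roeVel]; field_simp; ring
    rw [hroe] at hJ
    rw [alphaR] at ha
    rw [alphaL, roeVel_comm, magJumpSpeed_comm] at hb
    have hJ0 := magJumpSpeed_nonneg w z
    set J := magJumpSpeed w z
    set ub := roeVel d w z
    have fw := fast_bound hγ hw d (vel w - v) (mag w - b)
    -- The flux of `z` enters with the opposite sign. The left side of `fast_bound` is odd in the
    -- velocity and the right side even, so the reversed velocity is inserted.
    have fz := fast_bound hγ hz d (-(vel z - v)) (mag z - b)
    simp only [neg_dotProduct, Pi.neg_apply, dotProduct_neg, neg_neg,
      Pi.sub_apply] at fw fz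
    have tw := apply_sq_le_dot (vel w - v) d
    have tz := apply_sq_le_dot (vel z - v) d
    simp only [Pi.sub_apply] at tw tz
    have iw := internal_pos hγ hw
    have iz := internal_pos hγ hz
    -- The magnetic pressure is expanded around `b`; this separates the mixed term of `fast_bound`
    -- from the part that changes the transport speed of |B-b|²/2.
    have Bw : mag w ⬝ᵥ mag w = (mag w - b) ⬝ᵥ (mag w - b) + 2 * ((mag w ⬝ᵥ (mag w - b)) -
        (mag w - b) ⬝ᵥ (mag w - b)) + b ⬝ᵥ b := by
      simp only [dot3, Pi.sub_apply]; ring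
    have Bz : mag z ⬝ᵥ mag z = (mag z - b) ⬝ᵥ (mag z - b) + 2 * ((mag z ⬝ᵥ (mag z - b)) -
        (mag z - b) ⬝ᵥ (mag z - b)) + b ⬝ᵥ b := by
      simp only [dot3, Pi.sub_apply]; ring
    have nw := mul_nonneg (half_pos hw.1).le (dotProduct_self_nonneg' (vel w - v))
    have nz := mul_nonneg (half_pos hz.1).le (dotProduct_self_nonneg' (vel z - v))
    have bw := dotProduct_self_nonneg' (mag w - b)
    have bz := dotProduct_self_nonneg' (mag z - b)
    have tw' := mul_le_mul_of_nonneg_left tw (half_pos hw.1).le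
    have tz' := mul_le_mul_of_nonneg_left tz (half_pos hz.1).le
    rw [Bw, Bz]
    rw [← eq_sub_iff_add_eq] at Xw Xz
    rw [Xw, Xz]
    generalize (mag w - b) ⬝ᵥ (mag w - b) = bbw at *
    generalize (mag z - b) ⬝ᵥ (mag z - b) = bbz at *
    generalize rho w / 2 * ((vel w - v) ⬝ᵥ (vel w - v)) = kw at *
    generalize rho z / 2 * ((vel z - v) ⬝ᵥ (vel z - v)) = kz at *
    generalize (vel w - v) ⬝ᵥ (mag w - b) = xw at *
    generalize (vel z - v) ⬝ᵥ (mag z - b) = xz at *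
    generalize mag w ⬝ᵥ (mag w - b) = mw at *
    generalize mag z ⬝ᵥ (mag z - b) = mz at *
    generalize pressure γ w = pw at *
    generalize pressure γ z = pz at *
    generalize internal w = ew at *
    generalize internal z = ez at *
    generalize b ⬝ᵥ b = bb at *
    generalize v ⬝ᵥ b = vb at *
    have Hw : (max (vel w d) ub + fastSpeed γ d w + J) * (ew + kw + bbw / 2)
        ≤ a * (ew + kw + bbw / 2) := mul_le_mul_of_nonneg_right ha (by linarith)
    have Hz : a' * (ez + kz + bbz / 2)
        ≤ (min (vel z d) ub - fastSpeed γ d z - J) * (ez + kz + bbz / 2) :=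
      mul_le_mul_of_nonneg_right hb (by linarith)
    have Mw1 : vel w d * (ew + kw) ≤ max (vel w d) ub * (ew + kw) :=
      mul_le_mul_of_nonneg_right (le_max_left _ _) (by linarith)
    have Mw2 : ub * (bbw / 2) ≤ max (vel w d) ub * (bbw / 2) :=
      mul_le_mul_of_nonneg_right (le_max_right _ _) (by linarith)
    have Mz1 : min (vel z d) ub * (ez + kz) ≤ vel z d * (ez + kz) :=
      mul_le_mul_of_nonneg_right (min_le_left _ _) (by linarith)
    have Mz2 : min (vel z d) ub * (bbz / 2) ≤ ub * (bbz / 2) :=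
      mul_le_mul_of_nonneg_right (min_le_right _ _) (by linarith)
    have HJ : J * (rho w * (vel w d - v d) ^ 2 / 2 + bbw / 2
        + (rho z * (vel z d - v d) ^ 2 / 2 + bbz / 2))
        ≤ J * (ew + kw + bbw / 2 + (ez + kz + bbz / 2)) :=
      mul_le_mul_of_nonneg_left (by linarith) hJ0
    linarith
/-! ### The Chandrashekar flux -/

theorem logMean_self (a : ℝ) : logMean a a = a := by simp [logMean]

theorem logMean_comm (a b : ℝ) : logMean a b = logMean b a := by
  by_cases h : a = b
  · rw [h]
  · rw [logMean, logMean, if_neg h, if_neg (Ne.symm h), ← neg_sub b a,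
      ← neg_sub (Real.log b), neg_div_neg_eq]

theorem chandrashekar_comm (γ : ℝ) (d : Fin 3) (w z : State) :
    chandrashekar γ d w z = chandrashekar γ d z w := by
  simp only [chandrashekar, logMean_comm (rho w), logMean_comm (invTemp γ w),
    add_comm (vel w), add_comm (mag w), add_comm (rho w), add_comm (invTemp γ w),
    add_comm (invTemp γ w • vel w), add_comm (vel w ⬝ᵥ vel w), add_comm (mag w ⬝ᵥ mag w)]

theorem chandrashekar_self {γ : ℝ} (hγ : 1 < γ) (d : Fin 3) {w : State} (h : Admissible γ w) :
    chandrashekar γ d w w = flux γ d w := by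
  have hρ := h.1.ne'
  have hp := h.2.ne'
  have hγ' : γ - 1 ≠ 0 := (sub_pos.2 hγ).ne'
  have half : ∀ x : Fin 3 → ℝ, (1 / 2 : ℝ) • (x + x) = x := fun x => by
    rw [← two_smul ℝ x, smul_smul]; norm_num
  have half' : ∀ x : ℝ, (x + x) / 2 = x := fun x => by ring
  have hβ : invTemp γ w ≠ 0 := div_ne_zero hρ (mul_ne_zero two_ne_zero hp)
  have hP : rho w / (2 * invTemp γ w) = pressure γ w := by
    rw [invTemp]; field_simp
  have hE : 1 / ((γ - 1) * invTemp γ w) = 2 * internal w / rho w := by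
    have hi : internal w = pressure γ w / (γ - 1) := by rw [pressure]; field_simp
    rw [hi, invTemp]; field_simp
  have hFB : (invTemp γ w)⁻¹ • ((invTemp γ w • vel w) d • mag w - mag w d • invTemp γ w • vel w)
      = vel w d • mag w - mag w d • vel w := by
    ext i
    simp only [Pi.smul_apply, Pi.sub_apply, smul_eq_mul]
    field_simp
  simp only [chandrashekar, half, half', logMean_self, hP, hE, hFB]
  refine Prod.ext rfl (Prod.ext rfl (Prod.ext rfl ?_))
  have hd : vel w ⬝ᵥ Pi.single d (1 : ℝ) = vel w d := by simp
  simp only [flux, ener_eq hρ, totalPressure, dotProduct_add, dotProduct_sub, dotProduct_smul, hd,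
    smul_eq_mul]
  rw [dotProduct_comm (mag w) (vel w)]
  field_simp
  ring

theorem isTwoPointFlux_chandrashekar {γ : ℝ} (hγ : 1 < γ) :
    IsTwoPointFlux γ (chandrashekar γ) :=
  ⟨fun d w z _ _ => chandrashekar_comm γ d w z, fun d _ h => chandrashekar_self hγ d h⟩

/-! ### Averages over a line of nodes -/

theorem zero_ne_last {k : ℕ} (hk : 1 ≤ k) : (0 : Fin (k + 1)) ≠ Fin.last k := by
  intro h; have := congrArg Fin.val h; simp at this; omega

theorem sum_tau_smul {k : ℕ} (hk : 1 ≤ k) {M : Type*} [AddCommGroup M] [Module ℝ M]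
    (g : Fin (k + 1) → M) : ∑ α, tau α • g α = g (Fin.last k) - g 0 := by
  rw [LGLNodes.sum_eq_of_ends hk]
  · simp [tau, (zero_ne_last hk).symm]
    abel
  · intro i h0 h1
    simp [tau, h0, h1]

namespace Disc

variable {k : ℕ} (S : Disc k)

/-- The factor 2 gives two copies of the double sum. Transposing one by symmetry of the flux brings
in the symmetric part of ωD, which by `sbp` is diagonal and supported at the end points, where
consistency applies. -/
theorem sum_weight_volumeFlux (hk : 1 ≤ k) (hfS : IsTwoPointFlux S.γ S.fS) (d : Fin 3)
    (u : Fin (k + 1) → State) (hu : ∀ α, Admissible S.γ (u α)) :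
    ∑ α, S.X.weight α • ((2 : ℝ) • ∑ β, S.X.diff α β • S.fS d (u α) (u β))
      = flux S.γ d (u (Fin.last k)) - flux S.γ d (u 0) := by
  have h1 : ∑ α, S.X.weight α • ((2 : ℝ) • ∑ β, S.X.diff α β • S.fS d (u α) (u β))
      = ∑ α, ∑ β, (S.X.weight α * S.X.diff α β) • S.fS d (u α) (u β)
        + ∑ α, ∑ β, (S.X.weight α * S.X.diff α β) • S.fS d (u α) (u β) := by
    rw [← Finset.sum_add_distrib]
    refine Finset.sum_congr rfl fun α _ => ?_
    rw [smul_comm, two_smul]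
    simp only [Finset.smul_sum, smul_smul]
  have h2 : ∑ α, ∑ β, (S.X.weight α * S.X.diff α β) • S.fS d (u α) (u β)
      = ∑ α, ∑ β, (S.X.weight β * S.X.diff β α) • S.fS d (u α) (u β) := by
    rw [Finset.sum_comm]
    refine Finset.sum_congr rfl fun α _ => Finset.sum_congr rfl fun β _ => ?_
    rw [hfS.1 d _ _ (hu β) (hu α)]
  rw [h1]
  nth_rewrite 2 [h2]
  rw [← Finset.sum_add_distrib]
  simp only [← Finset.sum_add_distrib, ← add_smul, S.X.sbp hk]
  rw [← sum_tau_smul hk (fun α => flux S.γ d (u α))]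
  refine Finset.sum_congr rfl fun α _ => ?_
  simp [ite_smul, hfS.2 d _ (hu α)]

theorem sum_weight_lineRes (hk : 1 ≤ k) (hfS : IsTwoPointFlux S.γ S.fS) (d : Fin 3)
    (u : Fin (k + 1) → State) (hu : ∀ α, Admissible S.γ (u α)) (eL eR : State) :
    ∑ α, S.X.weight α • S.lineRes d u eL eR α
      = S.lineBoundary d u eL eR
        - ∑ α, (S.X.weight α * ∑ β, S.X.diff α β * mag (u β) d) • gpS (u α) := by
  have h1 : ∑ α, S.X.weight α • ((tau α / S.X.weight α) • S.star d u eL eR α)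
      = S.star d u eL eR (Fin.last k) - S.star d u eL eR 0 := by
    rw [← sum_tau_smul hk]
    refine Finset.sum_congr rfl fun α _ => ?_
    rw [smul_smul, mul_div_cancel₀ _ (S.X.weight_pos hk α).ne']
  have h3 : ∀ α, S.X.weight α • ∑ β, (S.X.diff α β * mag (u β) d) • gpS (u α)
      = (S.X.weight α * ∑ β, S.X.diff α β * mag (u β) d) • gpS (u α) := by
    intro α
    rw [← Finset.sum_smul, smul_smul]
  simp only [lineRes, smul_sub, Finset.sum_sub_distrib, h1, h3,
    S.sum_weight_volumeFlux hk hfS d u hu]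
  simp only [star, if_neg (zero_ne_last hk).symm, if_true, lineBoundary]
  abel

/-! ### The HLL flux and the lower bound for the boundary terms -/

/-- Isolates the unnormalized HLL intermediate state, which has the form occurring in the splitting
inequality. For nonnegative right speed its coefficient is nonnegative; in `hll_eq_right` it is
nonpositive for nonpositive left speed, which suits the outgoing flux. -/
theorem hll_eq_left (d : Fin 3) (wL wR : State) (h : S.SL d wL wR < S.SR d wL wR)
    (φ : State →ₗ[ℝ] ℝ) :
    φ (S.hll d wL wR) = φ (flux S.γ d wR) - S.SR d wL wR * φ wR
      + S.SR d wL wR / (S.SR d wL wR - S.SL d wL wR)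
        * φ (S.SR d wL wR • wR - flux S.γ d wR - S.SL d wL wR • wL + flux S.γ d wL) := by
  have hD : S.SR d wL wR - S.SL d wL wR ≠ 0 := (sub_pos.2 h).ne'
  simp only [hll, map_add, map_sub, map_smul, smul_eq_mul]
  field_simp
  ring

theorem hll_eq_right (d : Fin 3) (wL wR : State) (h : S.SL d wL wR < S.SR d wL wR)
    (φ : State →ₗ[ℝ] ℝ) :
    φ (S.hll d wL wR) = φ (flux S.γ d wL) - S.SL d wL wR * φ wL
      + S.SL d wL wR / (S.SR d wL wR - S.SL d wL wR)
        * φ (S.SR d wL wR • wR - flux S.γ d wR - S.SL d wL wR • wL + flux S.γ d wL) := by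
  have hD : S.SR d wL wR - S.SL d wL wR ≠ 0 := (sub_pos.2 h).ne'
  simp only [hll, map_add, map_sub, map_smul, smul_eq_mul]
  field_simp
  ring

theorem sub_hllB_right (d : Fin 3) (wL wR : State) (h : S.SL d wL wR < S.SR d wL wR) :
    mag wR d - S.hllB d wL wR
      = S.SR d wL wR / (S.SR d wL wR - S.SL d wL wR) * (mag wR d - mag wL d) := by
  have hD : S.SR d wL wR - S.SL d wL wR ≠ 0 := (sub_pos.2 h).ne'
  rw [hllB]; field_simp; ring

theorem sub_hllB_left (d : Fin 3) (wL wR : State) (h : S.SL d wL wR < S.SR d wL wR) :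
    mag wL d - S.hllB d wL wR
      = S.SL d wL wR / (S.SR d wL wR - S.SL d wL wR) * (mag wR d - mag wL d) := by
  have hD : S.SR d wL wR - S.SL d wL wR ≠ 0 := (sub_pos.2 h).ne'
  rw [hllB]; field_simp; ring

/-- Converts the bound `IsPPForm.gp` into the field-jump contribution to `nodeSpeed`. -/
theorem mul_le_of_abs_le {r x g Y s : ℝ} (hr : 0 ≤ r) (h : |g| ≤ Y / s) :
    r * x * g ≤ r * (|x| / s) * Y := by
  calc r * x * g ≤ |r * x * g| := le_abs_self _
    _ = r * |x| * |g| := by rw [abs_mul, abs_mul, abs_of_nonneg hr]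
    _ ≤ r * |x| * (Y / s) := mul_le_mul_of_nonneg_left h (by positivity)
    _ = _ := by ring

/-- Lower bound for the boundary terms of a line. -/
theorem lineBoundary_ge (hk : 1 ≤ k) (hsp : PPSpeeds S.γ S.SL S.SR) {φ : State →ₗ[ℝ] ℝ}
    {c κ : ℝ} (hφ : IsPPForm S.γ φ c κ) (d : Fin 3) (u : Fin (k + 1) → State)
    (hu : ∀ α, Admissible S.γ (u α)) {eL eR : State} (hL : Admissible S.γ eL)
    (hR : Admissible S.γ eR) :
    -(∑ α, S.nodeSpeed d u eL eR α * (φ (u α) + c))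
        - (mag (u (Fin.last k)) d - mag (u 0) d) * κ
      ≤ φ (S.lineBoundary d u eL eR) := by
  rw [LGLNodes.sum_eq_of_ends hk _ (fun i h0 h1 => by simp [nodeSpeed, h0, h1])]
  simp only [nodeSpeed, if_true, if_neg (zero_ne_last hk).symm]
  have hP := hu 0
  have hQ := hu (Fin.last k)
  set P := u 0
  set Q := u (Fin.last k)
  obtain ⟨-, l1, l2, l3, l4⟩ := hsp d eL P hL hP
  obtain ⟨r0, -, r2, r3, r4⟩ := hsp d Q eR hQ hR
  -- Splitting at the two interfaces bounds the intermediate states; splitting the two end states of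
  -- the line in `sM` absorbs the physical fluxes that remain.
  have sL := hφ.split d P eL _ _ hP hL l4 l3
  have sR := hφ.split d eR Q _ _ hR hQ r4 r3
  have sM := hφ.split d Q P _ _ hQ hP le_rfl le_rfl
  have gP := hφ.gp P hP
  have gQ := hφ.gp Q hQ
  change _ ≤ φ (S.hll d eL P - S.hll d Q eR + (mag Q d - S.hllB d Q eR) • gpS Q
    - (mag P d - S.hllB d eL P) • gpS P)
  rw [S.sub_hllB_right d eL P l2, S.sub_hllB_left d Q eR r2]
  simp only [map_add, map_sub, map_smul, smul_eq_mul] at sM ⊢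
  rw [S.hll_eq_left d eL P l2, S.hll_eq_right d Q eR r2]
  generalize φ (S.SR d eL P • P - flux S.γ d P - S.SL d eL P • eL + flux S.γ d eL) = HL at *
  generalize φ (S.SR d Q eR • eR - flux S.γ d eR - S.SL d Q eR • Q + flux S.γ d Q) = HR at *
  have DL : 0 < S.SR d eL P - S.SL d eL P := sub_pos.2 l2
  have DR : 0 < S.SR d Q eR - S.SL d Q eR := sub_pos.2 r2
  -- The constant of the affine functional is multiplied by the speed gap in the splitting
  -- inequality. These identities are recorded before the ratios are generalized, since they return
  -- the plain speeds.
  have eqL : S.SR d eL P = S.SR d eL P / (S.SR d eL P - S.SL d eL P)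
      * (S.SR d eL P - S.SL d eL P) := by field_simp
  have eqR : S.SL d Q eR = S.SL d Q eR / (S.SR d Q eR - S.SL d Q eR)
      * (S.SR d Q eR - S.SL d Q eR) := by field_simp
  have hrL : 0 ≤ S.SR d eL P / (S.SR d eL P - S.SL d eL P) := div_nonneg l1 DL.le
  have hrR : 0 ≤ -S.SL d Q eR / (S.SR d Q eR - S.SL d Q eR) :=
    div_nonneg (neg_nonneg.2 r0) DR.le
  rw [neg_div] at hrR ⊢
  have bL := mul_le_of_abs_le (x := mag P d - mag eL d) hrL gP
  have bR := mul_le_of_abs_le (x := mag eR d - mag Q d) hrR gQ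
  have mL := mul_nonneg hrL sL
  have mR := mul_nonneg hrR sR
  generalize S.SR d eL P / (S.SR d eL P - S.SL d eL P) = rL at *
  generalize S.SL d Q eR / (S.SR d Q eR - S.SL d Q eR) = rR at *
  have cL : rL * ((S.SR d eL P - S.SL d eL P) * c) = S.SR d eL P * c := by
    rw [← mul_assoc, ← eqL]
  have cR : rR * ((S.SR d Q eR - S.SL d Q eR) * c) = S.SL d Q eR * c := by
    rw [← mul_assoc, ← eqR]
  linarith

end Disc

end MHD

end

noncomputable section

namespace MHD

open Matrix

theorem Grid1.h_pos (G : Grid1) : 0 < G.h :=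
  div_pos (sub_pos.2 G.a_lt_b) (Nat.cast_pos.2 G.N_pos)

theorem Grid.hx_pos (G : Grid) : 0 < G.hx :=
  div_pos (sub_pos.2 G.a_lt_b) (Nat.cast_pos.2 G.Nx_pos)

theorem Grid.hy_pos (G : Grid) : 0 < G.hy :=
  div_pos (sub_pos.2 G.c_lt_d) (Nat.cast_pos.2 G.Ny_pos)

namespace Disc

variable {k : ℕ} (S : Disc k)

/-! ### Evolution of the cell averages -/

theorem vol1_eq (u : Fin (k + 1) → State) :
    S.vol1 u = ∑ α, (S.X.weight α * ∑ β, S.X.diff α β * mag (u β) 0) • gpS (u α) := by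
  refine Finset.sum_congr rfl fun α _ => ?_
  rw [← Finset.sum_smul, Finset.mul_sum]
  simp only [mul_assoc]

theorem h_smul_avg1_L1 (hk : 1 ≤ k) (hfS : IsTwoPointFlux S.γ S.fS) {G : Grid1}
    (bc : Sol1 k G → State × State) (w : Sol1 k G) (hw : ∀ i α, Admissible S.γ (w i α))
    (i : Fin G.N) :
    G.h • S.avg1 (S.L1 bc w i) = S.lineBoundary 0 (w i) (extL1 (bc w) w i) (extR1 (bc w) w i)
      - S.vol1 (w i) := by
  rw [vol1_eq, ← S.sum_weight_lineRes hk hfS 0 (w i) (hw i), avg1, smul_smul, Finset.smul_sum]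
  refine Finset.sum_congr rfl fun α _ => ?_
  rw [L1, smul_smul, smul_smul]
  congr 1
  have := G.h_pos.ne'
  field_simp

theorem hasDerivAt_avg1 {u : ℝ → Fin (k + 1) → State} {u' : Fin (k + 1) → State} {t : ℝ}
    (h : ∀ α, HasDerivAt (fun s => u s α) (u' α) t) :
    HasDerivAt (fun s => S.avg1 (u s)) (S.avg1 u') t :=
  (HasDerivAt.fun_sum fun α _ => (h α).const_smul (S.X.weight α)).const_smul (1 / 2 : ℝ)

variable {G : Grid}

theorem h_smul_avg_L (hk : 1 ≤ k) (hfS : IsTwoPointFlux S.γ S.fS)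
    (bc : Sol k G → Ghost k G) (w : Sol k G) (hw : NodallyAdmissible S.γ w)
    (i : Fin G.Nx) (j : Fin G.Ny) :
    (G.hx * G.hy) • S.avg (S.L bc w i j) = S.boundaryTerm bc w i j - S.volumeTerm w i j := by
  have hx := G.hx_pos.ne'
  have hy := G.hy_pos.ne'
  have e1 : (G.hx * G.hy) • S.avg (S.L bc w i j)
      = G.hy • ∑ β, (S.X.weight β / 2) • ∑ α, S.X.weight α •
          S.lineRes 0 (fun p => w i j p β) (extLeft (bc w) w i j β) (extRight (bc w) w i j β) α
        + G.hx • ∑ α, (S.X.weight α / 2) • ∑ β, S.X.weight β •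
          S.lineRes 1 (fun q => w i j α q) (extBottom (bc w) w i j α) (extTop (bc w) w i j α) β := by
    simp only [Finset.smul_sum, smul_smul]
    rw [Finset.sum_comm, avg]
    simp only [Finset.smul_sum, smul_smul, ← Finset.sum_add_distrib]
    refine Finset.sum_congr rfl fun α _ => Finset.sum_congr rfl fun β _ => ?_
    rw [L, smul_add, smul_smul, smul_smul]
    congr 2 <;> field_simp <;> ring
  have e2 : S.volumeTerm w i j
      = G.hy • ∑ β, (S.X.weight β / 2) • ∑ α,
          (S.X.weight α * ∑ p, S.X.diff α p * mag (w i j p β) 0) • gpS (w i j α β)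
        + G.hx • ∑ α, (S.X.weight α / 2) • ∑ β,
          (S.X.weight β * ∑ q, S.X.diff β q * mag (w i j α q) 1) • gpS (w i j α β) := by
    simp only [Finset.smul_sum, smul_smul]
    rw [Finset.sum_comm, volumeTerm]
    simp only [Finset.smul_sum, smul_smul, ← Finset.sum_add_distrib]
    refine Finset.sum_congr rfl fun α _ => Finset.sum_congr rfl fun β _ => ?_
    rw [← add_smul, discDiv]
    congr 1
    field_simp
    ring
  rw [e1, e2, boundaryTerm]
  have l0 : ∀ β, ∑ α, S.X.weight α • S.lineRes 0 (fun p => w i j p β)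
      (extLeft (bc w) w i j β) (extRight (bc w) w i j β) α = _ := fun β =>
    S.sum_weight_lineRes hk hfS 0 (fun p => w i j p β) (fun p => hw i j p β) _ _
  have l1 : ∀ α, ∑ β, S.X.weight β • S.lineRes 1 (fun q => w i j α q)
      (extBottom (bc w) w i j α) (extTop (bc w) w i j α) β = _ := fun α =>
    S.sum_weight_lineRes hk hfS 1 (fun q => w i j α q) (fun q => hw i j α q) _ _
  simp only [l0, l1, smul_sub, Finset.sum_sub_distrib]
  abel

theorem hasDerivAt_avg {c : ℝ → CellSol k} {c' : CellSol k} {t : ℝ}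
    (h : ∀ α β, HasDerivAt (fun s => c s α β) (c' α β) t) :
    HasDerivAt (fun s => S.avg (c s)) (S.avg c') t :=
  (HasDerivAt.fun_sum fun α _ => HasDerivAt.fun_sum fun β _ =>
    (h α β).const_smul (S.X.weight α * S.X.weight β)).const_smul (1 / 4 : ℝ)

/-! ### The divergence of the interpolated magnetic field -/

theorem deriv_magFun1 {G : Grid1} (w : Sol1 k G) (i : Fin G.N) (α : Fin (k + 1)) :
    deriv (S.magFun1 w i) (G.ctr i + G.h / 2 * S.X.node α)
      = 2 / G.h * ∑ β, S.X.diff α β * mag (w i β) 0 := by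
  have hh := G.h_pos.ne'
  have hinner : ∀ x, HasDerivAt (fun x => (x - G.ctr i) / (G.h / 2)) (1 / (G.h / 2)) x :=
    fun x => ((hasDerivAt_id x).sub_const _).div_const _
  have hx : (G.ctr i + G.h / 2 * S.X.node α - G.ctr i) / (G.h / 2) = S.X.node α := by
    field_simp; ring
  have hd : HasDerivAt (S.magFun1 w i)
      (∑ β, mag (w i β) 0 * (S.X.diff α β * (1 / (G.h / 2))))
      (G.ctr i + G.h / 2 * S.X.node α) := by
    refine HasDerivAt.fun_sum fun β _ => HasDerivAt.const_mul _ ?_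
    have := HasDerivAt.comp (G.ctr i + G.h / 2 * S.X.node α)
      (h₂ := fun x => (S.X.basis β).eval x) ((S.X.basis β).hasDerivAt _) (hinner _)
    rw [hx] at this
    exact this
  rw [hd.deriv, Finset.mul_sum]
  refine Finset.sum_congr rfl fun β _ => ?_
  field_simp

theorem sum_diff_mag_eq_zero1 (hk : 1 ≤ k) {G : Grid1} {w : Sol1 k G} (h : S.LDF1 w)
    (i : Fin G.N) (α : Fin (k + 1)) : ∑ β, S.X.diff α β * mag (w i β) 0 = 0 := by
  have hh := G.h_pos
  have hn := S.X.node_mem_Icc hk α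
  have := h i (G.ctr i + G.h / 2 * S.X.node α) (by
    constructor <;> nlinarith [hn.1, hn.2])
  rw [deriv_magFun1] at this
  exact (mul_eq_zero.1 this).resolve_left (by positivity)

theorem vol1_eq_zero (hk : 1 ≤ k) {G : Grid1} {w : Sol1 k G} (h : S.LDF1 w) (i : Fin G.N) :
    S.vol1 (w i) = 0 := by
  rw [vol1_eq]
  simp [S.sum_diff_mag_eq_zero1 hk h]

/-- The discrete fundamental theorem of calculus: the weighted column sums of the differentiation
matrix live only at the end points. -/
theorem sum_weight_sum_diff (hk : 1 ≤ k) (f : Fin (k + 1) → ℝ) :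
    ∑ α, S.X.weight α * ∑ p, S.X.diff α p * f p = f (Fin.last k) - f 0 := by
  rw [← sum_tau_smul hk]
  simp only [Finset.mul_sum, smul_eq_mul]
  rw [Finset.sum_comm]
  refine Finset.sum_congr rfl fun p _ => ?_
  rw [← S.X.sum_weight_diff hk p, Finset.sum_mul]
  simp only [mul_assoc]

/-! ### Tensor-product interpolation and its divergence in physical and reference coordinates -/

theorem eval_aeval_X (i : Fin 2) (p : Polynomial ℝ) (z : Fin 2 → ℝ) :
    MvPolynomial.eval z (Polynomial.aeval (MvPolynomial.X i : MvPolynomial (Fin 2) ℝ) p)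
      = p.eval (z i) := by
  rw [← MvPolynomial.coe_aeval_eq_eval, RingHom.coe_coe, ← Polynomial.aeval_algHom_apply]
  simp

theorem eval_refInterp (b : Fin (k + 1) → Fin (k + 1) → ℝ) (x y : ℝ) :
    MvPolynomial.eval ![x, y] (S.refInterp b)
      = ∑ α, ∑ β, b α β * ((S.X.basis α).eval x * (S.X.basis β).eval y) := by
  simp [refInterp, eval_aeval_X]

theorem eval_refInterp_node (b : Fin (k + 1) → Fin (k + 1) → ℝ) (α β : Fin (k + 1)) :
    MvPolynomial.eval ![S.X.node α, S.X.node β] (S.refInterp b) = b α β := by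
  rw [eval_refInterp]
  simp [S.X.eval_basis]

theorem eval_pderiv_zero_refInterp (b : Fin (k + 1) → Fin (k + 1) → ℝ) (x y : ℝ) :
    MvPolynomial.eval ![x, y] (MvPolynomial.pderiv 0 (S.refInterp b))
      = ∑ α, ∑ β, b α β *
        ((Polynomial.derivative (S.X.basis α)).eval x * (S.X.basis β).eval y) := by
  simp [refInterp, Derivation.map_aeval, eval_aeval_X, MvPolynomial.pderiv_X, mul_comm]

theorem eval_pderiv_one_refInterp (b : Fin (k + 1) → Fin (k + 1) → ℝ) (x y : ℝ) :
    MvPolynomial.eval ![x, y] (MvPolynomial.pderiv 1 (S.refInterp b))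
      = ∑ α, ∑ β, b α β *
        ((S.X.basis α).eval x * (Polynomial.derivative (S.X.basis β)).eval y) := by
  simp [refInterp, Derivation.map_aeval, eval_aeval_X, MvPolynomial.pderiv_X]

theorem divB_eq_sum (w : Sol k G) (i : Fin G.Nx) (j : Fin G.Ny) (x y : ℝ) :
    S.divB w i j x y = 2 / G.hx * ∑ α, ∑ β, mag (w i j α β) 0 *
        ((Polynomial.derivative (S.X.basis α)).eval ((x - G.xc i) / (G.hx / 2))
          * (S.X.basis β).eval ((y - G.yc j) / (G.hy / 2)))
      + 2 / G.hy * ∑ α, ∑ β, mag (w i j α β) 1 *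
        ((S.X.basis α).eval ((x - G.xc i) / (G.hx / 2))
          * (Polynomial.derivative (S.X.basis β)).eval ((y - G.yc j) / (G.hy / 2))) := by
  have hx := G.hx_pos.ne'
  have hy := G.hy_pos.ne'
  have inner : ∀ c h x : ℝ, HasDerivAt (fun x => (x - c) / (h / 2)) (1 / (h / 2)) x :=
    fun c h x => ((hasDerivAt_id x).sub_const _).div_const _
  have comp : ∀ (α : Fin (k + 1)) (c h x : ℝ),
      HasDerivAt (fun x => (S.X.basis α).eval ((x - c) / (h / 2)))
        ((Polynomial.derivative (S.X.basis α)).eval ((x - c) / (h / 2)) * (1 / (h / 2))) x :=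
    fun α c h x => HasDerivAt.comp x
      (h₂ := fun x => (S.X.basis α).eval x) ((S.X.basis α).hasDerivAt _) (inner c h x)
  have d0 : HasDerivAt (fun x' => S.magFun w i j 0 x' y) (∑ α, ∑ β, mag (w i j α β) 0 *
      ((Polynomial.derivative (S.X.basis α)).eval ((x - G.xc i) / (G.hx / 2)) * (1 / (G.hx / 2))
          * (S.X.basis β).eval ((y - G.yc j) / (G.hy / 2)))) x := by
    simp only [magFun, eval_refInterp]
    exact HasDerivAt.fun_sum fun α _ => HasDerivAt.fun_sum fun β _ =>
      ((comp α _ _ x).mul_const _).const_mul _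
  have d1 : HasDerivAt (fun y' => S.magFun w i j 1 x y') (∑ α, ∑ β, mag (w i j α β) 1 *
      ((S.X.basis α).eval ((x - G.xc i) / (G.hx / 2))
        * ((Polynomial.derivative (S.X.basis β)).eval ((y - G.yc j) / (G.hy / 2))
          * (1 / (G.hy / 2))))) y := by
    simp only [magFun, eval_refInterp]
    exact HasDerivAt.fun_sum fun α _ => HasDerivAt.fun_sum fun β _ =>
      ((comp β _ _ y).const_mul _).const_mul _
  rw [divB, d0.deriv, d1.deriv]
  simp only [Finset.mul_sum]
  congr 1
  · refine Finset.sum_congr rfl fun α _ => Finset.sum_congr rfl fun β _ => ?_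
    field_simp
  · refine Finset.sum_congr rfl fun α _ => Finset.sum_congr rfl fun β _ => ?_
    field_simp

/-- The purpose of the Piola scaling: on anisotropic cells, too, physical and reference divergence
differ by a single factor, so a zero reference divergence suffices. -/
theorem divB_eq_refDiv (w : Sol k G) (i : Fin G.Nx) (j : Fin G.Ny) (x y : ℝ) :
    S.divB w i j x y = 4 / (G.hx * G.hy) *
      MvPolynomial.eval ![(x - G.xc i) / (G.hx / 2), (y - G.yc j) / (G.hy / 2)]
        (refDiv (S.piola w i j)) := by
  have hx := G.hx_pos.ne'
  have hy := G.hy_pos.ne'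
  rw [divB_eq_sum, refDiv, piola]
  simp only [Matrix.cons_val_zero, Matrix.cons_val_one, map_add, eval_pderiv_zero_refInterp,
    eval_pderiv_one_refInterp, mul_add, Finset.mul_sum]
  congr 1
  · refine Finset.sum_congr rfl fun α _ => Finset.sum_congr rfl fun β _ => ?_
    field_simp
    ring
  · refine Finset.sum_congr rfl fun α _ => Finset.sum_congr rfl fun β _ => ?_
    field_simp
    ring

theorem discDiv_eq_divB (w : Sol k G) (i : Fin G.Nx) (j : Fin G.Ny) (α β : Fin (k + 1)) :
    S.discDiv w i j α β =
      S.divB w i j (G.xc i + G.hx / 2 * S.X.node α) (G.yc j + G.hy / 2 * S.X.node β) := by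
  have hx := G.hx_pos.ne'
  have hy := G.hy_pos.ne'
  have e1 : (G.xc i + G.hx / 2 * S.X.node α - G.xc i) / (G.hx / 2) = S.X.node α := by
    field_simp; ring
  have e2 : (G.yc j + G.hy / 2 * S.X.node β - G.yc j) / (G.hy / 2) = S.X.node β := by
    field_simp; ring
  rw [divB_eq_sum, e1, e2, discDiv]
  simp only [S.X.eval_basis]
  congr 2
  · refine Finset.sum_congr rfl fun p _ => ?_
    simp [LGLNodes.diff, mul_comm]
  · rw [Finset.sum_comm]
    refine Finset.sum_congr rfl fun q _ => ?_
    simp [LGLNodes.diff, mul_comm]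

theorem discDiv_eq_zero (hk : 1 ≤ k) {w : Sol k G} (h : S.LDF w) (i : Fin G.Nx) (j : Fin G.Ny)
    (α β : Fin (k + 1)) : S.discDiv w i j α β = 0 := by
  rw [discDiv_eq_divB]
  have hx := G.hx_pos
  have hy := G.hy_pos
  have hα := S.X.node_mem_Icc hk α
  have hβ := S.X.node_mem_Icc hk β
  refine h i j _ _ ⟨?_, ?_⟩
  · constructor <;> simp only <;> nlinarith [hα.1, hα.2]
  · constructor <;> simp only <;> nlinarith [hβ.1, hβ.2]

theorem volumeTerm_eq_zero (hk : 1 ≤ k) {w : Sol k G} (h : S.LDF w) (i : Fin G.Nx)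
    (j : Fin G.Ny) : S.volumeTerm w i j = 0 := by
  simp [volumeTerm, S.discDiv_eq_zero hk h]

/-- The net flux of the magnetic field through the boundary of a cell vanishes if the field is
locally divergence-free. -/
theorem net_flux_eq_zero (hk : 1 ≤ k) {w : Sol k G} (h : S.LDF w) (i : Fin G.Nx)
    (j : Fin G.Ny) :
    G.hy * ∑ β, S.X.weight β / 2 * (mag (w i j (Fin.last k) β) 0 - mag (w i j 0 β) 0)
      + G.hx * ∑ α, S.X.weight α / 2 * (mag (w i j α (Fin.last k)) 1 - mag (w i j α 0) 1)
      = 0 := by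
  have hx := G.hx_pos.ne'
  have hy := G.hy_pos.ne'
  have h0 : ∑ α, ∑ β, G.hx * G.hy / 4 * (S.X.weight α * S.X.weight β * S.discDiv w i j α β) = 0 := by
    simp [S.discDiv_eq_zero hk h]
  rw [← h0]
  -- The inner sums get opaque names so that `Finset.mul_sum` distributes only over the quadrature
  -- sums.
  obtain ⟨F, hF⟩ : ∃ F : Fin (k + 1) → Fin (k + 1) → ℝ,
      ∀ α β, ∑ p, S.X.diff α p * mag (w i j p β) 0 = F α β := ⟨_, fun _ _ => rfl⟩
  obtain ⟨H, hH⟩ : ∃ H : Fin (k + 1) → Fin (k + 1) → ℝ,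
      ∀ α β, ∑ q, S.X.diff β q * mag (w i j α q) 1 = H α β := ⟨_, fun _ _ => rfl⟩
  have l0 : ∀ β, mag (w i j (Fin.last k) β) 0 - mag (w i j 0 β) 0
      = ∑ α, S.X.weight α * F α β := fun β => by
    simp only [← hF, ← S.sum_weight_sum_diff hk (fun p => mag (w i j p β) 0)]
  have l1 : ∀ α, mag (w i j α (Fin.last k)) 1 - mag (w i j α 0) 1
      = ∑ β, S.X.weight β * H α β := fun α => by
    simp only [← hH, ← S.sum_weight_sum_diff hk (fun q => mag (w i j α q) 1)]
  simp only [l0, l1, discDiv, hF, hH, Finset.mul_sum]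
  rw [Finset.sum_comm, ← Finset.sum_add_distrib]
  refine Finset.sum_congr rfl fun α _ => ?_
  rw [← Finset.sum_add_distrib]
  refine Finset.sum_congr rfl fun β _ => ?_
  field_simp
  ring

theorem sum_eval_derivative_basis (x : ℝ) :
    ∑ α, (Polynomial.derivative (S.X.basis α)).eval x = 0 := by
  rw [← Polynomial.eval_finsetSum, ← Polynomial.derivative_sum, S.X.sum_basis]
  simp

/-- Scaling the magnetic field towards a constant scales its divergence. -/
theorem divB_of_scaled {w w' : Sol k G} {i : Fin G.Nx} {j : Fin G.Ny} {θ : ℝ}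
    (c : Fin 3 → ℝ) (h : ∀ α β, mag (w' i j α β) = c + θ • (mag (w i j α β) - c)) (x y : ℝ) :
    S.divB w' i j x y = θ * S.divB w i j x y := by
  have z0 : ∀ x y : ℝ, ∑ α, ∑ β, ((1 - θ) * c 0) * ((Polynomial.derivative (S.X.basis α)).eval x
      * (S.X.basis β).eval y) = 0 := by
    intro x y
    simp [← Finset.mul_sum, ← Finset.sum_mul, S.sum_eval_derivative_basis]
  have z1 : ∀ x y : ℝ, ∑ α, ∑ β, ((1 - θ) * c 1) * ((S.X.basis α).eval x
      * (Polynomial.derivative (S.X.basis β)).eval y) = 0 := by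
    intro x y
    simp [← Finset.mul_sum, S.sum_eval_derivative_basis]
  have e : ∀ α β m, mag (w' i j α β) m = (1 - θ) * c m + θ * mag (w i j α β) m := by
    intro α β m
    rw [h]
    simp only [Pi.add_apply, Pi.smul_apply, Pi.sub_apply, smul_eq_mul]
    ring
  simp only [divB_eq_sum, e, add_mul, Finset.sum_add_distrib, z0, z1, zero_add]
  simp only [mul_assoc θ, ← Finset.mul_sum]
  ring

theorem LDF_of_scaled {w w' : Sol k G} (hw : S.LDF w) (θ : Fin G.Nx → Fin G.Ny → ℝ)
    (c : Fin G.Nx → Fin G.Ny → Fin 3 → ℝ)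
    (h : ∀ i j α β, mag (w' i j α β) = c i j + θ i j • (mag (w i j α β) - c i j)) :
    S.LDF w' := by
  intro i j x y hxy
  rw [S.divB_of_scaled (c i j) (h i j), hw i j x y hxy, mul_zero]

end Disc

end MHD

end

noncomputable section

namespace MHD

open Matrix

/-! ### Polynomial spaces on the reference element -/

theorem monomial_eq_X_mul_X (n : Fin 2 →₀ ℕ) (c : ℝ) :
    MvPolynomial.monomial n c
      = c • (MvPolynomial.X 0 ^ n 0 * MvPolynomial.X 1 ^ n 1 : MvPolynomial (Fin 2) ℝ) := by
  rw [MvPolynomial.monomial_eq, Finsupp.prod_fintype _ _ (by simp), Fin.prod_univ_two,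
    MvPolynomial.smul_eq_C_mul]

theorem X_pow_mul_X_pow_mem_QSpace {a b m n : ℕ} (hm : m ≤ a) (hn : n ≤ b) :
    (MvPolynomial.X 0 ^ m * MvPolynomial.X 1 ^ n : MvPolynomial (Fin 2) ℝ) ∈ QSpace a b := by
  have h := monomial_eq_X_mul_X (Finsupp.single 0 m + Finsupp.single 1 n) 1
  simp only [one_smul] at h
  have e0 : (Finsupp.single (0 : Fin 2) m + Finsupp.single 1 n : Fin 2 →₀ ℕ) 0 = m := by simp
  have e1 : (Finsupp.single (0 : Fin 2) m + Finsupp.single 1 n : Fin 2 →₀ ℕ) 1 = n := by simp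
  rw [e0, e1] at h
  rw [← h]
  refine (MvPolynomial.monomial_mem_restrictSupport ℝ).2 (Or.inl ?_)
  rw [Set.mem_ofPred_eq, e0, e1]
  exact ⟨hm, hn⟩

theorem QSpace_induction {a b : ℕ} {C : MvPolynomial (Fin 2) ℝ → Prop}
    (mono : ∀ m n, m ≤ a → n ≤ b → C (MvPolynomial.X 0 ^ m * MvPolynomial.X 1 ^ n))
    (zero : C 0) (add : ∀ P Q, C P → C Q → C (P + Q)) (smul : ∀ (c : ℝ) P, C P → C (c • P))
    {P : MvPolynomial (Fin 2) ℝ} (hP : P ∈ QSpace a b) : C P := by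
  rw [QSpace, MvPolynomial.restrictSupport_eq_span] at hP
  induction hP using Submodule.span_induction with
  | mem x hx =>
    obtain ⟨n, hn, rfl⟩ := hx
    simp only [monomial_eq_X_mul_X, one_smul]
    exact mono _ _ hn.1 hn.2
  | zero => exact zero
  | add x y _ _ hx hy => exact add _ _ hx hy
  | smul c x _ hx => exact smul _ _ hx

theorem aeval_mul_aeval_mem_QSpace {a b : ℕ} {p q : Polynomial ℝ} (hp : p.natDegree ≤ a)
    (hq : q.natDegree ≤ b) :
    (Polynomial.aeval (MvPolynomial.X 0) p * Polynomial.aeval (MvPolynomial.X 1) q :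
      MvPolynomial (Fin 2) ℝ) ∈ QSpace a b := by
  rw [Polynomial.aeval_eq_sum_range, Polynomial.aeval_eq_sum_range, Finset.sum_mul_sum]
  refine Submodule.sum_mem _ fun m hm => Submodule.sum_mem _ fun n hn => ?_
  rw [smul_mul_smul_comm]
  refine Submodule.smul_mem _ _ (X_pow_mul_X_pow_mem_QSpace ?_ ?_)
  · rw [Finset.mem_range] at hm; omega
  · rw [Finset.mem_range] at hn; omega

theorem QSpace_mono {a b a' b' : ℕ} (ha : a ≤ a') (hb : b ≤ b') : QSpace a b ≤ QSpace a' b' :=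
  MvPolynomial.restrictSupport_mono _ fun _ h => ⟨h.1.trans ha, h.2.trans hb⟩

theorem MSpace_le (k : ℕ) : MSpace k ≤ QSpace k k :=
  sup_le (QSpace_mono (Nat.sub_le _ _) le_rfl) (QSpace_mono le_rfl (Nat.sub_le _ _))

theorem pderiv_zero_mem {a b : ℕ} {P : MvPolynomial (Fin 2) ℝ} (hP : P ∈ QSpace a b) :
    MvPolynomial.pderiv 0 P ∈ QSpace (a - 1) b := by
  refine QSpace_induction (C := fun P => MvPolynomial.pderiv 0 P ∈ QSpace (a - 1) b) ?_ ?_ ?_ ?_ hP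
  · intro m n hm hn
    have e : MvPolynomial.pderiv 0
        (MvPolynomial.X 0 ^ m * MvPolynomial.X 1 ^ n : MvPolynomial (Fin 2) ℝ)
        = (m : ℝ) • (MvPolynomial.X 0 ^ (m - 1) * MvPolynomial.X 1 ^ n) := by
      simp [MvPolynomial.pderiv_X, MvPolynomial.smul_eq_C_mul]
      ring
    rw [e]
    exact Submodule.smul_mem _ _ (X_pow_mul_X_pow_mem_QSpace (by omega) hn)
  · simp
  · intro P Q h1 h2
    rw [map_add]; exact Submodule.add_mem _ h1 h2
  · intro c P h
    rw [Derivation.map_smul]; exact Submodule.smul_mem _ _ h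

theorem pderiv_one_mem {a b : ℕ} {P : MvPolynomial (Fin 2) ℝ} (hP : P ∈ QSpace a b) :
    MvPolynomial.pderiv 1 P ∈ QSpace a (b - 1) := by
  refine QSpace_induction (C := fun P => MvPolynomial.pderiv 1 P ∈ QSpace a (b - 1)) ?_ ?_ ?_ ?_ hP
  · intro m n hm hn
    have e : MvPolynomial.pderiv 1
        (MvPolynomial.X 0 ^ m * MvPolynomial.X 1 ^ n : MvPolynomial (Fin 2) ℝ)
        = (n : ℝ) • (MvPolynomial.X 0 ^ m * MvPolynomial.X 1 ^ (n - 1)) := by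
      simp [MvPolynomial.pderiv_X, MvPolynomial.smul_eq_C_mul]
      ring
    rw [e]
    exact Submodule.smul_mem _ _ (X_pow_mul_X_pow_mem_QSpace hm (by omega))
  · simp
  · intro P Q h1 h2
    rw [map_add]; exact Submodule.add_mem _ h1 h2
  · intro c P h
    rw [Derivation.map_smul]; exact Submodule.smul_mem _ _ h

/-- Why the multiplier space has this form: the divergence of an admissible field may itself be used
as a test function in the constraint. -/
theorem refDiv_mem {k : ℕ} {v : Fin 2 → MvPolynomial (Fin 2) ℝ} (hv : ∀ m, v m ∈ QSpace k k) :
    refDiv v ∈ MSpace k :=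
  Submodule.add_mem_sup (pderiv_zero_mem (hv 0)) (pderiv_one_mem (hv 1))

/-! ### The integral over the reference element -/

theorem continuous_eval_pair (P : MvPolynomial (Fin 2) ℝ) :
    Continuous fun z : ℝ × ℝ => MvPolynomial.eval ![z.1, z.2] P := by
  refine (MvPolynomial.continuous_eval P).comp ?_
  refine continuous_pi fun i => ?_
  fin_cases i
  · exact continuous_fst
  · exact continuous_snd

theorem continuous_eval_right (P : MvPolynomial (Fin 2) ℝ) (x : ℝ) :
    Continuous fun y : ℝ => MvPolynomial.eval ![x, y] P := by
  refine (MvPolynomial.continuous_eval P).comp ?_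
  refine continuous_pi fun i => ?_
  fin_cases i
  · exact continuous_const
  · exact continuous_id

theorem continuous_inner_integral (P : MvPolynomial (Fin 2) ℝ) :
    Continuous fun x : ℝ => ∫ y in (-1 : ℝ)..1, MvPolynomial.eval ![x, y] P :=
  intervalIntegral.continuous_parametric_intervalIntegral_of_continuous'
    (f := fun x y : ℝ => MvPolynomial.eval ![x, y] P) (continuous_eval_pair P) (-1) 1

theorem refInt_add (P Q : MvPolynomial (Fin 2) ℝ) : refInt (P + Q) = refInt P + refInt Q := by
  simp only [refInt, map_add]
  rw [← intervalIntegral.integral_add ((continuous_inner_integral P).intervalIntegrable _ _)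
    ((continuous_inner_integral Q).intervalIntegrable _ _)]
  refine intervalIntegral.integral_congr fun x _ => ?_
  exact intervalIntegral.integral_add ((continuous_eval_right P x).intervalIntegrable _ _)
    ((continuous_eval_right Q x).intervalIntegrable _ _)

theorem refInt_smul (c : ℝ) (P : MvPolynomial (Fin 2) ℝ) : refInt (c • P) = c * refInt P := by
  simp only [refInt, MvPolynomial.smul_eval]
  rw [← intervalIntegral.integral_const_mul]
  refine intervalIntegral.integral_congr fun x _ => ?_
  exact intervalIntegral.integral_const_mul _ _

/-- The integral over the reference element as a linear map. -/
def refIntLin : MvPolynomial (Fin 2) ℝ →ₗ[ℝ] ℝ where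
  toFun := refInt
  map_add' := refInt_add
  map_smul' := refInt_smul

theorem refIntLin_apply (P : MvPolynomial (Fin 2) ℝ) : refIntLin P = refInt P := rfl

theorem refInt_mul_self_nonneg (P : MvPolynomial (Fin 2) ℝ) : 0 ≤ refInt (P * P) := by
  refine intervalIntegral.integral_nonneg (by norm_num) fun x _ =>
    intervalIntegral.integral_nonneg (by norm_num) fun y _ => ?_
  rw [map_mul]
  exact mul_self_nonneg _

/-- By continuity one nonzero value suffices, even on the boundary of the square; LGL nodes do lie
there. -/
theorem refInt_mul_self_pos {P : MvPolynomial (Fin 2) ℝ} {x y : ℝ} (hx : x ∈ Set.Icc (-1 : ℝ) 1)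
    (hy : y ∈ Set.Icc (-1 : ℝ) 1) (h : MvPolynomial.eval ![x, y] P ≠ 0) :
    0 < refInt (P * P) := by
  have hnn : ∀ x y : ℝ, 0 ≤ MvPolynomial.eval ![x, y] (P * P) := fun x y => by
    rw [map_mul]; exact mul_self_nonneg _
  refine intervalIntegral.integral_pos (by norm_num)
    (continuous_inner_integral (P * P)).continuousOn
    (fun x _ => intervalIntegral.integral_nonneg (by norm_num) fun y _ => hnn x y) ⟨x, hx, ?_⟩
  refine intervalIntegral.integral_pos (by norm_num)
    (continuous_eval_right (P * P) x).continuousOn (fun y _ => hnn x y) ⟨y, hy, ?_⟩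
  rw [map_mul]
  exact mul_self_pos.2 h

/-- An anisotropic bilinear form on a finite-dimensional space represents every linear
functional. -/
theorem exists_represents {U : Type*} [AddCommGroup U] [Module ℝ U] [FiniteDimensional ℝ U]
    (B : U →ₗ[ℝ] U →ₗ[ℝ] ℝ) (hB : ∀ u, B u u = 0 → u = 0) (l : U →ₗ[ℝ] ℝ) :
    ∃ u, ∀ v, B u v = l v := by
  have hinj : Function.Injective B := by
    rw [← LinearMap.ker_eq_bot, LinearMap.ker_eq_bot']
    intro u hu
    exact hB u (by rw [hu]; rfl)
  have hsurj : Function.Surjective (B : U →ₗ[ℝ] Module.Dual ℝ U) :=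
    (LinearMap.injective_iff_surjective_of_finrank_eq_finrank
      (Subspace.dual_finrank_eq).symm).1 hinj
  obtain ⟨u, hu⟩ := hsurj l
  exact ⟨u, fun v => by rw [hu]⟩

/-- Solvability of a saddle point problem with anisotropic forms. -/
theorem exists_saddle {U M : Type*} [AddCommGroup U] [Module ℝ U] [FiniteDimensional ℝ U]
    [AddCommGroup M] [Module ℝ M] [FiniteDimensional ℝ M]
    (a : U →ₗ[ℝ] U →ₗ[ℝ] ℝ) (c : M →ₗ[ℝ] M →ₗ[ℝ] ℝ) (ha : ∀ u, a u u = 0 → u = 0)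
    (hc : ∀ p, c p p = 0 → p = 0) (D : U →ₗ[ℝ] M) (u₀ : U) :
    ∃ u p, D u = 0 ∧ ∀ v, a u v + c p (D v) = a u₀ v := by
  obtain ⟨u, hu⟩ := exists_represents
    (a.compl₁₂ (LinearMap.ker D).subtype (LinearMap.ker D).subtype)
    (fun u hu => Subtype.ext (ha u.1 hu)) (a u₀ ∘ₗ (LinearMap.ker D).subtype)
  -- The problem is first solved on the kernel of `D`. The residual annihilates that kernel, hence
  -- factors through `D`, and representing the factor by `c` gives the multiplier. No surjectivity
  -- of `D` is needed.
  have hann : a (u₀ - u.1) ∈ (LinearMap.ker D).dualAnnihilator := by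
    rw [Submodule.mem_dualAnnihilator]
    intro v hv
    have : a u.1 v = a u₀ v := hu ⟨v, hv⟩
    rw [map_sub, LinearMap.sub_apply, this, sub_self]
  rw [← LinearMap.range_dualMap_eq_dualAnnihilator_ker] at hann
  obtain ⟨ψ, hψ⟩ := hann
  obtain ⟨p, hp⟩ := exists_represents c hc ψ
  refine ⟨u.1, p, u.2, fun v => ?_⟩
  have h : ψ (D v) = a (u₀ - u.1) v := by rw [← hψ]; rfl
  rw [hp, h, map_sub, LinearMap.sub_apply]
  ring

/-- The `L²` inner product on `Q^k × Q^k`. -/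
def fieldForm (k : ℕ) : (Fin 2 → QSpace k k) →ₗ[ℝ] (Fin 2 → QSpace k k) →ₗ[ℝ] ℝ :=
  LinearMap.mk₂ ℝ
    (fun u v => refInt (∑ m, (u m : MvPolynomial (Fin 2) ℝ) * (v m : MvPolynomial (Fin 2) ℝ)))
    (fun u u' v => by
      simp only [Pi.add_apply, Submodule.coe_add, add_mul, Finset.sum_add_distrib, refInt_add])
    (fun c u v => by
      simp only [Pi.smul_apply, Submodule.coe_smul, smul_mul_assoc, ← Finset.smul_sum,
        refInt_smul, smul_eq_mul])
    (fun u v v' => by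
      simp only [Pi.add_apply, Submodule.coe_add, mul_add, Finset.sum_add_distrib, refInt_add])
    (fun c u v => by
      simp only [Pi.smul_apply, Submodule.coe_smul, mul_smul_comm, ← Finset.smul_sum,
        refInt_smul, smul_eq_mul])

theorem fieldForm_apply {k : ℕ} (u v : Fin 2 → QSpace k k) : fieldForm k u v
    = refInt (∑ m, (u m : MvPolynomial (Fin 2) ℝ) * (v m : MvPolynomial (Fin 2) ℝ)) := rfl

/-- The `L²` inner product on the multiplier space. -/
def multForm (k : ℕ) : MSpace k →ₗ[ℝ] MSpace k →ₗ[ℝ] ℝ :=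
  LinearMap.mk₂ ℝ
    (fun p q => refInt ((p : MvPolynomial (Fin 2) ℝ) * (q : MvPolynomial (Fin 2) ℝ)))
    (fun u u' v => by simp only [Submodule.coe_add, add_mul, refInt_add])
    (fun c u v => by simp only [Submodule.coe_smul, smul_mul_assoc, refInt_smul, smul_eq_mul])
    (fun u v v' => by simp only [Submodule.coe_add, mul_add, refInt_add])
    (fun c u v => by simp only [Submodule.coe_smul, mul_smul_comm, refInt_smul, smul_eq_mul])

theorem multForm_apply {k : ℕ} (p q : MSpace k) : multForm k p q
    = refInt ((p : MvPolynomial (Fin 2) ℝ) * (q : MvPolynomial (Fin 2) ℝ)) := rfl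

/-- The divergence from `Q^k × Q^k` to the multiplier space. -/
def divLin (k : ℕ) : (Fin 2 → QSpace k k) →ₗ[ℝ] MSpace k where
  toFun v := ⟨refDiv fun m => v m, refDiv_mem fun m => (v m).2⟩
  map_add' u v := by
    ext1
    simp only [refDiv, Pi.add_apply, Submodule.coe_add, map_add]
    abel
  map_smul' c v := by
    ext1
    simp only [refDiv, Pi.smul_apply, Submodule.coe_smul, Derivation.map_smul, smul_add,
      RingHom.id_apply]

theorem divLin_apply {k : ℕ} (v : Fin 2 → QSpace k k) :
    (divLin k v : MvPolynomial (Fin 2) ℝ) = refDiv fun m => (v m : MvPolynomial (Fin 2) ℝ) := rfl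

namespace Disc

variable {k : ℕ} (S : Disc k)

theorem refInterp_mem (b : Fin (k + 1) → Fin (k + 1) → ℝ) : S.refInterp b ∈ QSpace k k := by
  refine Submodule.sum_mem _ fun α _ => Submodule.sum_mem _ fun β _ => ?_
  rw [← MvPolynomial.smul_eq_C_mul]
  exact Submodule.smul_mem _ _ (aeval_mul_aeval_mem_QSpace (S.X.natDegree_basis α).le
    (S.X.natDegree_basis β).le)

/-- Interpolation as a linear map. -/
def refInterpLin : (Fin (k + 1) → Fin (k + 1) → ℝ) →ₗ[ℝ] MvPolynomial (Fin 2) ℝ where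
  toFun := S.refInterp
  map_add' b b' := by
    simp only [refInterp, Pi.add_apply, map_add, add_mul, Finset.sum_add_distrib]
  map_smul' c b := by
    simp only [refInterp, Pi.smul_apply, smul_eq_mul, map_mul, mul_assoc, Finset.smul_sum,
      MvPolynomial.smul_eq_C_mul, RingHom.id_apply]

theorem refInterpLin_apply (b : Fin (k + 1) → Fin (k + 1) → ℝ) :
    S.refInterpLin b = S.refInterp b := rfl

/-- A polynomial in `Q^k` is the interpolant of its nodal values. -/
theorem eq_refInterp {P : MvPolynomial (Fin 2) ℝ} (hP : P ∈ QSpace k k) :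
    P = S.refInterp fun α β => MvPolynomial.eval ![S.X.node α, S.X.node β] P := by
  refine QSpace_induction (C := fun P => P = S.refInterp fun α β =>
    MvPolynomial.eval ![S.X.node α, S.X.node β] P) ?_ ?_ ?_ ?_ hP
  · intro m n hm hn
    have h : ∀ (i : Fin 2) (m : ℕ), m ≤ k → (MvPolynomial.X i ^ m : MvPolynomial (Fin 2) ℝ)
        = ∑ α, MvPolynomial.C (S.X.node α ^ m)
            * Polynomial.aeval (MvPolynomial.X i) (S.X.basis α) := by
      intro i m hm
      have := congrArg (Polynomial.aeval (MvPolynomial.X i : MvPolynomial (Fin 2) ℝ))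
        (S.X.eq_sum_basis (f := Polynomial.X ^ m) (by simpa using hm))
      simpa [MvPolynomial.algebraMap_eq] using this
    conv_lhs => rw [h 0 m hm, h 1 n hn, Finset.sum_mul_sum]
    rw [refInterp]
    refine Finset.sum_congr rfl fun α _ => Finset.sum_congr rfl fun β _ => ?_
    simp
    ring
  · have := S.refInterpLin.map_zero
    rw [refInterpLin_apply] at this
    simp only [map_zero]
    exact this.symm
  · intro P Q h1 h2
    have := S.refInterpLin.map_add (fun α β => MvPolynomial.eval ![S.X.node α, S.X.node β] P)
      (fun α β => MvPolynomial.eval ![S.X.node α, S.X.node β] Q)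
    simp only [refInterpLin_apply] at this
    rw [← h1, ← h2] at this
    refine this.symm.trans ?_
    congr 1
    funext α β
    simp
  · intro c P h
    have := S.refInterpLin.map_smul c (fun α β => MvPolynomial.eval ![S.X.node α, S.X.node β] P)
    simp only [refInterpLin_apply] at this
    rw [← h] at this
    refine this.symm.trans ?_
    congr 1
    funext α β
    simp

theorem finiteDimensional_QSpace (S : Disc k) : FiniteDimensional ℝ (QSpace k k) := by
  have h : QSpace k k ≤ LinearMap.range S.refInterpLin := fun P hP =>
    ⟨_, (S.eq_refInterp hP).symm⟩
  exact Submodule.finiteDimensional_of_le h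

/-- Definiteness of the L² form: all nodal values must vanish, and a polynomial in `Q^k` is the
interpolant of its nodal values. -/
theorem eq_zero_of_refInt_mul_self (S : Disc k) (hk : 1 ≤ k) {P : MvPolynomial (Fin 2) ℝ}
    (hP : P ∈ QSpace k k) (h : refInt (P * P) = 0) : P = 0 := by
  have h0 : ∀ α β, MvPolynomial.eval ![S.X.node α, S.X.node β] P = 0 := by
    intro α β
    by_contra hne
    exact (refInt_mul_self_pos (S.X.node_mem_Icc hk α) (S.X.node_mem_Icc hk β) hne).ne' h
  rw [S.eq_refInterp hP]
  simp [h0, refInterp]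

theorem refInt_refInterp (b : Fin (k + 1) → Fin (k + 1) → ℝ) :
    refInt (S.refInterp b) = ∑ α, ∑ β, S.X.weight α * S.X.weight β * b α β := by
  have h : refInt (S.refInterp b)
      = ∑ α, ∑ β, b α β * refInt (Polynomial.aeval (MvPolynomial.X 0) (S.X.basis α) *
        Polynomial.aeval (MvPolynomial.X 1) (S.X.basis β)) := by
    simp only [← refIntLin_apply, refInterp, map_sum, ← MvPolynomial.smul_eq_C_mul, map_smul,
      smul_eq_mul]
  rw [h]
  refine Finset.sum_congr rfl fun α _ => Finset.sum_congr rfl fun β _ => ?_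
  rw [mul_comm]
  congr 1
  simp only [refInt, map_mul, eval_aeval_X]
  simp only [Matrix.cons_val_zero, Matrix.cons_val_one, intervalIntegral.integral_const_mul,
    intervalIntegral.integral_mul_const]
  rfl

/-! ### The projection onto locally divergence-free fields -/

theorem refDiv_eq_zero (S : Disc k) (hk : 1 ≤ k) {B₀ B : Fin 2 → MvPolynomial (Fin 2) ℝ}
    (h : IsRefLDFProjection k B₀ B) : refDiv B = 0 := by
  obtain ⟨hB, p, _, _, h2⟩ := h
  have hm := refDiv_mem hB
  exact S.eq_zero_of_refInt_mul_self hk (MSpace_le k hm) (h2 _ hm)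

theorem refInt_sum_mul_self_eq_zero (S : Disc k) (hk : 1 ≤ k) {D : Fin 2 → MvPolynomial (Fin 2) ℝ}
    (hD : ∀ m, D m ∈ QSpace k k) (h : refInt (∑ m, D m * D m) = 0) : D = 0 := by
  rw [Fin.sum_univ_two, refInt_add] at h
  have h0 := refInt_mul_self_nonneg (D 0)
  have h1 := refInt_mul_self_nonneg (D 1)
  funext m
  fin_cases m
  · exact S.eq_zero_of_refInt_mul_self hk (hD 0) (by change refInt (D 0 * D 0) = 0; linarith)
  · exact S.eq_zero_of_refInt_mul_self hk (hD 1) (by change refInt (D 1 * D 1) = 0; linarith)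

/-- The difference of two solutions is divergence-free, so testing with it removes both multipliers.
The multipliers themselves are not compared. -/
theorem refLDFProjection_unique (S : Disc k) (hk : 1 ≤ k) {B₀ B B' : Fin 2 → MvPolynomial (Fin 2) ℝ}
    (h : IsRefLDFProjection k B₀ B) (h' : IsRefLDFProjection k B₀ B') : B = B' := by
  have d := S.refDiv_eq_zero hk h
  have d' := S.refDiv_eq_zero hk h'
  obtain ⟨hB, p, -, h1, -⟩ := h
  obtain ⟨hB', p', -, h1', -⟩ := h'
  have hD : ∀ m, (B - B') m ∈ QSpace k k := fun m => Submodule.sub_mem _ (hB m) (hB' m)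
  have dD : refDiv (B - B') = 0 := by
    have : refDiv (B - B') = refDiv B - refDiv B' := by
      simp only [refDiv, Pi.sub_apply, map_sub]; abel
    rw [this, d, d', sub_zero]
  have e := h1 _ hD
  have e' := h1' _ hD
  rw [dD, mul_zero] at e e'
  refine sub_eq_zero.1 (S.refInt_sum_mul_self_eq_zero hk hD ?_)
  have : (∑ m, (B - B') m * (B - B') m) = ∑ m, B m * (B - B') m - ∑ m, B' m * (B - B') m := by
    rw [← Finset.sum_sub_distrib]
    exact Finset.sum_congr rfl fun m _ => by rw [Pi.sub_apply]; ring
  rw [this, ← refIntLin_apply, map_sub, refIntLin_apply, refIntLin_apply]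
  linarith

theorem exists_refLDFProjection (S : Disc k) (hk : 1 ≤ k)
    {B₀ : Fin 2 → MvPolynomial (Fin 2) ℝ}
    (hB₀ : ∀ m, B₀ m ∈ QSpace k k) : ∃ B, IsRefLDFProjection k B₀ B := by
  have := S.finiteDimensional_QSpace
  have : FiniteDimensional ℝ (MSpace k) := Submodule.finiteDimensional_of_le (MSpace_le k)
  obtain ⟨B, p, hB, hp⟩ := exists_saddle (fieldForm k) (multForm k)
    (fun u hu => by
      rw [fieldForm_apply] at hu
      have := S.refInt_sum_mul_self_eq_zero hk (fun m => (u m).2) hu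
      funext m
      exact Subtype.ext (congrFun this m))
    (fun u hu => Subtype.ext (S.eq_zero_of_refInt_mul_self hk (MSpace_le k u.2) (by
      rwa [multForm_apply] at hu)))
    (divLin k) (fun m => ⟨B₀ m, hB₀ m⟩)
  refine ⟨fun m => B m, fun m => (B m).2, p, p.2, ?_, ?_⟩
  · intro v hv
    have h := hp fun m => ⟨v m, hv m⟩
    rw [fieldForm_apply, fieldForm_apply, multForm_apply, divLin_apply] at h
    exact h
  · intro q _
    have h0 := divLin_apply B
    rw [hB, Submodule.coe_zero] at h0
    rw [← h0, zero_mul, ← refIntLin_apply, map_zero]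

variable {G : Grid}

theorem map_avg {E : Type*} [AddCommGroup E] [Module ℝ E] (φ : State →ₗ[ℝ] E) (c : CellSol k) :
    φ (S.avg c) = (1 / 4 : ℝ) • ∑ α, ∑ β, (S.X.weight α * S.X.weight β) • φ (c α β) := by
  simp only [avg, map_smul, map_sum]

theorem rho_avg (c : CellSol k) : rho (S.avg c)
    = (1 / 4 : ℝ) • ∑ α, ∑ β, (S.X.weight α * S.X.weight β) • rho (c α β) :=
  S.map_avg (LinearMap.fst ℝ ℝ ((Fin 3 → ℝ) × (Fin 3 → ℝ) × ℝ)) c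

theorem mom_avg (c : CellSol k) : mom (S.avg c)
    = (1 / 4 : ℝ) • ∑ α, ∑ β, (S.X.weight α * S.X.weight β) • mom (c α β) :=
  S.map_avg (LinearMap.fst ℝ (Fin 3 → ℝ) ((Fin 3 → ℝ) × ℝ) ∘ₗ
    LinearMap.snd ℝ ℝ ((Fin 3 → ℝ) × (Fin 3 → ℝ) × ℝ)) c

theorem mag_avg (c : CellSol k) : mag (S.avg c)
    = (1 / 4 : ℝ) • ∑ α, ∑ β, (S.X.weight α * S.X.weight β) • mag (c α β) :=
  S.map_avg (LinearMap.fst ℝ (Fin 3 → ℝ) ℝ ∘ₗ LinearMap.snd ℝ (Fin 3 → ℝ) ((Fin 3 → ℝ) × ℝ) ∘ₗ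
    LinearMap.snd ℝ ℝ ((Fin 3 → ℝ) × (Fin 3 → ℝ) × ℝ)) c

theorem ener_avg (c : CellSol k) : ener (S.avg c)
    = (1 / 4 : ℝ) • ∑ α, ∑ β, (S.X.weight α * S.X.weight β) • ener (c α β) :=
  S.map_avg (LinearMap.snd ℝ (Fin 3 → ℝ) ℝ ∘ₗ LinearMap.snd ℝ (Fin 3 → ℝ) ((Fin 3 → ℝ) × ℝ) ∘ₗ
    LinearMap.snd ℝ ℝ ((Fin 3 → ℝ) × (Fin 3 → ℝ) × ℝ)) c

theorem piola_mem (w : Sol k G) (i : Fin G.Nx) (j : Fin G.Ny) (m : Fin 2) :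
    S.piola w i j m ∈ QSpace k k := by
  fin_cases m
  · exact S.refInterp_mem _
  · exact S.refInterp_mem _

theorem state_ext {w z : State} (h1 : rho w = rho z) (h2 : mom w = mom z)
    (h30 : mag w 0 = mag z 0) (h31 : mag w 1 = mag z 1) (h32 : mag w 2 = mag z 2)
    (h4 : ener w = ener z) : w = z := by
  refine Prod.ext h1 (Prod.ext h2 (Prod.ext ?_ h4))
  funext m
  fin_cases m
  · exact h30
  · exact h31
  · exact h32

theorem existsUnique_isLDFProjection (hk : 1 ≤ k) (w : Sol k G) :
    ∃! w', S.IsLDFProjection w w' := by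
  have hx := G.hx_pos.ne'
  have hy := G.hy_pos.ne'
  choose B hB using fun i j => S.exists_refLDFProjection hk (S.piola_mem w i j)
  -- The factors 2/h_y and 2/h_x undo the Piola scaling at the nodes.
  refine ⟨fun i j α β => (rho (w i j α β), mom (w i j α β),
    ![2 / G.hy * MvPolynomial.eval ![S.X.node α, S.X.node β] (B i j 0),
      2 / G.hx * MvPolynomial.eval ![S.X.node α, S.X.node β] (B i j 1), mag (w i j α β) 2],
    ener (w i j α β)), ?_, ?_⟩
  · intro i j
    refine ⟨fun α β => ⟨rfl, rfl, rfl, rfl⟩, ?_⟩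
    convert hB i j using 1
    funext m
    fin_cases m
    · refine Eq.trans ?_ (S.eq_refInterp ((hB i j).1 0)).symm
      change S.refInterp _ = _
      congr 1
      funext α β
      simp only [mag, Matrix.cons_val_zero]
      field_simp
    · refine Eq.trans ?_ (S.eq_refInterp ((hB i j).1 1)).symm
      change S.refInterp _ = _
      congr 1
      funext α β
      change G.hx / 2 * (2 / G.hx * MvPolynomial.eval ![S.X.node α, S.X.node β] (B i j 1)) = _
      field_simp
  · intro w' hw'
    funext i j α β
    obtain ⟨h1, h2⟩ := hw' i j
    have e := S.refLDFProjection_unique hk h2 (hB i j)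
    obtain ⟨a1, a2, a3, a4⟩ := h1 α β
    refine state_ext a1 a2 ?_ ?_ a3 a4
    · have := congrArg (MvPolynomial.eval ![S.X.node α, S.X.node β]) (congrFun e 0)
      change MvPolynomial.eval _ (S.refInterp _) = _ at this
      rw [eval_refInterp_node] at this
      change _ = 2 / G.hy * MvPolynomial.eval ![S.X.node α, S.X.node β] (B i j 0)
      rw [← this]
      field_simp
    · have := congrArg (MvPolynomial.eval ![S.X.node α, S.X.node β]) (congrFun e 1)
      change MvPolynomial.eval _ (S.refInterp _) = _ at this
      rw [eval_refInterp_node] at this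
      change _ = 2 / G.hx * MvPolynomial.eval ![S.X.node α, S.X.node β] (B i j 1)
      rw [← this]
      field_simp

theorem LDF_of_isLDFProjection (hk : 1 ≤ k) {w w' : Sol k G} (h : S.IsLDFProjection w w') :
    S.LDF w' := by
  intro i j x y _
  rw [divB_eq_refDiv, S.refDiv_eq_zero hk (h i j).2]
  simp

theorem C_mem_QSpace (k : ℕ) (c : ℝ) : (MvPolynomial.C c : MvPolynomial (Fin 2) ℝ) ∈ QSpace k k := by
  have := Submodule.smul_mem (QSpace k k) c
    (X_pow_mul_X_pow_mem_QSpace (a := k) (b := k) (Nat.zero_le k) (Nat.zero_le k))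
  simpa [MvPolynomial.smul_eq_C_mul] using this

/-- Constant fields are divergence-free, so testing with a coordinate field loses the multiplier and
leaves the mean of one component. -/
theorem refInt_eq_of_isRefLDFProjection {B₀ B : Fin 2 → MvPolynomial (Fin 2) ℝ}
    (h : IsRefLDFProjection k B₀ B) (m : Fin 2) : refInt (B m) = refInt (B₀ m) := by
  obtain ⟨-, p, -, h1, -⟩ := h
  have hv : ∀ n, (Pi.single m 1 : Fin 2 → MvPolynomial (Fin 2) ℝ) n ∈ QSpace k k := by
    intro n
    by_cases hn : n = m
    · subst hn
      rw [Pi.single_eq_same, ← MvPolynomial.C_1]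
      exact C_mem_QSpace k 1
    · rw [Pi.single_eq_of_ne hn]
      exact Submodule.zero_mem _
  have e := h1 _ hv
  have hd : refDiv (Pi.single m 1 : Fin 2 → MvPolynomial (Fin 2) ℝ) = 0 := by
    fin_cases m <;> simp [refDiv]
  have z : refInt (0 : MvPolynomial (Fin 2) ℝ) = 0 := refIntLin.map_zero
  rw [hd, mul_zero, z, add_zero] at e
  simpa [Pi.single_apply] using e

theorem avg_of_isLDFProjection {w w' : Sol k G} (h : S.IsLDFProjection w w')
    (i : Fin G.Nx) (j : Fin G.Ny) : S.avg (w' i j) = S.avg (w i j) := by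
  have hx := G.hx_pos.ne'
  have hy := G.hy_pos.ne'
  obtain ⟨h1, h2⟩ := h i j
  have r0 := refInt_eq_of_isRefLDFProjection h2 0
  have r1 := refInt_eq_of_isRefLDFProjection h2 1
  change refInt (S.refInterp _) = refInt (S.refInterp _) at r0 r1
  simp only [refInt_refInterp, mul_left_comm _ (G.hy / 2), mul_left_comm _ (G.hx / 2),
    ← Finset.mul_sum] at r0 r1
  have r0' := mul_left_cancel₀ (div_ne_zero hy two_ne_zero) r0
  have r1' := mul_left_cancel₀ (div_ne_zero hx two_ne_zero) r1
  have hm : ∀ m, ∑ α, ∑ β, S.X.weight α * S.X.weight β * mag (w' i j α β) m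
      = ∑ α, ∑ β, S.X.weight α * S.X.weight β * mag (w i j α β) m →
      mag (S.avg (w' i j)) m = mag (S.avg (w i j)) m := by
    intro m hm
    simp only [mag_avg, Pi.smul_apply, Finset.sum_apply, smul_eq_mul, hm]
  refine state_ext ?_ ?_ (hm 0 r0') (hm 1 r1') (hm 2 ?_) ?_
  · simp only [rho_avg, (h1 _ _).1]
  · simp only [mom_avg, (h1 _ _).2.1]
  · simp only [(h1 _ _).2.2.1]
  · simp only [ener_avg, (h1 _ _).2.2.2]

end Disc

end MHD

end

noncomputable section

namespace MHD

open Matrix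

/-! ### Convexity of the set of admissible states -/

theorem gqlForm_self {w : State} (h : rho w ≠ 0) :
    gqlForm (vel w) (mag w) w + (mag w ⬝ᵥ mag w) / 2 = internal w := by
  rw [gqlForm_add h]; simp

theorem internal_le_gqlForm {w : State} (h : 0 < rho w) (v b : Fin 3 → ℝ) :
    internal w ≤ gqlForm v b w + (b ⬝ᵥ b) / 2 := by
  rw [gqlForm_add h.ne']
  have h1 := mul_nonneg (half_pos h).le (dotProduct_self_nonneg' (vel w - v))
  have h2 := dotProduct_self_nonneg' (mag w - b)
  linarith

/-- Once the density is known to be positive, the form with `v` and `b` taken from the state itself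
evaluates to its internal energy. -/
theorem admissible_of_forms {γ : ℝ} (hγ : 1 < γ) {w : State}
    (h : ∀ φ c κ, IsPPForm γ φ c κ → 0 < φ w + c) : Admissible γ w := by
  have hρ : 0 < rho w := by simpa [rhoForm_apply] using h _ _ _ (isPPForm_rho hγ)
  rw [admissible_iff hγ]
  refine ⟨hρ, ?_⟩
  rw [← gqlForm_self hρ.ne']
  exact h _ _ _ (isPPForm_gql hγ (vel w) (mag w))

/-- The internal energy is a minimum of affine functions; the one that is tight at the combined
state is compared at both end states. -/
theorem internal_concave {w z : State} (hw : 0 < rho w) (hz : 0 < rho z) {θ : ℝ} (h0 : 0 ≤ θ)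
    (h1 : θ ≤ 1) :
    (1 - θ) * internal w + θ * internal z ≤ internal (w + θ • (z - w)) := by
  set s := w + θ • (z - w) with hs
  have hlin : ∀ φ : State →ₗ[ℝ] ℝ, φ s = (1 - θ) * φ w + θ * φ z := by
    intro φ
    simp only [hs, map_add, map_smul, map_sub, smul_eq_mul]
    ring
  have hρ : rho s = (1 - θ) * rho w + θ * rho z := hlin rhoForm
  have hpos : 0 < rho s := by
    rw [hρ]
    rcases h0.eq_or_lt with h | h
    · rw [← h]; linarith
    · have := mul_pos h hz
      have := mul_nonneg (sub_nonneg.2 h1) hw.le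
      linarith
  rw [← gqlForm_self hpos.ne', hlin]
  have a := mul_le_mul_of_nonneg_left (internal_le_gqlForm hw (vel s) (mag s)) (sub_nonneg.2 h1)
  have b := mul_le_mul_of_nonneg_left (internal_le_gqlForm hz (vel s) (mag s)) h0
  linarith

/-- Terms with zero coefficient may be arbitrary; this is why a Runge-Kutta stage needs the CFL
condition only where its coefficient is nonzero. -/
theorem admissible_sum {γ : ℝ} (hγ : 1 < γ) {ι : Type*} (s : Finset ι) (a : ι → ℝ)
    (z : ι → State) (ha : ∀ i ∈ s, 0 ≤ a i) (hsum : ∑ i ∈ s, a i = 1)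
    (hz : ∀ i ∈ s, a i ≠ 0 → Admissible γ (z i)) : Admissible γ (∑ i ∈ s, a i • z i) := by
  refine admissible_of_forms hγ fun φ c κ hφ => ?_
  have e : φ (∑ i ∈ s, a i • z i) + c = ∑ i ∈ s, a i * (φ (z i) + c) := by
    simp only [map_sum, map_smul, smul_eq_mul, mul_add, Finset.sum_add_distrib,
      ← Finset.sum_mul, hsum, one_mul]
  rw [e]
  obtain ⟨i, hi, hne⟩ : ∃ i ∈ s, a i ≠ 0 := by
    by_contra hcon
    push Not at hcon
    rw [Finset.sum_eq_zero hcon] at hsum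
    exact zero_ne_one hsum
  have hpos : ∀ i ∈ s, a i ≠ 0 → 0 < a i * (φ (z i) + c) := fun i hi hne =>
    mul_pos (lt_of_le_of_ne (ha i hi) (Ne.symm hne)) (hφ.pos _ (hz i hi hne))
  refine Finset.sum_pos' (fun i hi => ?_) ⟨i, hi, hpos i hi hne⟩
  by_cases h : a i = 0
  · rw [h, zero_mul]
  · exact (hpos i hi h).le

theorem admissible_add {γ : ℝ} (hγ : 1 < γ) {a b : ℝ} (ha : 0 ≤ a) (hb : 0 ≤ b)
    (hab : a + b = 1) {w z : State} (hw : Admissible γ w) (hz : Admissible γ z) :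
    Admissible γ (a • w + b • z) := by
  have := admissible_sum hγ Finset.univ ![a, b] ![w, z]
    (fun i _ => by fin_cases i <;> simpa) (by simpa using hab)
    (fun i _ _ => by fin_cases i <;> simpa)
  simpa using this

namespace Disc

variable {k : ℕ} (S : Disc k) {G : Grid}

/-! ### Cell averages -/

/-- The cell average as a linear map. -/
def avgLin : CellSol k →ₗ[ℝ] State where
  toFun := S.avg
  map_add' c c' := by
    simp only [avg, Pi.add_apply, smul_add, Finset.sum_add_distrib]
  map_smul' a c := by
    simp only [avg, Pi.smul_apply, Finset.smul_sum, RingHom.id_apply]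
    exact Finset.sum_congr rfl fun α _ => Finset.sum_congr rfl fun β _ => by
      rw [smul_comm _ a, smul_comm _ a]

theorem avgLin_apply (c : CellSol k) : S.avgLin c = S.avg c := rfl

theorem sum_weight_mul_weight : ∑ α, ∑ β, S.X.weight α * S.X.weight β = 4 := by
  rw [← Finset.sum_mul_sum, S.X.sum_weight]
  norm_num

theorem avg_const (z : State) : S.avg (fun _ _ => z) = z := by
  simp only [avg, ← Finset.sum_smul, sum_weight_mul_weight, smul_smul]
  norm_num

/-- Averaging is linear and fixes constants, so any real factor is allowed. Damping with arbitrary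
coefficients and both limiter steps rest on this. -/
theorem avg_scaled (θ : ℝ) (c : CellSol k) :
    S.avg (fun α β => S.avg c + θ • (c α β - S.avg c)) = S.avg c := by
  have e : (fun α β => S.avg c + θ • (c α β - S.avg c))
      = (fun _ _ => S.avg c) + θ • (c - fun _ _ => S.avg c) := rfl
  rw [e, ← avgLin_apply, map_add, map_smul, map_sub]
  simp only [avgLin_apply, avg_const, sub_self, smul_zero, add_zero]

theorem avg_admissible (hk : 1 ≤ k) (hγ : 1 < S.γ) {c : CellSol k}
    (hc : ∀ α β, Admissible S.γ (c α β)) : Admissible S.γ (S.avg c) := by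
  have h := admissible_sum hγ Finset.univ
    (fun n : Fin (k + 1) × Fin (k + 1) => 1 / 4 * (S.X.weight n.1 * S.X.weight n.2))
    (fun n => c n.1 n.2)
    (fun n _ => by
      have := S.X.weight_pos hk n.1
      have := S.X.weight_pos hk n.2
      positivity)
    (by
      rw [← Finset.mul_sum, Fintype.sum_prod_type]
      simp only [sum_weight_mul_weight]
      norm_num)
    (fun n _ _ => hc _ _)
  rw [Fintype.sum_prod_type] at h
  simpa only [avg, Finset.smul_sum, smul_smul] using h

theorem avgAdmissible_of_nodallyAdmissible (hk : 1 ≤ k) (hγ : 1 < S.γ) {w : Sol k G}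
    (hw : NodallyAdmissible S.γ w) : S.AvgAdmissible w :=
  fun i j => S.avg_admissible hk hγ (hw i j)

/-! ### Damping and limiting -/

theorem LDF_oedg (δ : Fin (k + 1) → Sol k G → Fin G.Nx → Fin G.Ny → ℝ) (t : ℝ) {w : Sol k G}
    (h : S.LDF w) : S.LDF (S.oedg δ t w) :=
  S.LDF_of_scaled h (fun i j => Real.exp (-t * ∑ m, δ m w i j)) (fun i j => mag (S.avg (w i j)))
    fun _ _ _ _ => rfl

theorem avg_oedg (δ : Fin (k + 1) → Sol k G → Fin G.Nx → Fin G.Ny → ℝ) (t : ℝ) (w : Sol k G)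
    (i : Fin G.Nx) (j : Fin G.Ny) : S.avg (S.oedg δ t w i j) = S.avg (w i j) :=
  S.avg_scaled _ _

theorem avg_ppDensity (ε : ℝ) (c : CellSol k) : S.avg (S.ppDensity ε c) = S.avg c := by
  refine Prod.ext ?_ (Prod.ext ?_ (Prod.ext ?_ ?_))
  · change rho _ = rho _
    have h := congrArg rho
      (S.avg_scaled (scale (rho (S.avg c)) (min ε (rho (S.avg c))) (nodeMin rho c)) c)
    rw [rho_avg] at h ⊢
    exact h
  · change mom _ = mom _
    rw [mom_avg, mom_avg]; rfl
  · change mag _ = mag _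
    rw [mag_avg, mag_avg]; rfl
  · change ener _ = ener _
    rw [ener_avg, ener_avg]; rfl

theorem avg_ppLimiter (ε : ℝ) (w : Sol k G) (i : Fin G.Nx) (j : Fin G.Ny) :
    S.avg (S.ppLimiter ε w i j) = S.avg (w i j) :=
  (S.avg_scaled _ _).trans (S.avg_ppDensity ε _)

theorem LDF_ppLimiter (ε : ℝ) {w : Sol k G} (h : S.LDF w) : S.LDF (S.ppLimiter ε w) :=
  S.LDF_of_scaled h
    (fun i j => scale (internal (S.avg (S.ppDensity ε (w i j))))
      (min ε (internal (S.avg (S.ppDensity ε (w i j)))))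
      (nodeMin internal (S.ppDensity ε (w i j))))
    (fun i j => mag (S.avg (S.ppDensity ε (w i j)))) fun _ _ _ _ => rfl

theorem nodeMin_le (q : State → ℝ) (c : CellSol k) (α β : Fin (k + 1)) :
    nodeMin q c ≤ q (c α β) :=
  Finset.inf'_le (fun n : Fin (k + 1) × Fin (k + 1) => q (c n.1 n.2)) (Finset.mem_univ (α, β))

theorem scale_mem {a e m : ℝ} (h : e ≤ a) : 0 ≤ scale a e m ∧ scale a e m ≤ 1 := by
  rw [scale]
  split_ifs with hm
  · norm_num
  · rw [not_le] at hm
    exact ⟨div_nonneg (by linarith) (by linarith), (div_le_one (by linarith)).2 (by linarith)⟩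

/-- The scaled minimum reaches the threshold. -/
theorem le_scaled_min {a e m : ℝ} (h : e ≤ a) : e ≤ (1 - scale a e m) * a + scale a e m * m := by
  rw [scale]
  split_ifs with hm
  · linarith
  · rw [not_le] at hm
    have : a - m ≠ 0 := by linarith
    have e1 : (1 - (a - e) / (a - m)) * a + (a - e) / (a - m) * m = e := by
      field_simp; ring
    rw [e1]

theorem rho_ppDensity_pos {ε : ℝ} (hε : 0 < ε) {c : CellSol k} (h : 0 < rho (S.avg c))
    (α β : Fin (k + 1)) : 0 < rho (S.ppDensity ε c α β) := by
  change 0 < rho (S.avg c) + scale (rho (S.avg c)) (min ε (rho (S.avg c))) (nodeMin rho c)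
    * (rho (c α β) - rho (S.avg c))
  have h1 := le_scaled_min (m := nodeMin rho c) (min_le_right ε (rho (S.avg c)))
  have h2 := (scale_mem (m := nodeMin rho c) (min_le_right ε (rho (S.avg c)))).1
  have h3 := mul_le_mul_of_nonneg_left (nodeMin_le rho c α β) h2
  have h4 : 0 < min ε (rho (S.avg c)) := lt_min hε h
  linarith

/-- By concavity the internal energy of a scaled state is at least the same combination of average
and nodal minimum, which the limiter lifts to its positive threshold. Density stays positive as a
convex combination. -/
theorem ppEnergy_admissible (hγ : 1 < S.γ) {ε : ℝ} (hε : 0 < ε) {c : CellSol k}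
    (h : Admissible S.γ (S.avg c)) (hc : ∀ α β, 0 < rho (c α β)) (α β : Fin (k + 1)) :
    Admissible S.γ (S.ppEnergy ε c α β) := by
  rw [admissible_iff hγ] at h ⊢
  have hs := scale_mem (m := nodeMin internal c) (min_le_right ε (internal (S.avg c)))
  have h1 := le_scaled_min (m := nodeMin internal c) (min_le_right ε (internal (S.avg c)))
  have h4 : 0 < min ε (internal (S.avg c)) := lt_min hε h.2
  change 0 < rho (S.avg c + scale (internal (S.avg c)) (min ε (internal (S.avg c)))
      (nodeMin internal c) • (c α β - S.avg c)) ∧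
    0 < internal (S.avg c + scale (internal (S.avg c)) (min ε (internal (S.avg c)))
      (nodeMin internal c) • (c α β - S.avg c))
  generalize scale (internal (S.avg c)) (min ε (internal (S.avg c))) (nodeMin internal c) = θ at *
  constructor
  · change 0 < rho (S.avg c) + θ * (rho (c α β) - rho (S.avg c))
    have h5 := hc α β
    rcases hs.1.eq_or_lt with h0 | h0
    · rw [← h0]; linarith [h.1]
    · have := mul_pos h0 h5
      have := mul_nonneg (sub_nonneg.2 hs.2) h.1.le
      linarith
  · refine lt_of_lt_of_le ?_ (internal_concave h.1 (hc α β) hs.1 hs.2)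
    have h3 := mul_le_mul_of_nonneg_left (nodeMin_le internal c α β) hs.1
    linarith

theorem nodallyAdmissible_ppLimiter (hγ : 1 < S.γ) {ε : ℝ} (hε : 0 < ε) {w : Sol k G}
    (h : S.AvgAdmissible w) : NodallyAdmissible S.γ (S.ppLimiter ε w) := by
  intro i j α β
  refine S.ppEnergy_admissible hγ hε ?_ (fun α β => S.rho_ppDensity_pos hε (h i j).1 α β) α β
  rw [avg_ppDensity]
  exact h i j

theorem isLimited_spec (hk : 1 ≤ k) (hγ : 1 < S.γ)
    {δ : Fin (k + 1) → Sol k G → Fin G.Nx → Fin G.Ny → ℝ} {ε t : ℝ} (hε : 0 < ε)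
    {raw out : Sol k G} (h : S.IsLimited δ ε t raw out) (hraw : S.AvgAdmissible raw) :
    NodallyAdmissible S.γ out ∧ S.LDF out ∧ S.AvgAdmissible out := by
  obtain ⟨w, hw, rfl⟩ := h
  have hn : NodallyAdmissible S.γ (S.ppLimiter ε (S.oedg δ t w)) := by
    refine S.nodallyAdmissible_ppLimiter hγ hε fun i j => ?_
    rw [avg_oedg, S.avg_of_isLDFProjection hw]
    exact hraw i j
  exact ⟨hn, S.LDF_ppLimiter ε (S.LDF_oedg δ t (S.LDF_of_isLDFProjection hk hw)),
    S.avgAdmissible_of_nodallyAdmissible hk hγ hn⟩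

/-! ### Forward Euler steps -/

/-- The CFL condition uses the end weight at every node. That is harmless: interior speeds vanish
and the two end weights agree. -/
theorem weight_zero_mul_nodeSpeed (hk : 1 ≤ k) (d : Fin 3) (u : Fin (k + 1) → State)
    (eL eR : State) (α : Fin (k + 1)) :
    S.X.weight 0 * S.nodeSpeed d u eL eR α = S.X.weight α * S.nodeSpeed d u eL eR α := by
  by_cases h0 : α = 0
  · rw [h0]
  · by_cases h1 : α = Fin.last k
    · rw [h1, S.X.weight_last hk]
    · simp [nodeSpeed, h0, h1]

theorem avg1_admissible_euler (hk : 1 ≤ k) (hγ : 1 < S.γ) (hfS : IsTwoPointFlux S.γ S.fS)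
    (hsp : PPSpeeds S.γ S.SL S.SR) {G : Grid1} {bc : Sol1 k G → State × State}
    (hbc : ∀ w, (∀ i α, Admissible S.γ (w i α)) →
      Admissible S.γ (bc w).1 ∧ Admissible S.γ (bc w).2)
    {w : Sol1 k G} {τ : ℝ} (hw : ∀ i α, Admissible S.γ (w i α)) (hldf : S.LDF1 w)
    (hτ : 0 ≤ τ) (hcfl : S.CFL1 bc w τ) (i : Fin G.N) :
    Admissible S.γ (S.avg1 ((w + τ • S.L1 bc w) i)) := by
  have hh := G.h_pos
  refine admissible_of_forms hγ fun φ c κ hφ => ?_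
  have hL : Admissible S.γ (extL1 (bc w) w i) := by
    rw [extL1]; split_ifs
    · exact hw _ _
    · exact (hbc w hw).1
  have hR : Admissible S.γ (extR1 (bc w) w i) := by
    rw [extR1]; split_ifs
    · exact hw _ _
    · exact (hbc w hw).2
  have hB := S.lineBoundary_ge hk hsp hφ 0 (w i) (hw i) hL hR
  -- This kills the κ term of `lineBoundary_ge`: in one dimension an LDF normal field has equal end
  -- values in each cell.
  have hjump : mag (w i (Fin.last k)) 0 - mag (w i 0) 0 = 0 := by
    rw [← S.sum_weight_sum_diff hk fun p => mag (w i p) 0]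
    simp [S.sum_diff_mag_eq_zero1 hk hldf]
  rw [hjump, zero_mul, sub_zero] at hB
  have hev := congrArg φ (S.h_smul_avg1_L1 hk hfS bc w hw i)
  rw [S.vol1_eq_zero hk hldf, sub_zero, map_smul, smul_eq_mul] at hev
  have e1 : S.avg1 ((w + τ • S.L1 bc w) i) = S.avg1 (w i) + τ • S.avg1 (S.L1 bc w i) := by
    simp only [avg1, Pi.add_apply, Pi.smul_apply, smul_add, Finset.sum_add_distrib]
    congr 1
    simp only [Finset.smul_sum]
    exact Finset.sum_congr rfl fun α _ => by rw [smul_comm _ τ, smul_comm _ τ]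
  have e2 : φ (S.avg1 (w i)) + c = ∑ α, S.X.weight α / 2 * (φ (w i α) + c) := by
    simp only [avg1, map_smul, map_sum, smul_eq_mul, mul_add, Finset.sum_add_distrib,
      ← Finset.sum_mul, ← Finset.sum_div, S.X.sum_weight, Finset.mul_sum]
    rw [div_self two_ne_zero, one_mul]
    congr 1
    exact Finset.sum_congr rfl fun α _ => by ring
  have e3 : φ (S.avg1 (S.L1 bc w i))
      = φ (S.lineBoundary 0 (w i) (extL1 (bc w) w i) (extR1 (bc w) w i)) / G.h := by
    rw [← hev]; field_simp
  rw [e1, map_add, map_smul, smul_eq_mul, e3, add_right_comm, e2]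
  set σ := S.nodeSpeed 0 (w i) (extL1 (bc w) w i) (extR1 (bc w) w i) with hσ
  -- The CFL condition is exactly the positivity of the coefficients in this lower bound for the
  -- updated functional.
  have hpos : 0 < ∑ α, (S.X.weight α / 2 - τ * (σ α / G.h)) * (φ (w i α) + c) := by
    refine Finset.sum_pos (fun α _ => mul_pos ?_ (hφ.pos _ (hw i α))) Finset.univ_nonempty
    have hc : τ * (σ α / G.h) < S.X.weight 0 / 2 := hcfl i α
    have h0 := S.X.weight_pos hk 0
    have hα := S.X.weight_pos hk α
    have hs : S.X.weight 0 * σ α = S.X.weight α * σ α := S.weight_zero_mul_nodeSpeed hk _ _ _ _ _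
    have hmul := mul_lt_mul_of_pos_left hc hα
    have hs' : S.X.weight α * (τ * (σ α / G.h)) = S.X.weight 0 * (τ * (σ α / G.h)) := by
      linear_combination (-(τ / G.h)) * hs
    rw [hs'] at hmul
    have : S.X.weight 0 * (τ * (σ α / G.h)) < S.X.weight 0 * (S.X.weight α / 2) := by linarith
    linarith [lt_of_mul_lt_mul_left this h0.le]
  refine lt_of_lt_of_le hpos ?_
  have e4 : ∑ α, (S.X.weight α / 2 - τ * (σ α / G.h)) * (φ (w i α) + c)
      = ∑ α, S.X.weight α / 2 * (φ (w i α) + c)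
        + τ * (-(∑ α, σ α * (φ (w i α) + c)) / G.h) := by
    rw [neg_div, Finset.sum_div, mul_neg, Finset.mul_sum, ← sub_eq_add_neg,
      ← Finset.sum_sub_distrib]
    exact Finset.sum_congr rfl fun α _ => by ring
  rw [e4]
  gcongr

theorem avgAdmissible_euler (hk : 1 ≤ k) (hγ : 1 < S.γ) (hfS : IsTwoPointFlux S.γ S.fS)
    (hsp : PPSpeeds S.γ S.SL S.SR) {bc : Sol k G → Ghost k G}
    (hbc : ∀ w, NodallyAdmissible S.γ w → (bc w).AllAdmissible S.γ)
    {w : Sol k G} {τ : ℝ} (hw : NodallyAdmissible S.γ w) (hldf : S.LDF w)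
    (hτ : 0 ≤ τ) (hcfl : S.CFL bc w τ) : S.AvgAdmissible (S.euler bc τ w) := by
  intro i j
  have hx := G.hx_pos
  have hy := G.hy_pos
  obtain ⟨hg1, hg2⟩ := hbc w hw
  refine admissible_of_forms hγ fun φ c κ hφ => ?_
  have hL : ∀ β, Admissible S.γ (extLeft (bc w) w i j β) := fun β => by
    rw [extLeft]; split_ifs
    · exact hw _ _ _ _
    · exact (hg1 _ _).1
  have hR : ∀ β, Admissible S.γ (extRight (bc w) w i j β) := fun β => by
    rw [extRight]; split_ifs
    · exact hw _ _ _ _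
    · exact (hg1 _ _).2
  have hBo : ∀ α, Admissible S.γ (extBottom (bc w) w i j α) := fun α => by
    rw [extBottom]; split_ifs
    · exact hw _ _ _ _
    · exact (hg2 _ _).1
  have hT : ∀ α, Admissible S.γ (extTop (bc w) w i j α) := fun α => by
    rw [extTop]; split_ifs
    · exact hw _ _ _ _
    · exact (hg2 _ _).2
  obtain ⟨σx, hσx⟩ : ∃ σx : Fin (k + 1) → Fin (k + 1) → ℝ, ∀ α β,
      S.nodeSpeed 0 (fun p => w i j p β) (extLeft (bc w) w i j β) (extRight (bc w) w i j β) α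
        = σx α β := ⟨_, fun _ _ => rfl⟩
  obtain ⟨σy, hσy⟩ : ∃ σy : Fin (k + 1) → Fin (k + 1) → ℝ, ∀ α β,
      S.nodeSpeed 1 (fun q => w i j α q) (extBottom (bc w) w i j α) (extTop (bc w) w i j α) β
        = σy α β := ⟨_, fun _ _ => rfl⟩
  obtain ⟨Y, hY⟩ : ∃ Y : Fin (k + 1) → Fin (k + 1) → ℝ, ∀ α β, φ (w i j α β) + c = Y α β :=
    ⟨_, fun _ _ => rfl⟩
  have hYpos : ∀ α β, 0 < Y α β := fun α β => by rw [← hY]; exact hφ.pos _ (hw i j α β)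
  have b0 : ∀ β, -(∑ α, σx α β * Y α β)
      - (mag (w i j (Fin.last k) β) 0 - mag (w i j 0 β) 0) * κ
      ≤ φ (S.lineBoundary 0 (fun p => w i j p β) (extLeft (bc w) w i j β)
        (extRight (bc w) w i j β)) := fun β => by
    have := S.lineBoundary_ge hk hsp hφ 0 (fun p => w i j p β) (fun p => hw i j p β) (hL β) (hR β)
    simpa only [hσx, hY] using this
  have b1 : ∀ α, -(∑ β, σy α β * Y α β)
      - (mag (w i j α (Fin.last k)) 1 - mag (w i j α 0) 1) * κ
      ≤ φ (S.lineBoundary 1 (fun q => w i j α q) (extBottom (bc w) w i j α)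
        (extTop (bc w) w i j α)) := fun α => by
    have := S.lineBoundary_ge hk hsp hφ 1 (fun q => w i j α q) (fun q => hw i j α q) (hBo α) (hT α)
    simpa only [hσy, hY] using this
  -- The κ terms of single lines have no sign. Weighted and summed over both directions they form κ
  -- times the net magnetic flux of the cell, which vanishes.
  have hbt : -(G.hy * ∑ β, S.X.weight β / 2 * ∑ α, σx α β * Y α β)
      - G.hx * ∑ α, S.X.weight α / 2 * ∑ β, σy α β * Y α β ≤ φ (S.boundaryTerm bc w i j) := by
    have hB0 := mul_le_mul_of_nonneg_left (Finset.sum_le_sum fun β (_ : β ∈ Finset.univ) =>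
      mul_le_mul_of_nonneg_left (b0 β) (half_pos (S.X.weight_pos hk β)).le) hy.le
    have hB1 := mul_le_mul_of_nonneg_left (Finset.sum_le_sum fun α (_ : α ∈ Finset.univ) =>
      mul_le_mul_of_nonneg_left (b1 α) (half_pos (S.X.weight_pos hk α)).le) hx.le
    have hnet := S.net_flux_eq_zero hk hldf i j
    simp only [mul_sub, mul_neg, Finset.sum_sub_distrib, Finset.sum_neg_distrib, ← mul_assoc,
      ← Finset.sum_mul] at hB0 hB1 hnet
    simp only [boundaryTerm, map_add, map_smul, map_sum, smul_eq_mul]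
    have hnetκ := congrArg (· * κ) hnet
    simp only [zero_mul, add_mul, sub_mul] at hnetκ
    linarith
  have hev := congrArg φ (S.h_smul_avg_L hk hfS bc w hw i j)
  rw [S.volumeTerm_eq_zero hk hldf, sub_zero, map_smul, smul_eq_mul] at hev
  have e1 : S.avg (S.euler bc τ w i j) = S.avg (w i j) + τ • S.avg (S.L bc w i j) := by
    change S.avg (w i j + τ • S.L bc w i j) = _
    rw [← avgLin_apply, map_add, map_smul]; rfl
  have e2 : φ (S.avg (w i j)) + c = ∑ α, ∑ β, S.X.weight α * S.X.weight β / 4 * Y α β := by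
    have h4 : c = (1 / 4) * ∑ α, ∑ β, S.X.weight α * S.X.weight β * c := by
      simp only [← Finset.sum_mul, sum_weight_mul_weight]; ring
    rw [map_avg, smul_eq_mul]
    nth_rewrite 1 [h4]
    rw [← mul_add]
    simp only [← Finset.sum_add_distrib, Finset.mul_sum, smul_eq_mul, ← hY]
    exact Finset.sum_congr rfl fun α _ => Finset.sum_congr rfl fun β _ => by ring
  have e3 : φ (S.avg (S.L bc w i j)) = φ (S.boundaryTerm bc w i j) / (G.hx * G.hy) := by
    rw [← hev]; field_simp
  rw [e1, map_add, map_smul, smul_eq_mul, e3, add_right_comm, e2]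
  have hpos : 0 < ∑ α, ∑ β, (S.X.weight α * S.X.weight β / 4
      - τ * (S.X.weight β / 2 * σx α β / G.hx + S.X.weight α / 2 * σy α β / G.hy)) * Y α β := by
    refine Finset.sum_pos (fun α _ => Finset.sum_pos (fun β _ => mul_pos ?_ (hYpos α β))
      Finset.univ_nonempty) Finset.univ_nonempty
    have hc : τ * (σx α β / G.hx + σy α β / G.hy) < S.X.weight 0 / 2 := by
      rw [← hσx, ← hσy]; exact hcfl i j α β
    have h0 := S.X.weight_pos hk 0
    have hα := S.X.weight_pos hk α
    have hβ := S.X.weight_pos hk β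
    have sx : S.X.weight 0 * σx α β = S.X.weight α * σx α β := by
      rw [← hσx]; exact S.weight_zero_mul_nodeSpeed hk _ _ _ _ _
    have sy : S.X.weight 0 * σy α β = S.X.weight β * σy α β := by
      rw [← hσy]; exact S.weight_zero_mul_nodeSpeed hk _ _ _ _ _
    -- The CFL inequality is multiplied by both nodal weights; exchanging the weight along each line
    -- with the end weight then gives a nodal coefficient that is positive up to the factor
    -- `S.X.weight 0`.
    have hmul := mul_lt_mul_of_pos_left hc (mul_pos hα hβ)
    have : S.X.weight 0 * (τ * (S.X.weight β / 2 * σx α β / G.hx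
          + S.X.weight α / 2 * σy α β / G.hy))
        = S.X.weight α * S.X.weight β * (τ * (σx α β / G.hx + σy α β / G.hy)) / 2 := by
      linear_combination (τ * S.X.weight β / 2 / G.hx) * sx + (τ * S.X.weight α / 2 / G.hy) * sy
    refine sub_pos.2 (lt_of_mul_lt_mul_left ?_ h0.le)
    rw [this]
    linarith
  refine lt_of_lt_of_le hpos ?_
  have e4 : ∑ α, ∑ β, (S.X.weight α * S.X.weight β / 4
      - τ * (S.X.weight β / 2 * σx α β / G.hx + S.X.weight α / 2 * σy α β / G.hy)) * Y α β
      = ∑ α, ∑ β, S.X.weight α * S.X.weight β / 4 * Y α β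
        + τ * ((-(G.hy * ∑ β, S.X.weight β / 2 * ∑ α, σx α β * Y α β)
          - G.hx * ∑ α, S.X.weight α / 2 * ∑ β, σy α β * Y α β) / (G.hx * G.hy)) := by
    have c1 : ∑ β, S.X.weight β / 2 * ∑ α, σx α β * Y α β
        = ∑ α, ∑ β, S.X.weight β / 2 * (σx α β * Y α β) := by
      simp only [Finset.mul_sum]
      exact Finset.sum_comm
    rw [c1]
    simp only [Finset.mul_sum]
    rw [← Finset.sum_neg_distrib]
    simp only [← Finset.sum_neg_distrib, ← Finset.sum_sub_distrib, Finset.sum_div, Finset.mul_sum,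
      ← Finset.sum_add_distrib]
    refine Finset.sum_congr rfl fun α _ => Finset.sum_congr rfl fun β _ => ?_
    field_simp
    ring
  rw [e4]
  gcongr

/-! ### Runge-Kutta methods -/

theorem avgAdmissible_raw (hk : 1 ≤ k) (hγ : 1 < S.γ) (hfS : IsTwoPointFlux S.γ S.fS)
    (hsp : PPSpeeds S.γ S.SL S.SR) {bc : Sol k G → Ghost k G}
    (hbc : ∀ w, NodallyAdmissible S.γ w → (bc w).AllAdmissible S.γ)
    (R : ConvexEuler) {Δt : ℝ} (hΔt : 0 < Δt) {W : ℕ → Sol k G} {i : ℕ} (hi : i < R.s)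
    (hW : ∀ j ≤ i, NodallyAdmissible S.γ (W j) ∧ S.LDF (W j))
    (hcfl : ∀ j ≤ i, R.a i j ≠ 0 → S.CFL bc (W j) (R.r i j * Δt)) :
    S.AvgAdmissible (R.raw S bc Δt W i) := by
  intro a b
  have e : S.avg (R.raw S bc Δt W i a b)
      = ∑ j ∈ Finset.range (i + 1), R.a i j • S.avg (S.euler bc (R.r i j * Δt) (W j) a b) := by
    have : R.raw S bc Δt W i a b
        = ∑ j ∈ Finset.range (i + 1), R.a i j • S.euler bc (R.r i j * Δt) (W j) a b := by
      simp only [ConvexEuler.raw, Finset.sum_apply, Pi.smul_apply]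
    rw [this, ← avgLin_apply, map_sum]
    simp only [map_smul, avgLin_apply]
  rw [e]
  have hle : ∀ j ∈ Finset.range (i + 1), j ≤ i := fun j hj =>
    Nat.lt_succ_iff.1 (Finset.mem_range.1 hj)
  exact admissible_sum hγ _ _ _ (fun j hj => R.a_nonneg i hi j (hle j hj)) (R.a_sum i hi)
    fun j hj hne => S.avgAdmissible_euler hk hγ hfS hsp hbc (hW j (hle j hj)).1
      (hW j (hle j hj)).2 (mul_nonneg (R.r_nonneg i hi j (hle j hj)) hΔt.le)
      (hcfl j (hle j hj) hne) a b

/-- One time step of a method made of convex combinations of forward Euler steps. -/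
theorem convexEuler_step (hk : 1 ≤ k) (hγ : 1 < S.γ) (hfS : IsTwoPointFlux S.γ S.fS)
    (hsp : PPSpeeds S.γ S.SL S.SR) {bc : Sol k G → Ghost k G}
    (hbc : ∀ w, NodallyAdmissible S.γ w → (bc w).AllAdmissible S.γ)
    {δ : Fin (k + 1) → Sol k G → Fin G.Nx → Fin G.Ny → ℝ} {ε : ℝ} (hε : 0 < ε)
    (R : ConvexEuler) {Δt : ℝ} (hΔt : 0 < Δt) {W : ℕ → Sol k G}
    (h0 : NodallyAdmissible S.γ (W 0) ∧ S.LDF (W 0))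
    (hlim : ∀ i < R.s, S.IsLimited δ ε Δt (R.raw S bc Δt W i) (W (i + 1)))
    (hcfl : ∀ i < R.s, ∀ j ≤ i, R.a i j ≠ 0 → S.CFL bc (W j) (R.r i j * Δt)) :
    ∀ i ≤ R.s, NodallyAdmissible S.γ (W i) ∧ S.LDF (W i) := by
  intro i
  -- A stage may combine Euler steps from all earlier stages, so all of them must be known to be
  -- admissible and LDF.
  induction i using Nat.strong_induction_on with
  | _ i ih =>
    intro hi
    rcases i with _ | i
    · exact h0
    · have hraw := S.avgAdmissible_raw hk hγ hfS hsp hbc R hΔt (Nat.lt_of_succ_le hi)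
        (fun j hj => ih j (by omega) (by omega)) (hcfl i (Nat.lt_of_succ_le hi))
      have := S.isLimited_spec hk hγ hε (hlim i (Nat.lt_of_succ_le hi)) hraw
      exact ⟨this.1, this.2.1⟩

theorem avgAdmissible_convex (hγ : 1 < S.γ) {a b : ℝ} (ha : 0 ≤ a) (hb : 0 ≤ b)
    (hab : a + b = 1) {w z : Sol k G} (hw : S.AvgAdmissible w) (hz : S.AvgAdmissible z) :
    S.AvgAdmissible (a • w + b • z) := by
  intro i j
  have e : S.avg ((a • w + b • z) i j) = a • S.avg (w i j) + b • S.avg (z i j) := by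
    change S.avg (a • w i j + b • z i j) = _
    rw [← avgLin_apply, map_add, map_smul, map_smul]; rfl
  rw [e]
  exact admissible_add hγ ha hb hab (hw i j) (hz i j)

end Disc

end MHD

end

/-! ### Assembly of the theorem -/

theorem mainTheorem4 {k : ℕ} (hk : 1 ≤ k) (S : Disc k) (hγ : 1 < S.γ)
    (hfS : IsTwoPointFlux S.γ S.fS) (hsp : PPSpeeds S.γ S.SL S.SR) :
    -- the Chandrashekar flux is an instance of the volume flux
    IsTwoPointFlux S.γ (chandrashekar S.γ) ∧
    -- one space dimension
    (∀ (G : Grid1) (bc : Sol1 k G → State × State),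
      (∀ w, (∀ i α, Admissible S.γ (w i α)) →
        Admissible S.γ (bc w).1 ∧ Admissible S.γ (bc w).2) →
      -- evolution of the cell averages
      (∀ (w : ℝ → Sol1 k G) (t : ℝ), (∀ i α, Admissible S.γ (w t i α)) →
        (∀ i α, HasDerivAt (fun s => w s i α) (S.L1 bc (w t) i α) t) →
        ∀ i, ∃ d, HasDerivAt (fun s => S.avg1 (w s i)) d t ∧
          G.h • d + S.vol1 (w t i) =
            S.lineBoundary 0 (w t i) (Disc.extL1 (bc (w t)) (w t) i)
              (Disc.extR1 (bc (w t)) (w t) i)) ∧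
      -- the volume term vanishes and the forward Euler step has admissible averages
      (∀ w : Sol1 k G, S.LDF1 w → ∀ i, S.vol1 (w i) = 0) ∧
      (∀ (w : Sol1 k G) (τ : ℝ), (∀ i α, Admissible S.γ (w i α)) → S.LDF1 w →
        0 ≤ τ → S.CFL1 bc w τ →
        ∀ i, Admissible S.γ (S.avg1 ((w + τ • S.L1 bc w) i)))) ∧
    -- two space dimensions
    (∀ (G : Grid) (bc : Sol k G → Ghost k G),
      (∀ w, NodallyAdmissible S.γ w → (bc w).AllAdmissible S.γ) →
      -- evolution of the cell averages
      (∀ (w : ℝ → Sol k G) (t : ℝ), NodallyAdmissible S.γ (w t) →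
        (∀ i j α β, HasDerivAt (fun s => w s i j α β) (S.L bc (w t) i j α β) t) →
        ∀ i j, ∃ d, HasDerivAt (fun s => S.avg (w s i j)) d t ∧
          (G.hx * G.hy) • d + S.volumeTerm (w t) i j = S.boundaryTerm bc (w t) i j) ∧
      -- the discrete divergence is the divergence at the LGL nodes
      (∀ (w : Sol k G) i j α β, S.discDiv w i j α β =
        S.divB w i j (G.xc i + G.hx / 2 * S.X.node α) (G.yc j + G.hy / 2 * S.X.node β)) ∧
      -- hence the volume term vanishes for a locally divergence-free field
      (∀ w : Sol k G, S.LDF w → ∀ i j, S.volumeTerm w i j = 0) ∧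
      -- the LDF projection is well defined, yields such a field and keeps the cell averages
      (∀ w : Sol k G, ∃! w', S.IsLDFProjection w w') ∧
      (∀ w w' : Sol k G, S.IsLDFProjection w w' →
        S.LDF w' ∧ ∀ i j, S.avg (w' i j) = S.avg (w i j)) ∧
      -- forward Euler
      (∀ (w : Sol k G) (τ : ℝ), NodallyAdmissible S.γ w → S.LDF w →
        0 ≤ τ → S.CFL bc w τ → S.AvgAdmissible (S.euler bc τ w)) ∧
      -- damping and limiting, Runge-Kutta methods
      (∀ (δ : Fin (k + 1) → Sol k G → Fin G.Nx → Fin G.Ny → ℝ) (ε : ℝ), 0 < ε →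
        (∀ (w : Sol k G) (τ : ℝ), (S.LDF w → S.LDF (S.oedg δ τ w)) ∧
          ∀ i j, S.avg (S.oedg δ τ w i j) = S.avg (w i j)) ∧
        (∀ w : Sol k G, (S.LDF w → S.LDF (S.ppLimiter ε w)) ∧
          (∀ i j, S.avg (S.ppLimiter ε w i j) = S.avg (w i j)) ∧
          (S.AvgAdmissible w → NodallyAdmissible S.γ (S.ppLimiter ε w))) ∧
        -- `n` time steps of a method made of convex combinations of forward Euler steps
        (∀ (R : ConvexEuler) (Δt : ℕ → ℝ) (w : ℕ → Sol k G) (W : ℕ → ℕ → Sol k G),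
          (∀ n, 0 < Δt n) →
          NodallyAdmissible S.γ (w 0) → S.LDF (w 0) →
          (∀ n, W n 0 = w n ∧ w (n + 1) = W n R.s) →
          (∀ n, ∀ i < R.s, S.IsLimited δ ε (Δt n) (R.raw S bc (Δt n) (W n) i) (W n (i + 1))) →
          (∀ n, ∀ i < R.s, ∀ j ≤ i, R.a i j ≠ 0 → S.CFL bc (W n j) (R.r i j * Δt n)) →
          ∀ n, (∀ i < R.s, S.AvgAdmissible (R.raw S bc (Δt n) (W n) i)) ∧
            (∀ i ≤ R.s, NodallyAdmissible S.γ (W n i) ∧ S.LDF (W n i) ∧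
              S.AvgAdmissible (W n i))) ∧
        -- the third order SSP Runge-Kutta method
        (∀ (Δt : ℝ) (w w₁ w₂ w₃ : Sol k G), 0 < Δt →
          NodallyAdmissible S.γ w → S.LDF w →
          S.IsLimited δ ε Δt (w + Δt • S.L bc w) w₁ →
          S.IsLimited δ ε Δt
            ((3 / 4 : ℝ) • w + (1 / 4 : ℝ) • (w₁ + Δt • S.L bc w₁)) w₂ →
          S.IsLimited δ ε Δt
            ((1 / 3 : ℝ) • w + (2 / 3 : ℝ) • (w₂ + Δt • S.L bc w₂)) w₃ →
          S.CFL bc w Δt → S.CFL bc w₁ Δt → S.CFL bc w₂ Δt →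
          S.AvgAdmissible (w + Δt • S.L bc w) ∧
          S.AvgAdmissible ((3 / 4 : ℝ) • w + (1 / 4 : ℝ) • (w₁ + Δt • S.L bc w₁)) ∧
          S.AvgAdmissible ((1 / 3 : ℝ) • w + (2 / 3 : ℝ) • (w₂ + Δt • S.L bc w₂)) ∧
          S.AvgAdmissible w₃ ∧ NodallyAdmissible S.γ w₃ ∧ S.LDF w₃))) := by
  refine ⟨isTwoPointFlux_chandrashekar hγ, fun G bc hbc => ⟨?_, ?_, ?_⟩,
    fun G bc hbc => ⟨?_, ?_, ?_, ?_, ?_, ?_, ?_⟩⟩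
  · intro w t hw hd i
    refine ⟨_, S.hasDerivAt_avg1 (hd i), ?_⟩
    rw [S.h_smul_avg1_L1 hk hfS bc (w t) hw i, sub_add_cancel]
  · exact fun w h i => S.vol1_eq_zero hk h i
  · exact fun w τ hw hldf hτ hcfl i =>
      S.avg1_admissible_euler hk hγ hfS hsp hbc hw hldf hτ hcfl i
  · intro w t hw hd i j
    refine ⟨_, S.hasDerivAt_avg (hd i j), ?_⟩
    rw [S.h_smul_avg_L hk hfS bc (w t) hw i j, sub_add_cancel]
  · exact S.discDiv_eq_divB
  · exact fun w h i j => S.volumeTerm_eq_zero hk h i j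
  · exact S.existsUnique_isLDFProjection hk
  · exact fun w w' h => ⟨S.LDF_of_isLDFProjection hk h, S.avg_of_isLDFProjection h⟩
  · exact fun w τ hw hldf hτ hcfl => S.avgAdmissible_euler hk hγ hfS hsp hbc hw hldf hτ hcfl
  · intro δ ε hε
    refine ⟨fun w τ => ⟨S.LDF_oedg δ τ, S.avg_oedg δ τ w⟩,
      fun w => ⟨S.LDF_ppLimiter ε, S.avg_ppLimiter ε w, S.nodallyAdmissible_ppLimiter hγ hε⟩,
      ?_, ?_⟩
    · intro R Δt w W hΔt hw0 hldf0 hW hlim hcfl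
      have step : ∀ n, NodallyAdmissible S.γ (w n) ∧ S.LDF (w n) →
          ∀ i ≤ R.s, NodallyAdmissible S.γ (W n i) ∧ S.LDF (W n i) := fun n hn =>
        S.convexEuler_step hk hγ hfS hsp hbc hε R (hΔt n) ((hW n).1 ▸ hn) (hlim n) (hcfl n)
      have hall : ∀ n, NodallyAdmissible S.γ (w n) ∧ S.LDF (w n) := by
        intro n
        induction n with
        | zero => exact ⟨hw0, hldf0⟩
        | succ n ih => rw [(hW n).2]; exact step n ih R.s le_rfl
      intro n
      have hn := step n (hall n)
      exact ⟨fun i hi => S.avgAdmissible_raw hk hγ hfS hsp hbc R (hΔt n) hi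
          (fun j hj => hn j (hj.trans hi.le)) (hcfl n i hi),
        fun i hi => ⟨(hn i hi).1, (hn i hi).2,
          S.avgAdmissible_of_nodallyAdmissible hk hγ (hn i hi).1⟩⟩
    · intro Δt w w₁ w₂ w₃ hΔt hw hldf h1 h2 h3 c0 c1 c2
      have avgw := S.avgAdmissible_of_nodallyAdmissible hk hγ hw
      have r1 : S.AvgAdmissible (w + Δt • S.L bc w) :=
        S.avgAdmissible_euler hk hγ hfS hsp hbc hw hldf hΔt.le c0
      obtain ⟨n1, l1, -⟩ := S.isLimited_spec hk hγ hε h1 r1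
      -- The part taken from the old solution has admissible averages because its nodal values are
      -- admissible.
      have r2 := S.avgAdmissible_convex hγ (a := 3 / 4) (b := 1 / 4) (by norm_num) (by norm_num)
        (by norm_num) avgw (S.avgAdmissible_euler hk hγ hfS hsp hbc n1 l1 hΔt.le c1)
      obtain ⟨n2, l2, -⟩ := S.isLimited_spec hk hγ hε h2 r2
      have r3 := S.avgAdmissible_convex hγ (a := 1 / 3) (b := 2 / 3) (by norm_num) (by norm_num)
        (by norm_num) avgw (S.avgAdmissible_euler hk hγ hfS hsp hbc n2 l2 hΔt.le c2)
      obtain ⟨n3, l3, a3⟩ := S.isLimited_spec hk hγ hε h3 r3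
      exact ⟨r1, r2, r3, a3, n3, l3⟩
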